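/- **Conventions.** Let $0\le k\le n$. $\mathrm{Br}_m$ is the braid group on $m$ strands with Artin generators $\sigma_1,\dots,\sigma_{m-1}$ ($\sigma_i$ is the positive crossing of the strands in positions $i,i+1$ counted from the top), $\sigma_{[a,b]}=\sigma_b\sigma_{b-1}\cdots\sigma_a$ (trivial if $b<a$), and $\Delta_m=(\sigma_1)(\sigma_2\sigma_1)\cdots(\sigma_{m-1}\cdots\sigma_1)$. Permutations are composed as functions. A *positroid pair* is a pair $u,w\in S_n$ such that $w^{-1}(1)<\dots<w^{-1}(k)$, $w^{-1}(k+1)<\dots<w^{-1}(n)$, and $u\le w$ in the Bruhat order. *Richardson braid.* $R_n(u,w)=\beta(w)\beta(u)^{-1}\in\mathrm{Br}_n$, where $\beta(v)$ is the positive lift of any reduced word of $v$. *Juggling braid.* Let $f=u^{-1}t_kw:\mathbb Z\to\mathbb Z$, where $t_k=[1+n,\dots,k+n,k+1,\dots,n]$ and $u,w$ are extended $n$-periodically; thus, for $i\in[1,n]$, $f(i)=u^{-1}(w(i))+n$ if $w(i)\le k$, and $f(i)=u^{-1}(w(i))$ otherwise. For $i\in[1,n]$ draw the upper half-circle arc $A_i$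 from $(f(i),0)$ to $(i,0)$, declare all crossings positive and smooth the arcs at common endpoints; the resulting $k$-strand braid, read from right to left, is $J_k(u,w)$. Sweeping out the arcs by their right ends writes it as $J_k(u,w)=\sigma_{[a_n,b_n]}\cdots\sigma_{[a_1,b_1]}$, where the $r$-th interval belongs to the arc $A_i$ with the $r$-th smallest value $f(i)$, $a_r=1+\#\{x\in[1,n]: x<i,\ f(i)<f(x)\}$ and $b_r=a_r-1+\#\{x\in[1,n]: i<x<f(i)<f(x)\}$. Put $J^{(1)}(u,w)=\sigma_{[a_{n-k},b_{n-k}]}\cdots\sigma_{[a_1,b_1]}$ (the arcs with $f(i)\le n$) and $J^{(2)}(u,w)=\sigma_{[a_n,b_n]}\cdots\sigma_{[a_{n-k+1},b_{n-k+1}]}$, so that $J_k(u,w)=J^{(2)}(u,w)J^{(1)}(u,w)$. *Le diagram and Le braid.* Let $\lambda\subseteq(n-k)^k$ be the partition with $w^{-1}(k+1-i)=k+1-i+\lambda_i$ for $i\in[1,k]$, drawn in French notation (row $1$ at the bottom). A Le diagram in $\lambda$ is a set of dots in boxes of $\lambda$ such that, whenever there are dots in boxes $(r_1,c_1)$ and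 $(r_2,c_2)$ with $r_1\le r_2$, $c_2\le c_1$ and $(r_2,c_1)$ is a box of $\lambda$, there is a dot in $(r_2,c_1)$. It is the Le diagram of $(u,w)$ if $u$ is the product of the $s_{k+j-i}$ over the boxes $(i,j)$ without dot, read by columns from left to right and each column from the bottom up. The Le braid $D_k(u,w)\in\mathrm{Br}_k$ is the concatenation of the column tangles of this diagram, the right-most column being drawn first (at the left). In the tangle of a column, row $i$ corresponds to position $k+1-i$ from the top; the strands in positions without dot are horizontal; every dot strand except the lowest goes down to the position of the next dot, over the horizontal strands; and the lowest dot strand goes up to the position of the highest dot, over all other strands. **Theorem.** Let $u,w\in S_n$ be a positroid pair. Then a Le diagram of $(u,w)$ exists, the associated Le braid satisfies $$D_k(u,w)=J^{(1)}(u,w)\,\Delta_k^{-1}\,J^{(2)}(u,w)\quad\text{in }\mathrm{Br}_k,$$ and $J_k(u,w)\Delta_k^{-1}$ is conjugate to $D_k(u,w)$ in $\mathrm{Br}_k$. Moreover, each of $D_k(u,w)$ and $J_k(u,w)\Delta_k^{-1}$ is obtained from $R_n(u,w)$ by a finite sequence of braid moves, conjugations, positive destabilizations ($\mathrm{Br}_{m+1}\ni\beta\sigma_m\to\beta\in\mathrm{Br}_m$,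 $m\ge1$) and exactly $s$ deletions of an unlinked disjoint strand ($\mathrm{Br}_{m+1}\ni\beta\to\beta\in\mathrm{Br}_m$), where $s$ is the number of fixed points of $f$ in $[1,n]$; in particular, if $f$ has no fixed point, braid moves, conjugations and positive destabilizations suffice. -/

import Mathlib

open Equiv

/-! ### Braid groups -/

/-- The Artin relations on generators `σ_1, …, σ_{n-1}`; the generator `σ_i` is indexed by the
element `i - 1` of `Fin (n - 1)`. -/
def braidRelations (n : ℕ) : Set (FreeGroup (Fin (n - 1))) :=
  {r | ∃ i j : Fin (n - 1), (i : ℕ) + 1 < j ∧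
      r = FreeGroup.of i * FreeGroup.of j * (FreeGroup.of j * FreeGroup.of i)⁻¹} ∪
  {r | ∃ i j : Fin (n - 1), (i : ℕ) + 1 = j ∧
      r = FreeGroup.of i * FreeGroup.of j * FreeGroup.of i *
        (FreeGroup.of j * FreeGroup.of i * FreeGroup.of j)⁻¹}

/-- The braid group on `n` strands, in Artin's presentation. Equality in this group is equivalence
of braid words under the braid moves (Reidemeister II and III moves, far commutations). -/
abbrev BraidGroup (n : ℕ) : Type := PresentedGroup (braidRelations n)

/-- The Artin generator `σ_i`, `1 ≤ i ≤ n - 1` (and `1` for an index out of this range). It is the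
positive crossing of the strands in positions `i` and `i + 1`, counted from the top. -/
def sigma (n i : ℕ) : BraidGroup n :=
  if h : 1 ≤ i ∧ i < n then PresentedGroup.of (⟨i - 1, by omega⟩ : Fin (n - 1)) else 1

/-- The standard inclusion of `Br_n` into `Br_{n+1}`, `σ_i ↦ σ_i`, which adds a disjoint trivial
strand in position `n + 1`. -/
def addStrand (n : ℕ) : BraidGroup n →* BraidGroup (n + 1) :=
  PresentedGroup.toGroup
    (f := fun i : Fin (n - 1) =>
      (PresentedGroup.of (⟨i, by omega⟩ : Fin (n + 1 - 1)) : BraidGroup (n + 1))) <| by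
    rintro r (⟨i, j, hij, rfl⟩ | ⟨i, j, hij, rfl⟩)
    · simp only [map_mul, map_inv, FreeGroup.lift_apply_of]
      rw [mul_inv_eq_one]
      have h : PresentedGroup.mk (braidRelations (n + 1)) _ = 1 :=
        PresentedGroup.one_of_mem (rels := braidRelations (n + 1))
          (Or.inl ⟨⟨i, by omega⟩, ⟨j, by omega⟩, hij, rfl⟩)
      rw [map_mul, map_inv, mul_inv_eq_one] at h
      simp only [map_mul] at h
      exact h
    · simp only [map_mul, map_inv, FreeGroup.lift_apply_of]
      rw [mul_inv_eq_one]
      have h : PresentedGroup.mk (braidRelations (n + 1)) _ = 1 :=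
        PresentedGroup.one_of_mem (rels := braidRelations (n + 1))
          (Or.inr ⟨⟨i, by omega⟩, ⟨j, by omega⟩, hij, rfl⟩)
      rw [map_mul, map_inv, mul_inv_eq_one] at h
      simp only [map_mul] at h
      exact h

/-- The interval braid `σ_{[a,b]} = σ_b σ_{b-1} ⋯ σ_a` (trivial if `b < a`). -/
def intervalBraid (n a b : ℕ) : BraidGroup n :=
  ((List.range' a (b + 1 - a)).reverse.map (sigma n)).prod

/-- The half twist `Δ_n = (σ_1)(σ_2 σ_1) ⋯ (σ_{n-1} ⋯ σ_1)`. -/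
def halfTwist (n : ℕ) : BraidGroup n :=
  ((List.range' 1 (n - 1)).map (intervalBraid n 1)).prod

/-- `MarkovReduces α s β`: the braid `β` is obtained from the braid `α` by a finite sequence of
braid moves (equalities in the braid group), conjugations, positive destabilizations
`Br_{m+1} ∋ β σ_m ⟶ β ∈ Br_m` (with `m ≥ 1`), and exactly `s` deletions of an unlinked disjoint
strand `Br_{m+1} ∋ β ⟶ β ∈ Br_m`. -/
inductive MarkovReduces {n : ℕ} (α : BraidGroup n) : ℕ → {m : ℕ} → BraidGroup m → Prop
  | refl : MarkovReduces α 0 α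
  | conj {s m : ℕ} {β γ : BraidGroup m} :
      MarkovReduces α s β → IsConj β γ → MarkovReduces α s γ
  | destabilize {s m : ℕ} {β : BraidGroup m} : 1 ≤ m →
      MarkovReduces α s (addStrand m β * sigma (m + 1) m) → MarkovReduces α s β
  | deleteStrand {s m : ℕ} {β : BraidGroup m} :
      MarkovReduces α s (addStrand m β) → MarkovReduces α (s + 1) β

/-! ### Permutations, Bruhat order, positroid pairs

`S_n` is `Perm (Fin n)`, so the letters `1, …, n` are shifted to `0, …, n - 1`. Products are
compositions of functions. -/

/-- The simple transposition `s_i = (i, i+1)`, `1 ≤ i ≤ n - 1` (and `1` out of this range). -/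
def simpleTransposition (n i : ℕ) : Perm (Fin n) :=
  if h : 1 ≤ i ∧ i < n then swap ⟨i - 1, by omega⟩ ⟨i, h.2⟩ else 1

/-- The Coxeter length of a permutation: its number of inversions. -/
def permLength {n : ℕ} (v : Perm (Fin n)) : ℕ :=
  (Finset.univ.filter fun p : Fin n × Fin n => p.1 < p.2 ∧ v p.2 < v p.1).card

/-- `a` is (the list of indices of) a reduced word `s_{a_1} ⋯ s_{a_ℓ}` of `v`. -/
def IsReducedWord {n : ℕ} (v : Perm (Fin n)) (a : List ℕ) : Prop :=
  (∀ i ∈ a, 1 ≤ i ∧ i < n) ∧ (a.map (simpleTransposition n)).prod = v ∧ a.length = permLength v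

/-- Bruhat order: the reflexive transitive closure of `v ⟶ v t`, with `t` a transposition such that
`ℓ(v) < ℓ(v t)`. -/
def BruhatLE {n : ℕ} (u w : Perm (Fin n)) : Prop :=
  Relation.ReflTransGen
    (fun v v' => ∃ i j : Fin n, v' = v * swap i j ∧ permLength v < permLength v') u w

/-- `w⁻¹(1) < ⋯ < w⁻¹(k)` and `w⁻¹(k+1) < ⋯ < w⁻¹(n)`. -/
def IsGrassmannian {n : ℕ} (k : ℕ) (w : Perm (Fin n)) : Prop :=
  ∀ i j : Fin n, i < j → ((j : ℕ) < k ∨ k ≤ (i : ℕ)) → w⁻¹ i < w⁻¹ j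

def IsPositroidPair {n : ℕ} (k : ℕ) (u w : Perm (Fin n)) : Prop :=
  IsGrassmannian k w ∧ BruhatLE u w

/-! ### Richardson braid -/

/-- The Richardson braid `β(w) β(u)⁻¹`, where the positive lifts `β(w)`, `β(u)` are given by the
words `a` of `w` and `b` of `u`. -/
def richardsonBraid (n : ℕ) (a b : List ℕ) : BraidGroup n :=
  (a.map (sigma n)).prod * ((b.map (sigma n)).prod)⁻¹

/-! ### Juggling braid -/

/-- The window `[f(1), …, f(n)]` of the bounded affine permutation `f = u⁻¹ t_k w`, where `t_k` adds
`n` to the first `k` letters; letters and values are shifted down by one, so that the values lie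
in `{0, …, 2n - 1}`. -/
def boundedAffine {n : ℕ} (k : ℕ) (u w : Perm (Fin n)) (i : Fin n) : ℕ :=
  (u⁻¹ (w i) : ℕ) + if (w i : ℕ) < k then n else 0

/-- The number of fixed points of `f` in the window. -/
def fixedCount {n : ℕ} (f : Fin n → ℕ) : ℕ :=
  (Finset.univ.filter fun i : Fin n => f i = (i : ℕ)).card

/-- The juggling diagram has an upper arc `A_i` from `(f(i), 0)` to `(i, 0)` for every `i`; the arcs `A_i`
and `A_x`, `i < x`, cross if and only if `x < f(i) < f(x)`, and then exactly once. Arcs are drawn so that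
these crossings lie next to the right end of `A_i`, where `A_i` descends steeply (another choice of the
arcs changes the braid word by Reidemeister III moves only).

`arcPosition f i` is the position of `A_i`, counted from the top, to the left of these crossings: it is
one plus the number of arcs that enclose `A_i`. -/
def arcPosition {n : ℕ} (f : Fin n → ℕ) (i : Fin n) : ℕ :=
  1 + (Finset.univ.filter fun x : Fin n => x < i ∧ f i < f x).card

/-- The number of arcs that `A_i` crosses next to its right end: the arcs `A_x` with
`i < x < f(i) < f(x)`. -/
def arcCrossings {n : ℕ} (f : Fin n → ℕ) (i : Fin n) : ℕ :=
  (Finset.univ.filter fun x : Fin n => i < x ∧ (x : ℕ) < f i ∧ f i < f x).card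

/-- The interval braid of the arc `A_i`: next to its right end, `A_i` moves from position `p` down to
position `p + c` through the `c` arcs that it crosses there, and all crossings are positive. Read from
right to left, this is `σ_{p+c-1} ⋯ σ_p`. -/
def arcBraid {n : ℕ} (k : ℕ) (f : Fin n → ℕ) (i : Fin n) : BraidGroup k :=
  intervalBraid k (arcPosition f i) (arcPosition f i + arcCrossings f i - 1)

/-- The part of the juggling braid given by the arcs with right ends in the list `ms`, in the order of
the list. -/
def jugglingPart {n : ℕ} (k : ℕ) (f : Fin n → ℕ) (ms : List ℕ) : BraidGroup k :=
  (ms.map fun m => (((List.finRange n).filter fun i => f i = m).map (arcBraid k f)).prod).prod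

/-- The juggling braid `J_k(f) = σ_{[a_n,b_n]} ⋯ σ_{[a_1,b_1]}`: the juggling diagram is read from
right to left, one interval braid for every arc, ordered by right ends. Arcs `i = f(i)` are points
and contribute trivially. -/
def jugglingBraid {n : ℕ} (k : ℕ) (f : Fin n → ℕ) : BraidGroup k :=
  jugglingPart k f (List.range (2 * n)).reverse

/-- `J⁽¹⁾_k = σ_{[a_{n-k},b_{n-k}]} ⋯ σ_{[a_1,b_1]}`: the arcs with `f(i) ≤ n`. -/
def jugglingBraid₁ {n : ℕ} (k : ℕ) (f : Fin n → ℕ) : BraidGroup k :=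
  jugglingPart k f (List.range n).reverse

/-- `J⁽²⁾_k = σ_{[a_n,b_n]} ⋯ σ_{[a_{n-k+1},b_{n-k+1}]}`: the arcs with `f(i) > n`. -/
def jugglingBraid₂ {n : ℕ} (k : ℕ) (f : Fin n → ℕ) : BraidGroup k :=
  jugglingPart k f (List.range' n n).reverse

/-! ### Le diagrams and the Le braid

Young diagrams are drawn in French notation. Rows are numbered `0, …, k - 1` from the bottom (longest)
row up, columns `0, …, n - k - 1` from left to right; a box is a pair (row, column). -/

/-- The length of row `i` of the partition `λ ⊆ (n-k)^k` of the `k`-Grassmannian permutation `w`,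
given by `w⁻¹ = [1 + λ_k, 2 + λ_{k-1}, …, k + λ_1, …]`. -/
def rowLength {n : ℕ} (k : ℕ) (w : Perm (Fin n)) (i : ℕ) : ℕ :=
  if h : i < k ∧ k ≤ n then (w⁻¹ ⟨k - 1 - i, by omega⟩ : ℕ) - (k - 1 - i) else 0

/-- The set of dots `L` is a Le diagram in `λ`: if a box of `λ` lies above (or at) a dot and to the
right of (or at) a dot, then it has a dot. -/
def IsLeDiagram {n : ℕ} (k : ℕ) (w : Perm (Fin n)) (L : Finset (ℕ × ℕ)) : Prop :=
  (∀ c ∈ L, c.2 < rowLength k w c.1) ∧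
  ∀ r₁ r₂ c₁ c₂ : ℕ, (r₁, c₁) ∈ L → (r₂, c₂) ∈ L → r₁ ≤ r₂ → c₂ ≤ c₁ →
    c₁ < rowLength k w r₂ → (r₂, c₁) ∈ L

/-- The letters in the boxes of `λ` without dot, read by columns from left to right, each column from
the bottom up. The box in row `i` and column `j` is filled with the letter `k + j - i`. -/
def emptyBoxWord {n : ℕ} (k : ℕ) (w : Perm (Fin n)) (L : Finset (ℕ × ℕ)) : List ℕ :=
  (List.range (n - k)).flatMap fun j =>
    ((List.range k).filter fun i => j < rowLength k w i ∧ (i, j) ∉ L).map fun i => k + j - i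

/-- `L` is the Le diagram of the positroid pair `(u, w)`: it is a Le diagram in the Young diagram of
`w`, and the boxes without dot spell `u`. -/
def IsLeDiagramOf {n : ℕ} (k : ℕ) (u w : Perm (Fin n)) (L : Finset (ℕ × ℕ)) : Prop :=
  IsLeDiagram k w L ∧ ((emptyBoxWord k w L).map (simpleTransposition n)).prod = u

/-- The positions, counted from the top, of the strands at the heights of the dots in column `j`: row
`i` has height `i + 1` from the bottom and hence position `k - i` from the top. -/
def dotPositions (k : ℕ) (L : Finset (ℕ × ℕ)) (j : ℕ) : Finset ℕ :=
  (Finset.Icc 1 k).filter fun p => (k - p, j) ∈ L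

/-- The column tangle, for a column whose dots have the positions `P` from the top. Every dot strand
but the lowest moves down to the next dot, passing over the horizontal strands in between: this gives
a negative crossing `σ_q⁻¹` for every strand `q + 1 ∉ P` between the top and the bottom dot. The lowest
dot strand moves up to the top dot over everything else: this gives `σ_{max P - 1} ⋯ σ_{min P}`.
As the latter strand is above all others, its crossings may be drawn last. -/
def columnTangle (k : ℕ) (P : Finset ℕ) : BraidGroup k :=
  if h : P.Nonempty then
    (((List.range' (P.min' h) (P.max' h - 1 - P.min' h)).filter fun q => q + 1 ∉ P).map
      fun q => (sigma k q)⁻¹).prod * intervalBraid k (P.min' h) (P.max' h - 1)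
  else 1

/-- The Le braid: the concatenation of the column tangles, from the right-most column (drawn at the
left) to the left-most one. -/
def leBraid (k n : ℕ) (L : Finset (ℕ × ℕ)) : BraidGroup k :=
  ((List.range (n - k)).reverse.map fun j => columnTangle k (dotPositions k L j)).prod

/-! For a list with distinct entries, let asc be the positive braid that crosses once every pair of
positions at which the list increases (`ascentWord`). Exchanging two adjacent entries `x < y` strips
one generator from its right end (`BraidSeq.ascentWord_swap`). Hence asc of the window of `v⁻¹`
equals `Δ β(v)⁻¹` for every reduced word of `v` (`IsReducedWord.ascentWord_mul`).

A diagram with dots is taken apart along the boundary of its shape: either the top row is empty or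
the first column is full. Put together again, these steps build the window of `u⁻¹`. An empty row
puts a new smallest letter in front. A column sends a new smallest letter through the first `k`
entries: at a box without dot it is swapped with the next entry, at a dot it is put down and the
next entry is carried on. The carried letter is always smaller than the next one (`DotPath.Valid`)
exactly for Le diagrams (`valid_dotPath`, `isLe_of_valid`). In that case the boxes without dot spell
a positive lift of `u` (`DotPath.ascentWord_mul_gaps`). Running the passes backwards, with the
tableau criterion for Bruhat order as the invariant, gives existence (`exists_dots`).

The formula for the Le braid is proved along the same path (`DotPath.braid_eq`). Multiplying asc of
the first `k` entries by a column tangle makes the carried letter leave at the right end and the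
letter 0 enter. If `c` entries are smaller than the leaving letter, this costs a factor `σ_{k-c} ⋯
σ_{k-1}` on the left, which `Δ⁻¹` turns into `σ_c ⋯ σ_1`, the braid of the arc that starts at the
new leftmost point. These arcs make up `J⁽¹⁾` (`DotPath.wordEval_arcs_low`). The list left at the
end gives `J⁽²⁾`: the arcs into the second window start at `w⁻¹(1) < ⋯ < w⁻¹(k)` and end at the
translates of `u⁻¹(1), …, u⁻¹(k)` (`arcs_high`). Since `J Δ⁻¹ = J⁽²⁾ J⁽¹⁾ Δ⁻¹`, conjugacy with the
Le braid is a cyclic rotation.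

For the Markov moves, the Richardson braid is the word of all boxes times the inverse of the word of
the boxes without dot. The first column is the only one that involves the top strand. After a
conjugation it uses `σ_1` once if it has a dot, and not at all otherwise, so the strand can be
destabilized or deleted, and the tangle of the column remains (`markovReduces_columns`). Columns
without dots correspond to fixed points (`DotPath.count_fixed`). -/

/-! ### Words in a sequence satisfying the braid relations -/

section BraidWords

variable {Γ : Type*} [Group Γ]

/-- The value of a positive word in the sequence `s`. -/
def wordEval (s : ℕ → Γ) (l : List ℕ) : Γ := (l.map s).prod

/-- The word `a + l - 1, …, a + 1, a`. -/
def descWord (a l : ℕ) : List ℕ := (List.range' a l).reverse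

/-- The elements `s 1, …, s (N - 1)` satisfy the relations of the braid group on `N` strands. -/
structure BraidSeq (N : ℕ) (s : ℕ → Γ) : Prop where
  comm : ∀ i j, 1 ≤ i → i + 1 < j → j < N → s i * s j = s j * s i
  braid : ∀ i, 1 ≤ i → i + 1 < N → s i * s (i + 1) * s i = s (i + 1) * s i * s (i + 1)

/-- All letters of the word lie in `{1, …, N - 1}`. -/
def Letters (N : ℕ) (l : List ℕ) : Prop := ∀ x ∈ l, 1 ≤ x ∧ x < N

variable {s : ℕ → Γ} {N : ℕ}

@[simp] lemma wordEval_nil : wordEval s [] = 1 := rfl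

@[simp] lemma wordEval_cons (x : ℕ) (l : List ℕ) : wordEval s (x :: l) = s x * wordEval s l := by
  simp [wordEval]

@[simp] lemma wordEval_append (l l' : List ℕ) :
    wordEval s (l ++ l') = wordEval s l * wordEval s l' := by
  simp [wordEval]

lemma wordEval_map_succ (l : List ℕ) :
    wordEval s (l.map (· + 1)) = wordEval (fun i => s (i + 1)) l := by
  simp [wordEval, Function.comp_def]

@[simp] lemma descWord_zero (a : ℕ) : descWord a 0 = [] := rfl

lemma descWord_succ (a l : ℕ) : descWord a (l + 1) = (a + l) :: descWord a l := by
  simp [descWord, List.range'_concat]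

lemma descWord_succ' (a l : ℕ) : descWord a (l + 1) = descWord (a + 1) l ++ [a] := by
  simp [descWord, List.range'_succ]

lemma descWord_add (a l m : ℕ) : descWord a (l + m) = descWord (a + l) m ++ descWord a l := by
  induction m with
  | zero => simp
  | succ m ih => rw [← Nat.add_assoc, descWord_succ, ih, descWord_succ, Nat.add_assoc]; rfl

lemma mem_descWord {a l x : ℕ} : x ∈ descWord a l ↔ a ≤ x ∧ x < a + l := by
  simp [descWord]

lemma descWord_map_succ (a l : ℕ) : (descWord a l).map (· + 1) = descWord (a + 1) l := by
  induction l with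
  | zero => rfl
  | succ l ih => simp [descWord_succ, ih]; omega

lemma BraidSeq.mono {M : ℕ} (h : BraidSeq N s) (hM : M ≤ N) : BraidSeq M s :=
  ⟨fun i j a b c => h.comm i j a b (by omega), fun i a b => h.braid i a (by omega)⟩

lemma BraidSeq.shift (h : BraidSeq (N + 1) s) : BraidSeq N (fun i => s (i + 1)) :=
  ⟨fun i j a b c => h.comm _ _ (by omega) (by omega) (by omega),
    fun i a b => h.braid _ (by omega) (by omega)⟩

lemma Letters.mono {M : ℕ} {l : List ℕ} (h : Letters M l) (hM : M ≤ N) : Letters N l :=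
  fun x hx => ⟨(h x hx).1, (h x hx).2.trans_le hM⟩

lemma Letters.append {l l' : List ℕ} (h : Letters N l) (h' : Letters N l') :
    Letters N (l ++ l') := by
  intro x hx
  rcases List.mem_append.1 hx with hx | hx
  exacts [h x hx, h' x hx]

lemma Letters.map_succ {l : List ℕ} (h : Letters N l) : Letters (N + 1) (l.map (· + 1)) := by
  intro x hx
  obtain ⟨y, hy, rfl⟩ := List.mem_map.1 hx
  have := h y hy
  constructor <;> omega

lemma letters_descWord {a l : ℕ} (ha : 1 ≤ a) (h : a + l ≤ N) : Letters N (descWord a l) := by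
  intro x hx
  rw [mem_descWord] at hx
  constructor <;> omega

lemma BraidSeq.comm_word (h : BraidSeq N s) {i : ℕ} (hi : 1 ≤ i) (hiN : i < N) {l : List ℕ}
    (hl : Letters N l) (hd : ∀ x ∈ l, x + 1 < i ∨ i + 1 < x) :
    s i * wordEval s l = wordEval s l * s i := by
  induction l with
  | nil => simp
  | cons x l ih =>
    have hx := hl x (by simp)
    have e : s i * s x = s x * s i := by
      rcases hd x (by simp) with hd | hd
      · exact (h.comm _ _ hx.1 hd hiN).symm
      · exact h.comm _ _ hi hd hx.2
    rw [wordEval_cons, ← mul_assoc, e, mul_assoc,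
      ih (fun y hy => hl y (by simp [hy])) (fun y hy => hd y (by simp [hy])), mul_assoc]

lemma BraidSeq.comm_words (h : BraidSeq N s) {l l' : List ℕ} (hl : Letters N l)
    (hl' : Letters N l') (hd : ∀ x ∈ l, ∀ y ∈ l', y + 1 < x ∨ x + 1 < y) :
    wordEval s l * wordEval s l' = wordEval s l' * wordEval s l := by
  induction l with
  | nil => simp
  | cons x l ih =>
    have hx := hl x (by simp)
    rw [wordEval_cons, mul_assoc, ih (fun y hy => hl y (by simp [hy]))
      (fun y hy => hd y (by simp [hy])), ← mul_assoc, h.comm_word hx.1 hx.2 hl' (hd x (by simp)),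
      mul_assoc]

/-- The generator `s i` commutes with every letter of the descending word up to the adjacent pair `i
+ 1, i`; there one braid relation turns it into `s (i + 1)`, which commutes with the rest. -/
lemma BraidSeq.slide (h : BraidSeq N s) {a l i : ℕ} (ha : 1 ≤ a) (hai : a ≤ i)
    (hil : i + 1 < a + l) (hN : a + l ≤ N) :
    s i * wordEval s (descWord a l) = wordEval s (descWord a l) * s (i + 1) := by
  obtain ⟨p, rfl⟩ := Nat.exists_eq_add_of_le hai
  obtain ⟨r, rfl⟩ : ∃ r, l = p + (1 + (1 + r)) := ⟨l - p - 2, by omega⟩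
  have e : descWord a (p + (1 + (1 + r))) =
      descWord (a + p + 2) r ++ (a + p + 1) :: (a + p) :: descWord a p := by
    rw [descWord_add, descWord_add, descWord_add]
    simp [descWord, Nat.add_assoc]
  have c₁ := h.comm_word (i := a + p) (by omega) (by omega) (l := descWord (a + p + 2) r)
    (letters_descWord (by omega) (by omega)) (fun x hx => by rw [mem_descWord] at hx; omega)
  have c₂ := h.comm_word (i := a + p + 1) (by omega) (by omega) (l := descWord a p)
    (letters_descWord (by omega) (by omega)) (fun x hx => by rw [mem_descWord] at hx; omega)
  have b := h.braid (a + p) (by omega) (by omega)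
  rw [e]
  simp only [wordEval_append, wordEval_cons]
  calc _ = (s (a + p) * wordEval s (descWord (a + p + 2) r)) *
        (s (a + p + 1) * s (a + p) * wordEval s (descWord a p)) := by group
    _ = wordEval s (descWord (a + p + 2) r) * (s (a + p) * s (a + p + 1) * s (a + p)) *
        wordEval s (descWord a p) := by rw [c₁]; group
    _ = wordEval s (descWord (a + p + 2) r) * s (a + p + 1) * s (a + p) *
        (s (a + p + 1) * wordEval s (descWord a p)) := by rw [b]; group
    _ = _ := by rw [c₂]; group

lemma BraidSeq.slide_word (h : BraidSeq N s) {a l : ℕ} (ha : 1 ≤ a) (hN : a + l ≤ N)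
    {w : List ℕ} (hw : ∀ x ∈ w, a ≤ x ∧ x + 1 < a + l) :
    wordEval s w * wordEval s (descWord a l) =
      wordEval s (descWord a l) * wordEval s (w.map (· + 1)) := by
  induction w with
  | nil => simp
  | cons x w ih =>
    have hx := hw x (by simp)
    rw [wordEval_cons, mul_assoc, ih (fun y hy => hw y (by simp [hy])), ← mul_assoc,
      h.slide ha hx.1 hx.2 hN, mul_assoc, List.map_cons, wordEval_cons]

/-! ### The half twist and its flip. -/

/-- The word of the half twist. -/
def deltaWord : ℕ → List ℕ
  | 0 => []
  | k + 1 => deltaWord k ++ descWord 1 k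

lemma letters_deltaWord (k : ℕ) : Letters k (deltaWord k) := by
  induction k with
  | zero => simp [deltaWord, Letters]
  | succ k ih => exact (ih.mono (by omega)).append (letters_descWord le_rfl (by omega))

/-- The recursion with the new strand on top instead of at the bottom; this form fits the removal of
an empty top row. -/
lemma BraidSeq.delta_succ (k : ℕ) (h : BraidSeq (k + 1) s) :
    wordEval s (deltaWord (k + 1)) =
      wordEval s (descWord 1 k) * wordEval s ((deltaWord k).map (· + 1)) := by
  rw [deltaWord, wordEval_append]
  exact h.slide_word le_rfl (by omega) fun x hx => by
    have := letters_deltaWord k x hx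
    omega

/-- For `i ≥ 2` the last factor of the half twist lowers the index by one and induction applies. For
`i = 1` the last two factors are needed: sliding one through the other produces `σ_1` next to
`σ_1`'s missing run, and the generator of highest index comes out on the left, where it commutes
with the remaining half twist. -/
lemma BraidSeq.delta_flip {k : ℕ} (h : BraidSeq k s) {i : ℕ} (hi : 1 ≤ i) (hik : i < k) :
    wordEval s (deltaWord k) * s i = s (k - i) * wordEval s (deltaWord k) := by
  induction k generalizing i with
  | zero => omega
  | succ k ih =>
    obtain rfl | hi1 := hi.eq_or_lt
    · obtain ⟨k, rfl⟩ : ∃ m, k = m + 1 := ⟨k - 1, by omega⟩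
      have c := h.comm_word (i := k + 1) (by omega) (by omega)
        ((letters_deltaWord k).mono (by omega : k ≤ k + 1 + 1))
        (fun x hx => by have := letters_deltaWord k x hx; omega)
      have e := h.slide_word (a := 1) (l := k + 1) le_rfl (by omega) (w := descWord 1 k)
        (fun x hx => by rw [mem_descWord] at hx; omega)
      have e₁ : wordEval s (descWord 1 (k + 1)) = s (k + 1) * wordEval s (descWord 1 k) := by
        rw [descWord_succ, wordEval_cons, Nat.add_comm 1 k]
      have e₂ : wordEval s (descWord 1 (k + 1)) = wordEval s (descWord 2 k) * s 1 := by
        rw [descWord_succ', wordEval_append]; simp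
      rw [descWord_map_succ] at e
      rw [show k + 1 + 1 - 1 = k + 1 by omega]
      simp only [deltaWord, wordEval_append]
      calc _ = wordEval s (deltaWord k) *
            (wordEval s (descWord 1 k) * wordEval s (descWord 1 (k + 1))) * s 1 := by group
        _ = wordEval s (deltaWord k) * wordEval s (descWord 1 (k + 1)) *
            (wordEval s (descWord 2 k) * s 1) := by rw [e]; group
        _ = (wordEval s (deltaWord k) * s (k + 1)) * wordEval s (descWord 1 k) *
            wordEval s (descWord 1 (k + 1)) := by rw [← e₂, e₁]; group
        _ = _ := by rw [← c]; group
    · obtain ⟨j, rfl⟩ : ∃ j, i = j + 1 := ⟨i - 1, by omega⟩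
      have e := h.slide (a := 1) (l := k) (i := j) le_rfl (by omega) (by omega) (by omega)
      have e' := ih (h.mono (by omega)) (i := j) (by omega) (by omega)
      rw [deltaWord, wordEval_append, mul_assoc, ← e, ← mul_assoc, e', mul_assoc,
        show k + 1 - (j + 1) = k - j by omega]

/-! ### Positive words from the ascents of a list. -/

lemma notMem_of_nodup_append_cons {x : ℕ} {A B : List ℕ} (h : (A ++ x :: B).Nodup) :
    x ∉ A ∧ x ∉ B := by
  simpa using (List.nodup_middle.1 h).notMem

lemma exists_append_cons_of_nodup {x : ℕ} {l : List ℕ} (hx : x ∈ l) (h : l.Nodup) :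
    ∃ A B, l = A ++ x :: B ∧ x ∉ A ∧ x ∉ B := by
  obtain ⟨A, B, rfl⟩ := List.append_of_mem hx
  exact ⟨A, B, rfl, notMem_of_nodup_append_cons h⟩

/-- Removal of the letter `0`, all other letters being decreased by one. -/
def dropZero : List ℕ → List ℕ
  | [] => []
  | 0 :: l => dropZero l
  | (x + 1) :: l => x :: dropZero l

/-- The positive word whose crossings are the pairs of positions at which the list `l` increases,
for a list with entries less than `M`. -/
def ascentWord : ℕ → List ℕ → List ℕ
  | 0, _ => []
  | M + 1, l => ascentWord M (dropZero l) ++ descWord (l.idxOf 0 + 1) (l.length - 1 - l.idxOf 0)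

@[simp] lemma dropZero_nil : dropZero [] = [] := rfl
@[simp] lemma dropZero_zero_cons (l : List ℕ) : dropZero (0 :: l) = dropZero l := rfl
@[simp] lemma dropZero_succ_cons (x : ℕ) (l : List ℕ) :
    dropZero ((x + 1) :: l) = x :: dropZero l := rfl

@[simp] lemma dropZero_append (l l' : List ℕ) :
    dropZero (l ++ l') = dropZero l ++ dropZero l' := by
  induction l with
  | nil => rfl
  | cons x l ih => cases x <;> simp [ih]

@[simp] lemma dropZero_map_succ (l : List ℕ) : dropZero (l.map (· + 1)) = l := by
  induction l with
  | nil => rfl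
  | cons x l ih => simp [ih]

lemma mem_dropZero {x : ℕ} {l : List ℕ} : x ∈ dropZero l ↔ x + 1 ∈ l := by
  induction l with
  | nil => simp
  | cons y l ih => cases y <;> simp [ih]

lemma nodup_dropZero {l : List ℕ} (h : l.Nodup) : (dropZero l).Nodup := by
  induction l with
  | nil => simp
  | cons y l ih =>
    cases y with
    | zero => exact ih h.of_cons
    | succ y =>
      rw [List.nodup_cons] at h
      simp [mem_dropZero, h.1, ih h.2]

lemma length_dropZero_of_notMem {l : List ℕ} (h : 0 ∉ l) : (dropZero l).length = l.length := by
  induction l with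
  | nil => rfl
  | cons y l ih =>
    cases y with
    | zero => simp at h
    | succ y => simp at h; simp [ih h]

lemma length_dropZero_le (l : List ℕ) : (dropZero l).length ≤ l.length := by
  induction l with
  | nil => simp
  | cons y l ih => cases y <;> simp <;> omega

lemma letters_ascentWord (M : ℕ) (l : List ℕ) : Letters l.length (ascentWord M l) := by
  induction M generalizing l with
  | zero => simp [ascentWord, Letters]
  | succ M ih =>
    refine ((ih _).mono (length_dropZero_le l)).append ?_
    intro x hx
    rw [mem_descWord] at hx
    omega

lemma ascentWord_of_notMem {M : ℕ} {l : List ℕ} (h : 0 ∉ l) :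
    ascentWord (M + 1) l = ascentWord M (dropZero l) := by
  rw [ascentWord, List.idxOf_eq_length h, show l.length - 1 - l.length = 0 by omega]
  simp

lemma ascentWord_zero_cons (M : ℕ) (A B : List ℕ) (h : 0 ∉ A) :
    ascentWord (M + 1) (A ++ 0 :: B) =
      ascentWord M (dropZero A ++ dropZero B) ++ descWord (A.length + 1) B.length := by
  rw [ascentWord, List.idxOf_append_of_notMem h]
  simp

lemma ascentWord_map_succ (M : ℕ) (l : List ℕ) :
    ascentWord (M + 1) (l.map (· + 1)) = ascentWord M l := by
  rw [ascentWord_of_notMem (by simp), dropZero_map_succ]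

/-- Induction on the smallest letter 0. If `x` is this letter, its descending factor just loses its
last generator. If 0 stands in `A`, the generator obtained by induction has index one too small and
slides through the factor of 0 to the right one. If 0 stands in `B`, its factor is far away and
commutes. -/
lemma BraidSeq.ascentWord_swap (h : BraidSeq N s) {M : ℕ} {A B : List ℕ} {x y : ℕ} (hxy : x < y)
    (hM : x < M) (hnd : (A ++ x :: y :: B).Nodup) (hN : (A ++ x :: y :: B).length ≤ N) :
    wordEval s (ascentWord M (A ++ x :: y :: B)) =
      wordEval s (ascentWord M (A ++ y :: x :: B)) * s (A.length + 1) := by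
  induction M generalizing A B x y with
  | zero => omega
  | succ M ih =>
    obtain ⟨y, rfl⟩ : ∃ z, y = z + 1 := ⟨y - 1, by omega⟩
    simp only [List.length_append, List.length_cons] at hN
    cases x with
    | zero =>
      have hA := (notMem_of_nodup_append_cons hnd).1
      rw [ascentWord_zero_cons _ _ _ hA,
        show A ++ (y + 1) :: 0 :: B = (A ++ [y + 1]) ++ 0 :: B by simp,
        ascentWord_zero_cons _ _ _ (by simp [hA])]
      simp [descWord_succ', mul_assoc]
    | succ x =>
      have hnd' := nodup_dropZero hnd
      simp only [dropZero_append, dropZero_succ_cons] at hnd'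
      by_cases hA : 0 ∈ A
      · obtain ⟨A₁, A₂, rfl, h0, h2⟩ := exists_append_cons_of_nodup hA hnd.of_append_left
        have l1 := length_dropZero_of_notMem h0
        have l2 := length_dropZero_of_notMem h2
        have lB := length_dropZero_le B
        simp only [List.length_append, List.length_cons] at hN
        simp only [dropZero_append, dropZero_zero_cons] at hnd'
        have := ih (by omega) (by omega) hnd' (by simp; omega)
        rw [List.append_assoc, List.append_assoc, List.cons_append, List.cons_append,
          ascentWord_zero_cons _ _ _ h0, ascentWord_zero_cons _ _ _ h0]
        simp only [dropZero_append, dropZero_succ_cons, wordEval_append, ← List.append_assoc]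
        rw [this, mul_assoc, h.slide (by omega) (by simp; omega) (by simp; omega) (by simp; omega)]
        simp only [List.length_append, List.length_cons, l1, l2, mul_assoc, Nat.add_assoc]
      · have l1 := length_dropZero_of_notMem hA
        by_cases hB : 0 ∈ B
        · obtain ⟨B₁, B₂, rfl, h0, -⟩ :=
            exists_append_cons_of_nodup hB hnd.of_append_right.of_cons.of_cons
          simp only [List.length_append, List.length_cons] at hN
          have lB1 := length_dropZero_le B₁
          have lB2 := length_dropZero_le B₂
          simp only [dropZero_append, dropZero_zero_cons] at hnd'
          have := ih (by omega) (by omega) hnd' (by simp; omega)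
          rw [show A ++ (x + 1) :: (y + 1) :: (B₁ ++ 0 :: B₂) =
              (A ++ (x + 1) :: (y + 1) :: B₁) ++ 0 :: B₂ by simp,
            show A ++ (y + 1) :: (x + 1) :: (B₁ ++ 0 :: B₂) =
              (A ++ (y + 1) :: (x + 1) :: B₁) ++ 0 :: B₂ by simp,
            ascentWord_zero_cons _ _ _ (by simp [hA, h0]),
            ascentWord_zero_cons _ _ _ (by simp [hA, h0])]
          simp only [dropZero_append, dropZero_succ_cons, wordEval_append, List.append_assoc,
            List.cons_append]
          rw [this, mul_assoc, h.comm_word (by omega) (by omega) (letters_descWord (by omega) ?_)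
            ?_, mul_assoc, l1]
          · simp
          · simp; omega
          · intro z hz
            rw [mem_descWord] at hz
            simp at hz
            omega
        · rw [ascentWord_of_notMem (by simp [hA, hB]), ascentWord_of_notMem (by simp [hA, hB])]
          simp only [dropZero_append, dropZero_succ_cons]
          rw [ih (by omega) (by omega) hnd' (by
            have := length_dropZero_le B
            simp; omega), l1]

/-- Every letter smaller than `y` crosses the strand of `y` in the first letter of its descending
factor. This generator has the highest index and commutes to the left past the ascent word of the
larger entries of `V`; collected in front, these crossings form an ascending run. -/
lemma BraidSeq.ascentWord_concat (h : BraidSeq N s) {M : ℕ} {V : List ℕ} {y : ℕ} (hM : y < M)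
    (hnd : (V ++ [y]).Nodup) (hN : V.length + 1 ≤ N) :
    wordEval s (ascentWord M (V ++ [y])) =
      wordEval s (List.range' (V.length + 1 - V.countP (· < y)) (V.countP (· < y))) *
        wordEval s (ascentWord M V) := by
  induction M generalizing V y with
  | zero => omega
  | succ M ih =>
    cases y with
    | zero =>
      have hV := (notMem_of_nodup_append_cons hnd).1
      rw [ascentWord_zero_cons _ _ _ hV, ascentWord_of_notMem hV]
      simp
    | succ y =>
      have hnd' := nodup_dropZero hnd
      have key : ∀ l : List ℕ, 0 ∉ l →
          (dropZero l).countP (· < y) = l.countP (· < y + 1) := by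
        intro l hl
        induction l with
        | nil => rfl
        | cons z l ihl =>
          cases z with
          | zero => simp at hl
          | succ z => simp at hl; simp [List.countP_cons, ihl hl]
      by_cases hV : 0 ∈ V
      · obtain ⟨A, B, rfl, h0, hB⟩ := exists_append_cons_of_nodup hV hnd.of_append_left
        have l1 := length_dropZero_of_notMem h0
        have l2 := length_dropZero_of_notMem hB
        simp only [dropZero_append, dropZero_zero_cons, dropZero_succ_cons, dropZero_nil] at hnd'
        simp only [List.length_append, List.length_cons] at hN
        have e := ih (V := dropZero A ++ dropZero B) (by omega) hnd' (by simp; omega)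
        have hc : (dropZero A ++ dropZero B).countP (· < y) ≤ _ := List.countP_le_length
        simp only [List.countP_append, List.length_append, key A h0, key B hB, l1, l2] at e hc
        have c := h.comm_word (i := A.length + B.length + 1) (by omega) (by omega)
          ((letters_ascentWord M (dropZero A ++ dropZero B)).mono (by simp; omega))
          (fun x hx => by
            have := letters_ascentWord _ _ x hx
            simp at this; omega)
        rw [List.append_assoc, List.cons_append, ascentWord_zero_cons _ _ _ h0,
          ascentWord_zero_cons _ _ _ h0]
        simp only [dropZero_append, dropZero_succ_cons, dropZero_nil, ← List.append_assoc]
        simp only [wordEval_append, List.length_append, List.length_cons, List.length_nil,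
          List.countP_append, List.countP_cons, decide_eq_true (Nat.succ_pos y), if_true]
        rw [e, Nat.zero_add, descWord_succ, ← Nat.add_assoc (List.countP _ A), List.range'_concat,
          wordEval_append,
          wordEval_cons, wordEval_cons, wordEval_nil, mul_one,
          show A.length + 1 + B.length = A.length + B.length + 1 by omega]
        rw [show A.length + (B.length + 1) + 1 -
          (List.countP (· < y + 1) A + List.countP (· < y + 1) B + 1) = A.length + B.length + 1 -
          (List.countP (· < y + 1) A + List.countP (· < y + 1) B) by omega,
          show A.length + B.length + 1 -
          (List.countP (· < y + 1) A + List.countP (· < y + 1) B) +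
            1 * (List.countP (· < y + 1) A + List.countP (· < y + 1) B) = A.length + B.length + 1
            by omega]
        simp only [mul_assoc]
        rw [← mul_assoc (wordEval s (ascentWord M _)) (s _), ← c]
        simp only [mul_assoc]
      · rw [ascentWord_of_notMem hV, ascentWord_of_notMem (by simp [hV])]
        simp only [dropZero_append, dropZero_succ_cons, dropZero_nil] at hnd' ⊢
        rw [ih (by omega) hnd' (by rw [length_dropZero_of_notMem hV]; omega), key V hV,
          length_dropZero_of_notMem hV]

lemma ascentWord_range (k : ℕ) : ascentWord k (List.range k) = deltaWord k := by
  induction k with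
  | zero => rfl
  | succ k ih =>
    have := ascentWord_zero_cons k [] ((List.range k).map (· + 1)) (by simp)
    rw [List.nil_append] at this
    rw [List.range_succ_eq_map, deltaWord, ← ih]
    simpa using this

lemma BraidSeq.delta_descWord {k : ℕ} (h : BraidSeq k s) {c : ℕ} (hc : c + 1 ≤ k) :
    wordEval s (deltaWord k) * wordEval s (descWord 1 c) =
      wordEval s (List.range' (k - c) c) * wordEval s (deltaWord k) := by
  induction c with
  | zero => simp
  | succ c ih =>
    rw [descWord_succ, wordEval_cons, ← mul_assoc, h.delta_flip (by omega) (by omega), mul_assoc,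
      ih (by omega), List.range'_succ, wordEval_cons, mul_assoc,
      show k - (1 + c) = k - (c + 1) by omega, show k - (c + 1) + 1 = k - c by omega]

end BraidWords

/-! ### Paths: the boundary of a Young diagram with the dots of its columns -/

/-- One pass through the list `xs`: at a dot the carried letter is put down and the next one is
taken up, elsewhere the carried letter moves past the next one. This is the resulting list. -/
def bubbleOut : ℕ → List Bool → List ℕ → List ℕ
  | c, true :: bs, x :: xs => c :: bubbleOut x bs xs
  | c, false :: bs, x :: xs => x :: bubbleOut c bs xs
  | _, _, _ => []

/-- The letter that is carried at the end of the pass. -/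
def bubbleCarry : ℕ → List Bool → List ℕ → ℕ
  | _, true :: bs, x :: xs => bubbleCarry x bs xs
  | c, false :: bs, _ :: xs => bubbleCarry c bs xs
  | c, _, _ => c

/-- In the pass, the carried letter is always smaller than the next one. -/
def BubbleAscending : ℕ → List Bool → List ℕ → Prop
  | c, true :: bs, x :: xs => c < x ∧ BubbleAscending x bs xs
  | c, false :: bs, x :: xs => c < x ∧ BubbleAscending c bs xs
  | _, _, _ => True

/-- The places without dot, the first place being `q`. -/
def gapWord : ℕ → List Bool → List ℕ
  | q, true :: bs => gapWord (q + 1) bs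
  | q, false :: bs => q :: gapWord (q + 1) bs
  | _, [] => []

/-- Steps of the boundary path: an empty top row, or a full first column with its dots, from the
top down. -/
abbrev DotPath := List (Option (List Bool))

namespace DotPath

def rows : DotPath → ℕ
  | [] => 0
  | none :: S => rows S + 1
  | some _ :: S => rows S

/-- The values of `u⁻¹` at the first `k` letters. -/
def high : DotPath → List ℕ
  | [] => []
  | none :: S => 0 :: (high S).map (· + 1)
  | some bs :: S => bubbleOut 0 bs ((high S).map (· + 1))

/-- The values of `u⁻¹` at the last `n - k` letters. -/
def low : DotPath → List ℕ
  | [] => []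
  | none :: S => (low S).map (· + 1)
  | some bs :: S => bubbleCarry 0 bs ((high S).map (· + 1)) :: (low S).map (· + 1)

def Valid : DotPath → Prop
  | [] => True
  | none :: S => Valid S
  | some bs :: S => bs.length = rows S ∧ BubbleAscending 0 bs ((high S).map (· + 1)) ∧ Valid S

/-- The positive word of the arcs that end in the first window. -/
def arcWord : DotPath → List ℕ
  | [] => []
  | none :: S => (arcWord S).map (· + 1)
  | some bs :: S =>
      arcWord S ++ descWord 1
        ((high S).countP fun z => z + 1 < bubbleCarry 0 bs ((high S).map (· + 1)))

/-- The word of the boxes without dot. -/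
def gaps : DotPath → List ℕ
  | [] => []
  | none :: S => (gaps S).map (· + 1)
  | some bs :: S => (gapWord 1 bs).reverse ++ (gaps S).map (· + 1)

end DotPath

/-! ### Column tangles and the braid of a path. -/

section

variable {Γ : Type*} [Group Γ] {s : ℕ → Γ} {N : ℕ}

/-- The tangle of a column with the given dots. -/
def tangle (s : ℕ → Γ) : List Bool → Γ
  | [] => 1
  | false :: bs => tangle (fun i => s (i + 1)) bs
  -- Gaps below the lowest dot are kept as well, and the descending word runs to the bottom of the
  -- column: the additional crossings cancel (`columnTangle_eq_tangle`), so the lowest dot need not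
  -- be singled out.
  | true :: bs =>
      (wordEval s (gapWord 1 bs).reverse)⁻¹ * wordEval s (descWord 1 bs.length)

/-- The path begins with the left-most column whereas the Le braid draws the right-most one first,
so the tangle of the first column comes last. An empty top row occupies position 1, whence the shift
of the generators. -/
def DotPath.braid (s : ℕ → Γ) : DotPath → Γ
  | [] => 1
  | none :: S => DotPath.braid (fun i => s (i + 1)) S
  | some bs :: S => DotPath.braid s S * tangle s bs

lemma gapWord_succ (q : ℕ) (bs : List Bool) :
    gapWord (q + 1) bs = (gapWord q bs).map (· + 1) := by
  induction bs generalizing q with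
  | nil => rfl
  | cons b bs ih => cases b <;> simp [gapWord, ih (q + 1)]

lemma gapWord_add (q p : ℕ) (bs : List Bool) :
    gapWord (q + p) bs = (gapWord q bs).map (· + p) := by
  induction p with
  | zero => simp
  | succ p ih => rw [← Nat.add_assoc, gapWord_succ, ih]; simp [Function.comp_def, Nat.add_assoc]

lemma mem_gapWord {q x : ℕ} {bs : List Bool} (h : x ∈ gapWord q bs) :
    q ≤ x ∧ x < q + bs.length := by
  induction bs generalizing q with
  | nil => simp [gapWord] at h
  | cons b bs ih =>
    cases b
    · simp only [gapWord, List.mem_cons] at h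
      rcases h with rfl | h
      · simp
      · have := ih h
        simp; omega
    · have := ih h
      simp; omega

lemma bubble_perm {c : ℕ} {bs : List Bool} {xs : List ℕ} (h : bs.length = xs.length) :
    (bubbleCarry c bs xs :: bubbleOut c bs xs).Perm (c :: xs) := by
  induction bs generalizing c xs with
  | nil =>
    cases xs with
    | nil => simp [bubbleCarry, bubbleOut]
    | cons x xs => simp at h
  | cons b bs ih =>
    cases xs with
    | nil => simp at h
    | cons x xs =>
      simp only [List.length_cons, Nat.add_right_cancel_iff] at h
      cases b
      · exact ((List.Perm.swap _ _ _).trans ((ih (c := c) h).cons x)).trans (List.Perm.swap _ _ _)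
      · exact (List.Perm.swap _ _ _).trans ((ih (c := x) h).cons c)

lemma length_bubbleOut {c : ℕ} {bs : List Bool} {xs : List ℕ} (h : bs.length = xs.length) :
    (bubbleOut c bs xs).length = xs.length := by
  simpa using (bubble_perm (c := c) h).length_eq

lemma bubble_perm_append {c : ℕ} {bs : List Bool} {xs : List ℕ} (h : bs.length = xs.length)
    (A B : List ℕ) :
    (A ++ (bubbleOut c bs xs ++ bubbleCarry c bs xs :: B)).Perm (A ++ c :: (xs ++ B)) := by
  refine List.Perm.append_left A ?_
  exact List.perm_middle.trans ((bubble_perm (c := c) h).append_right B)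

/-- At a gap the carried letter forms an ascent with the next entry, and exchanging them splits off
one generator; at a dot the list is unchanged and only the carried letter is another one. -/
lemma BraidSeq.ascentWord_bubble (h : BraidSeq N s) {M c : ℕ} {bs : List Bool} {A xs B : List ℕ}
    (hl : bs.length = xs.length) (ha : BubbleAscending c bs xs)
    (hM : c < M ∧ ∀ x ∈ xs, x < M) (hnd : (A ++ c :: (xs ++ B)).Nodup)
    (hN : (A ++ c :: (xs ++ B)).length ≤ N) :
    wordEval s (ascentWord M (A ++ c :: (xs ++ B))) =
      wordEval s (ascentWord M (A ++ (bubbleOut c bs xs ++ bubbleCarry c bs xs :: B))) *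
        wordEval s (gapWord (A.length + 1) bs).reverse := by
  induction bs generalizing c xs A with
  | nil =>
    cases xs with
    | nil => simp [bubbleCarry, bubbleOut, gapWord]
    | cons x xs => simp at hl
  | cons b bs ih =>
    cases xs with
    | nil => simp at hl
    | cons x xs =>
      simp only [List.length_cons, Nat.add_right_cancel_iff] at hl
      cases b
      · obtain ⟨hcx, ha⟩ := ha
        rw [List.cons_append, h.ascentWord_swap (B := xs ++ B) hcx hM.1 hnd hN]
        have hp : (A ++ x :: c :: (xs ++ B)).Perm (A ++ c :: (x :: xs ++ B)) :=
          (List.Perm.swap _ _ _).append_left A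
        have := ih (A := A ++ [x]) hl ha ⟨hM.1, fun z hz => hM.2 z (by simp [hz])⟩
          (by simpa using hp.nodup_iff.2 hnd) (by simpa using hN)
        simp only [List.append_assoc, List.cons_append, List.nil_append] at this
        rw [this]
        simp [bubbleOut, bubbleCarry, gapWord, mul_assoc]
      · obtain ⟨hcx, ha⟩ := ha
        have := ih (A := A ++ [c]) hl ha ⟨hM.2 x (by simp), fun z hz => hM.2 z (by simp [hz])⟩
          (by simpa using hnd) (by simpa using hN)
        simpa [bubbleOut, bubbleCarry, gapWord] using this

lemma wordEval_shift (p : ℕ) (l : List ℕ) :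
    wordEval (fun i => s (i + p)) l = wordEval s (l.map (· + p)) := by
  simp [wordEval, Function.comp_def]

lemma descWord_map_add (a l p : ℕ) : (descWord a l).map (· + p) = descWord (a + p) l := by
  induction p with
  | zero => simp
  | succ p ih =>
    rw [← Nat.add_assoc, ← descWord_map_succ, ← ih, List.map_map]
    rfl

/-- The effect of one column. Rows above the first dot are collected in `A`. From there on the entry
`x` at the first dot is carried to the right end, which splits off the gap crossings, and these
cancel against the negative part of the tangle. Dropping the carried letter at the end costs the
ascending run on the left, and the positive part of the tangle is the descending factor of a 0
inserted at the first dot. -/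
lemma BraidSeq.ascentWord_mul_tangle (h : BraidSeq N s) {M y : ℕ} {bs : List Bool}
    {A xs : List ℕ} (hy : bubbleCarry 0 bs xs = y)
    (hl : bs.length = xs.length) (ha : BubbleAscending 0 bs xs) (hM : ∀ x ∈ xs, x < M + 1)
    (h0 : 0 ∉ A ++ xs) (hnd : (A ++ xs).Nodup) (hN : (A ++ xs).length ≤ N) :
    wordEval s (ascentWord (M + 1) (A ++ xs)) * tangle (fun i => s (i + A.length)) bs =
      wordEval s (List.range' ((A ++ xs).length - (A ++ xs).countP (· < y))
        ((A ++ xs).countP (· < y))) *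
        wordEval s (ascentWord (M + 1) (A ++ bubbleOut 0 bs xs)) := by
  induction bs generalizing A xs with
  | nil =>
    cases xs with
    | nil => simp [← hy, bubbleCarry, bubbleOut, tangle]
    | cons x xs => simp at hl
  | cons b bs ih =>
    cases xs with
    | nil => simp at hl
    | cons x xs =>
      simp only [List.length_cons, Nat.add_right_cancel_iff] at hl
      cases b
      · have := ih (A := A ++ [x]) hy hl ha.2 (fun z hz => hM z (by simp [hz])) (by simpa using h0)
          (by simpa using hnd) (by simpa using hN)
        simp only [List.append_assoc, List.cons_append, List.nil_append, List.length_append,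
          List.length_cons, List.length_nil, Nat.zero_add] at this
        simp only [bubbleOut, tangle, List.length_append, List.length_cons]
        rw [← this]
        congr 2
        funext i
        congr 1
        omega
      · replace hy : bubbleCarry x bs xs = y := hy
        have hp := bubble_perm (c := x) hl
        have hp' := bubble_perm_append (c := x) hl A []
        have e := h.ascentWord_bubble (A := A) (B := []) hl ha.2
          (M := M + 1) ⟨hM x (by simp), fun z hz => hM z (by simp [hz])⟩
          (by simpa using hnd) (by simpa using hN)
        rw [List.append_nil, hy] at hp' e
        rw [hy] at hp
        have hnd' := hp'.nodup_iff.2 hnd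
        rw [e]
        have hyM : y < M + 1 := hM _ (hp.mem_iff.1 (by simp))
        have hlen := hp'.length_eq
        have hout := length_bubbleOut (c := x) hl
        have hcount := hp'.countP_eq (· < y)
        rw [← List.append_assoc] at hnd' hcount hlen ⊢
        rw [h.ascentWord_concat hyM hnd' (by simp at hN hlen ⊢; omega)]
        have h0' : 0 ∉ A ++ bubbleOut x bs xs := fun h => h0 (hp'.mem_iff.1 (by
          rw [← List.append_assoc]; exact List.mem_append_left _ h))
        have h0A : 0 ∉ A := fun h => h0' (by simp [h])
        rw [ascentWord_of_notMem h0']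
        simp only [bubbleOut, tangle]
        rw [ascentWord_zero_cons _ _ _ h0A, wordEval_shift, wordEval_shift, descWord_map_add,
          List.map_reverse, ← gapWord_add, dropZero_append]
        have e1 : List.countP (fun z => decide (z < y)) (A ++ bubbleOut x bs xs) =
          List.countP (fun z => decide (z < y)) (A ++ x :: xs) := by
          rw [← hcount]
          simp
        have e2 : (A ++ bubbleOut x bs xs).length + 1 = (A ++ x :: xs).length := by
          rw [← hlen]; simp [Nat.add_assoc]
        rw [e1, e2, Nat.add_comm 1, hl, hout, wordEval_append]
        simp only [mul_assoc, mul_inv_cancel_left]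

namespace DotPath

lemma high_perm {S : DotPath} (h : Valid S) :
    (high S).length = (rows S) ∧ ((high S) ++ (low S)).Perm (List.range S.length) := by
  induction S with
  | nil => simp [high, low, rows]
  | cons b S ih =>
    cases b with
    | none =>
      obtain ⟨e, p⟩ := ih h
      refine ⟨by simp [high, rows, e], ?_⟩
      simp only [high, low, List.length_cons, List.cons_append, ← List.map_append,
        List.range_succ_eq_map]
      exact (p.map _).cons _
    | some bs =>
      obtain ⟨hl, ha, hS⟩ := h
      obtain ⟨e, p⟩ := ih hS
      have hl' : bs.length = ((high S).map (· + 1)).length := by simp [hl, e]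
      refine ⟨by simp [high, rows, length_bubbleOut hl', e], ?_⟩
      have := bubble_perm_append (c := 0) hl' [] ((low S).map (· + 1))
      simp only [high, low, List.length_cons, List.range_succ_eq_map]
      refine this.trans ?_
      rw [List.nil_append, ← List.map_append]
      exact (p.map _).cons _

lemma high_nodup {S : DotPath} (h : Valid S) : ((high S) ++ (low S)).Nodup :=
  (high_perm h).2.nodup_iff.2 List.nodup_range

lemma lt_of_mem_high {S : DotPath} (h : Valid S) {x : ℕ} (hx : x ∈ (high S)) : x < S.length := by
  simpa using (high_perm h).2.mem_iff.1 (List.mem_append_left _ hx)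

lemma rows_le (S : DotPath) : (rows S) ≤ S.length := by
  induction S with
  | nil => simp [rows]
  | cons b S ih => cases b <;> simp [rows] <;> omega

/-- The braid of a valid path in terms of its arcs. -/
theorem braid_eq {S : DotPath} (h : Valid S) {s : ℕ → Γ} (hs : BraidSeq (rows S) s) :
    DotPath.braid s S = wordEval s (arcWord S) * (wordEval s (deltaWord (rows S)))⁻¹ *
      wordEval s (ascentWord S.length (high S)) := by
  induction S generalizing s with
  | nil => simp [DotPath.braid, arcWord, rows, deltaWord, ascentWord]
  | cons b S ih =>
    cases b with
    | none =>
      have hlen := (high_perm h).1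
      simp only [high, List.length_cons, List.length_map, rows, Nat.add_right_cancel_iff] at hlen
      have hl := letters_ascentWord S.length (high S)
      rw [hlen] at hl
      have e := ascentWord_zero_cons S.length [] ((high S).map (· + 1)) (by simp)
      simp only [List.nil_append, dropZero_map_succ, dropZero_nil, List.length_nil,
        List.length_map, Nat.zero_add, hlen] at e
      -- The new half twist and the ascent word of the list with 0 in front acquire the same factor
      -- `σ_k ⋯ σ_1`, here with `k` the old number of rows, and it cancels.
      rw [DotPath.braid, ih h hs.shift, arcWord, rows, hs.delta_succ, high, List.length_cons, e,
        wordEval_append, hs.slide_word le_rfl (by simp [rows]; omega)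
          (fun x hx => by have := hl x hx; omega)]
      simp only [← wordEval_map_succ]
      group
    | some bs =>
      obtain ⟨hl, ha, hS⟩ := h
      have hlen := (high_perm hS).1
      have e := hs.ascentWord_mul_tangle (M := S.length) (A := []) rfl (xs := (high S).map (· + 1))
        (by simp [hl, hlen]) ha (by simpa using fun x hx => lt_of_mem_high hS hx) (by simp)
        (by
          rw [List.nil_append]
          exact (List.nodup_map_iff (add_left_injective 1)).2 (high_nodup hS).of_append_left)
        (by simp [rows, hlen])
      have hy : bubbleCarry 0 bs ((high S).map (· + 1)) ∈ 0 :: (high S).map (· + 1) :=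
        (bubble_perm (bs := bs) (by simp [hl, hlen])).mem_iff.1 (by simp)
      simp only [List.nil_append, ascentWord_map_succ, List.length_nil, Nat.add_zero,
        List.length_map, List.countP_map, Function.comp_def] at e
      rw [DotPath.braid, ih hS hs, mul_assoc, e, arcWord, rows, high, List.length_cons,
        wordEval_append, ← hlen]
      rw [rows, ← hlen] at hs
      generalize bubbleCarry 0 bs ((high S).map (· + 1)) = y at *
      -- Either nothing is smaller than the carried letter, or it is itself an entry that is not
      -- counted; in the latter case the run has at most `k - 1` letters, as the flip by the half
      -- twist requires.
      have hc : y = 0 ∨ (high S).countP (fun z => decide (z + 1 < y)) + 1 ≤ (high S).length := by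
        rw [List.mem_cons] at hy
        refine hy.imp_right fun hy => ?_
        obtain ⟨z, hz, rfl⟩ := List.mem_map.1 hy
        refine Nat.lt_of_le_of_ne List.countP_le_length fun he => ?_
        simpa using List.countP_eq_length.1 he z hz
      rcases hc with rfl | hc
      · simp
      · have := hs.delta_descWord hc
        rw [← eq_inv_mul_iff_mul_eq, ← mul_assoc, ← mul_inv_eq_iff_eq_mul] at this
        simp only [mul_assoc] at this ⊢
        rw [← mul_assoc _ (wordEval s (List.range' _ _)), ← this]
        simp only [mul_assoc]

lemma letters_gaps {S : DotPath} (h : Valid S) : Letters S.length (gaps S) := by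
  induction S with
  | nil => simp [gaps, Letters]
  | cons b S ih =>
    cases b with
    | none => exact (ih h).map_succ
    | some bs =>
      obtain ⟨hl, ha, hS⟩ := h
      refine Letters.append (fun x hx => ?_) (ih hS).map_succ
      have := mem_gapWord (List.mem_reverse.1 hx)
      have := rows_le S
      simp
      omega

/-- Undoing the pass of the first column returns the window of the rest, shifted and with 0 in
front, and every undone swap supplies a generator because the path is valid. The 0 in front
contributes the last factor of the half twist. Compared with `IsReducedWord.ascentWord_mul`, this
makes the gap word a positive lift of `u`. -/
theorem ascentWord_mul_gaps {S : DotPath} (h : Valid S) {s : ℕ → Γ} (hs : BraidSeq S.length s) :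
    wordEval s (ascentWord S.length ((high S) ++ (low S))) * wordEval s (gaps S) =
      wordEval s (deltaWord S.length) := by
  induction S with
  | nil => simp [gaps, deltaWord, ascentWord]
  | cons b S ih =>
    have step : ∀ hS : Valid S, wordEval s (ascentWord (S.length + 1)
        (0 :: ((high S) ++ (low S)).map (· + 1))) * wordEval s ((gaps S).map (· + 1)) =
        wordEval s (deltaWord (S.length + 1)) := fun hS => by
      have e := ascentWord_zero_cons S.length [] (((high S) ++ (low S)).map (· + 1)) (by simp)
      simp only [List.nil_append, dropZero_map_succ, dropZero_nil, List.length_nil,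
        List.length_map, Nat.zero_add, (high_perm hS).2.length_eq, List.length_range] at e
      rw [e, wordEval_append, mul_assoc, ← hs.slide_word le_rfl (by simp; omega)
        (fun x hx => by have := letters_gaps hS x hx; omega), ← mul_assoc,
        ih hS (hs.mono (by simp)), deltaWord, wordEval_append]
    cases b with
    | none =>
      simpa [high, low, gaps] using step h
    | some bs =>
      obtain ⟨hl, ha, hS⟩ := h
      have hp := high_perm hS
      have e := hs.ascentWord_bubble (M := S.length + 1) (A := []) (B := (low S).map (· + 1))
        (xs := (high S).map (· + 1)) (c := 0) (by simp [hl, hp.1]) ha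
        ⟨by omega, by simpa using fun x hx => lt_of_mem_high hS hx⟩
        (by
          rw [List.nil_append, ← List.map_append, List.nodup_cons]
          exact ⟨by simp, (List.nodup_map_iff (add_left_injective 1)).2 (high_nodup hS)⟩)
        (by simpa using hp.2.length_eq.le)
      rw [List.nil_append, List.nil_append] at e
      rw [high, low, gaps, List.length_cons, wordEval_append, ← mul_assoc, ← step hS,
        List.map_append, e]
      rfl

end DotPath
end

/-! ### Dot diagrams -/

/-- The rows of the partition `r ⊆ (n - k)^k` are weakly decreasing. -/
structure IsShape (k n : ℕ) (r : ℕ → ℕ) : Prop where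
  le : k ≤ n
  anti : ∀ i, r (i + 1) ≤ r i
  bound : ∀ i, r i ≤ n - k
  zero : ∀ i, k ≤ i → r i = 0

/-- The dots of a column, from the top down. -/
def colDots : ℕ → (ℕ → Bool) → List Bool
  | 0, _ => []
  | k + 1, d => d k :: colDots k d

/-- The path of the diagram with row lengths `r` and dots `d`. -/
def dotPath : ℕ → ℕ → (ℕ → ℕ) → (ℕ → ℕ → Bool) → DotPath
  | 0, _, _, _ => []
  | n + 1, k, r, d =>
    -- Without the guard, `k = 0` would be read as an empty row 0, since `k - 1` truncates; when no
    -- rows remain, all steps are columns.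
    if 1 ≤ k ∧ r (k - 1) = 0 then none :: dotPath n (k - 1) r d
    else some (colDots k fun i => d i 0) ::
      dotPath n k (fun i => r i - 1) (fun i j => d i (j + 1))

lemma dotPath_row {n k : ℕ} {r : ℕ → ℕ} (d : ℕ → ℕ → Bool) (h : r k = 0) :
    dotPath (n + 1) (k + 1) r d = none :: dotPath n k r d := by
  simp [dotPath, h]

lemma dotPath_col {n k : ℕ} {r : ℕ → ℕ} (d : ℕ → ℕ → Bool) (h : ∀ i < k, 1 ≤ r i) :
    dotPath (n + 1) k r d = some (colDots k fun i => d i 0) ::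
      dotPath n k (fun i => r i - 1) (fun i j => d i (j + 1)) := by
  rw [dotPath, if_neg]
  rintro ⟨h1, h2⟩
  have := h (k - 1) (by omega)
  omega

lemma IsShape.antitone {k n : ℕ} {r : ℕ → ℕ} (h : IsShape k n r) : Antitone r :=
  antitone_nat_of_succ_le h.anti

@[elab_as_elim]
-- If the last row is not empty, no row is, so the first column is full and can be removed; the
-- bound `r i ≤ n - k` then leaves room for it. The dots are carried along for statements about
-- `dotPath`.
theorem IsShape.induction {P : ∀ (k n : ℕ) (r : ℕ → ℕ) (_ : ℕ → ℕ → Bool), IsShape k n r → Prop}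
    (nil : ∀ r d h, P 0 0 r d h)
    (row : ∀ k n r d h h', r k = 0 → P k n r d h' → P (k + 1) (n + 1) r d h)
    (col : ∀ k n r d h h', (∀ i < k, 1 ≤ r i) →
      P k n (fun i => r i - 1) (fun i j => d i (j + 1)) h' → P k (n + 1) r d h)
    {k n : ℕ} {r : ℕ → ℕ} (d : ℕ → ℕ → Bool) (h : IsShape k n r) : P k n r d h := by
  induction n generalizing k r d with
  | zero =>
    obtain rfl : k = 0 := by have := h.le; omega
    exact nil r d h
  | succ n ih =>
    by_cases hk : 1 ≤ k ∧ r (k - 1) = 0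
    · obtain ⟨k, rfl⟩ : ∃ m, k = m + 1 := ⟨k - 1, by omega⟩
      have h0 : r k = 0 := by simpa using hk.2
      have h' : IsShape k n r :=
        ⟨by have := h.le; omega, h.anti, fun i => by have := h.bound i; omega, fun i hi => by
          rcases hi.eq_or_lt with rfl | hi
          · exact h0
          · exact h.zero i hi⟩
      exact row k n r d h h' h0 (ih d h')
    · have h1 : ∀ i < k, 1 ≤ r i := fun i hi => by
        have := h.antitone (show i ≤ k - 1 by omega)
        have : 1 ≤ k := by omega
        simp only [this, true_and] at hk
        omega
      have hkn : k ≤ n := by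
        by_contra hc
        have := h.bound (k - 1)
        have := h1 (k - 1) (by omega)
        omega
      have h' : IsShape k n fun i => r i - 1 :=
        ⟨hkn, fun i => Nat.sub_le_sub_right (h.anti i) 1,
          fun i => by have := h.bound i; omega, fun i hi => by have := h.zero i hi; omega⟩
      exact col k n r d h h' h1 (ih _ h')

lemma length_colDots (k : ℕ) (d : ℕ → Bool) : (colDots k d).length = k := by
  induction k with
  | zero => rfl
  | succ k ih => simp [colDots, ih]

lemma getD_colDots {k p : ℕ} (d : ℕ → Bool) (h : p < k) :
    (colDots k d).getD p false = d (k - 1 - p) := by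
  induction k generalizing p with
  | zero => omega
  | succ k ih =>
    cases p with
    | zero => simp [colDots]
    | succ p =>
      rw [colDots, List.getD_cons_succ, ih (by omega)]
      congr 1
      omega

/-- The letters in the boxes without dot. -/
def emptyWord (k m : ℕ) (r : ℕ → ℕ) (d : ℕ → ℕ → Bool) : List ℕ :=
  (List.range m).flatMap fun j =>
    ((List.range k).filter fun i => j < r i ∧ d i j = false).map fun i => k + j - i

lemma gapWord_colDots (k : ℕ) (d : ℕ → Bool) :
    (gapWord 1 (colDots k d)).reverse =
      ((List.range k).filter fun i => d i = false).map fun i => k - i := by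
  induction k with
  | zero => rfl
  | succ k ih =>
    have e : ((List.range k).filter fun i => d i = false).map (fun i => k + 1 - i) =
        ((gapWord 1 (colDots k d)).reverse).map (· + 1) := by
      rw [ih, List.map_map]
      refine List.map_congr_left fun i hi => ?_
      simp only [List.mem_filter, List.mem_range] at hi
      simp only [Function.comp_apply]
      omega
    rw [List.range_succ, List.filter_append, List.map_append, e, colDots]
    cases hd : d k
    · simp [gapWord, gapWord_succ 1, hd]
    · simp [gapWord, gapWord_succ 1, hd]

lemma emptyWord_col (k m : ℕ) (r : ℕ → ℕ) (d : ℕ → ℕ → Bool) :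
    emptyWord k (m + 1) r d =
      (((List.range k).filter fun i => 0 < r i ∧ d i 0 = false).map fun i => k - i) ++
        (emptyWord k m (fun i => r i - 1) (fun i j => d i (j + 1))).map (· + 1) := by
  rw [emptyWord, List.range_succ_eq_map, List.flatMap_cons, emptyWord, List.map_flatMap,
    List.flatMap_map, Nat.add_zero]
  congr 1
  congr 1
  funext j
  rw [List.map_map]
  have : ∀ i, (decide (j + 1 < r i ∧ d i (j + 1) = false)) =
      decide (j < r i - 1 ∧ d i (j + 1) = false) := fun i => by
    congr 1
    simp only [eq_iff_iff]
    refine and_congr_left fun _ => ?_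
    omega
  simp only [Nat.succ_eq_add_one, this]
  refine List.map_congr_left fun i hi => ?_
  simp only [List.mem_filter, List.mem_range] at hi
  simp only [Function.comp_apply]
  omega

lemma gaps_dotPath {k n : ℕ} {r : ℕ → ℕ} (d : ℕ → ℕ → Bool) (h : IsShape k n r) :
    (dotPath n k r d).gaps = emptyWord k (n - k) r d := by
  induction d, h using IsShape.induction with
  | nil r d h => simp [dotPath, DotPath.gaps, emptyWord]
  | row k n r d h h' h0 ih =>
    rw [dotPath_row d h0, DotPath.gaps, ih, emptyWord, emptyWord, List.map_flatMap,
      Nat.add_sub_add_right]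
    congr 1
    funext j
    have e : [k].filter (fun i => j < r i ∧ d i j = false) = [] := by simp [h0]
    rw [List.range_succ, List.filter_append, e, List.append_nil, List.map_map]
    refine List.map_congr_left fun i hi => ?_
    simp only [List.mem_filter, List.mem_range] at hi
    simp only [Function.comp_apply]
    omega
  | col k n r d h h' h1 ih =>
    rw [dotPath_col d h1, DotPath.gaps, ih, Nat.succ_sub h'.le, emptyWord_col, gapWord_colDots]
    congr 2
    refine List.filter_congr fun i hi => ?_
    have := h1 i (List.mem_range.1 hi)
    simp [show 0 < r i by omega]

lemma length_dotPath {n : ℕ} (k : ℕ) (r : ℕ → ℕ) (d : ℕ → ℕ → Bool) :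
    (dotPath n k r d).length = n := by
  induction n generalizing k r d with
  | zero => rfl
  | succ n ih =>
    rw [dotPath]
    split_ifs <;> simp [ih]

lemma rows_dotPath {k n : ℕ} {r : ℕ → ℕ} (d : ℕ → ℕ → Bool) (h : IsShape k n r) :
    (dotPath n k r d).rows = k := by
  induction d, h using IsShape.induction with
  | nil r d h => rfl
  | row k n r d h h' h0 ih => rw [dotPath_row d h0, DotPath.rows, ih]
  | col k n r d h h' h1 ih => rw [dotPath_col d h1, DotPath.rows, ih]

lemma braid_dotPath {Γ : Type*} [Group Γ] (s : ℕ → Γ) {k n : ℕ} {r : ℕ → ℕ} (d : ℕ → ℕ → Bool)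
    (h : IsShape k n r) (hd : ∀ i j, d i j → j < r i) :
    (dotPath n k r d).braid s =
      ((List.range (n - k)).reverse.map fun j => tangle s (colDots k fun i => d i j)).prod := by
  induction d, h using IsShape.induction generalizing s with
  | nil r d h => simp [dotPath, DotPath.braid]
  | row k n r d h h' h0 ih =>
    have : ∀ j, d k j = false := fun j => by
      by_contra hc
      have := hd k j (by simpa using hc)
      omega
    rw [dotPath_row d h0, DotPath.braid, ih _ hd, Nat.add_sub_add_right]
    simp [colDots, this, tangle]
  | col k n r d h h' h1 ih =>
    rw [dotPath_col d h1, DotPath.braid, ih _ (fun i j hij => by have := hd _ _ hij; beta_reduce at *; omega),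
      Nat.succ_sub h'.le, List.range_succ_eq_map]
    simp [Function.comp_def]

/-- A box with a dot below it (or in it) and a dot to the left (or in it) has a dot. -/
def IsLe (r : ℕ → ℕ) (d : ℕ → ℕ → Bool) : Prop :=
  ∀ r₁ r₂ c₁ c₂ : ℕ, d r₁ c₁ → d r₂ c₂ → r₁ ≤ r₂ → c₂ ≤ c₁ → c₁ < r r₂ → d r₂ c₁

/-! ### Comparison of entries before and after a pass. -/

section Bubble

variable {c : ℕ} {bs : List Bool} {xs : List ℕ}

lemma lt_bubbleOut (hl : bs.length = xs.length) {a : ℕ} (hc : a < c)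
    (h : ∀ q < xs.length, a < xs.getD q 0) {q : ℕ} (hq : q < xs.length) :
    a < (bubbleOut c bs xs).getD q 0 := by
  induction bs generalizing c xs q with
  | nil => simp at hl; omega
  | cons b bs ih =>
    cases xs with
    | nil => simp at hl
    | cons x xs =>
      simp only [List.length_cons, Nat.add_right_cancel_iff] at hl
      have hx := h 0 (by simp)
      have h' : ∀ q < xs.length, a < xs.getD q 0 := fun q hq => by simpa using h (q + 1) (by simpa)
      cases q with
      | zero =>
        cases b
        · exact hx
        · exact hc
      | succ q =>
        simp only [List.length_cons, Nat.add_lt_add_iff_right] at hq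
        cases b
        · exact ih hl hc h' hq
        · exact ih hl hx h' hq

lemma getD_bubbleOut_of_false (hl : bs.length = xs.length) {q : ℕ} (hq : q < xs.length)
    (hb : bs.getD q false = false) : (bubbleOut c bs xs).getD q 0 = xs.getD q 0 := by
  induction bs generalizing c xs q with
  | nil => simp at hl; omega
  | cons b bs ih =>
    cases xs with
    | nil => simp at hl
    | cons x xs =>
      simp only [List.length_cons, Nat.add_right_cancel_iff] at hl
      cases q with
      | zero =>
        obtain rfl : b = false := by simpa using hb
        simp [bubbleOut]
      | succ q =>
        simp only [List.length_cons, Nat.add_lt_add_iff_right] at hq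
        cases b
        · exact ih hl hq hb
        · exact ih hl hq hb

/-- The carried letter is `c` or an entry at an earlier dot, hence smaller than all that follows.
What a dot leaves behind is such a letter and so lies below all later results. Two gaps keep their
entries, and the remaining case, a gap before a dot, is excluded by hypothesis. -/
lemma bubbleAscending_of_lt (hl : bs.length = xs.length) (h : ∀ q < xs.length, c < xs.getD q 0)
    (h₂ : ∀ p q, p < q → q < xs.length → bs.getD p false → xs.getD p 0 < xs.getD q 0) :
    BubbleAscending c bs xs ∧
      ∀ p q, p < q → q < xs.length → (bs.getD q false → bs.getD p false) →
        (bs.getD p false = false → bs.getD q false = false → xs.getD p 0 < xs.getD q 0) →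
        (bubbleOut c bs xs).getD p 0 < (bubbleOut c bs xs).getD q 0 := by
  induction bs generalizing c xs with
  | nil =>
    cases xs with
    | nil => simp [BubbleAscending]
    | cons x xs => simp at hl
  | cons b bs ih =>
    cases xs with
    | nil => simp at hl
    | cons x xs =>
      simp only [List.length_cons, Nat.add_right_cancel_iff] at hl
      have hx := h 0 (by simp)
      have h' : ∀ q < xs.length, c < xs.getD q 0 := fun q hq => by simpa using h (q + 1) (by simpa)
      have h₂' : ∀ p q, p < q → q < xs.length → bs.getD p false →
          xs.getD p 0 < xs.getD q 0 := fun p q hpq hq hb => by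
        simpa using h₂ (p + 1) (q + 1) (by omega) (by simpa) (by simpa using hb)
      cases b
      · obtain ⟨i₁, i₂⟩ := ih hl h' h₂'
        refine ⟨⟨hx, i₁⟩, fun p q hpq hq hd hx' => ?_⟩
        obtain ⟨q, rfl⟩ : ∃ m, q = m + 1 := ⟨q - 1, by omega⟩
        simp only [List.length_cons, Nat.add_lt_add_iff_right] at hq
        cases p with
        | zero =>
          have hb : bs.getD q false = false := by simpa using hd
          have := hx' rfl (by simpa using hb)
          change x < (bubbleOut c bs xs).getD q 0
          rw [getD_bubbleOut_of_false hl hq hb]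
          exact this
        | succ p => exact i₂ p q (by omega) hq (by simpa using hd) (by simpa using hx')
      · obtain ⟨i₁, i₂⟩ := ih (c := x) hl
          (fun q hq => by simpa using h₂ 0 (q + 1) (by omega) (by simpa) (by simp)) h₂'
        refine ⟨⟨hx, i₁⟩, fun p q hpq hq hd hx' => ?_⟩
        obtain ⟨q, rfl⟩ : ∃ m, q = m + 1 := ⟨q - 1, by omega⟩
        simp only [List.length_cons, Nat.add_lt_add_iff_right] at hq
        cases p with
        | zero => exact lt_bubbleOut hl hx h' hq
        | succ p => exact i₂ p q (by omega) hq (by simpa using hd) (by simpa using hx')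

lemma BubbleAscending.carry_lt (hl : bs.length = xs.length) (h : BubbleAscending c bs xs) :
    (∀ q < xs.length, c < xs.getD q 0) ∧
      ∀ p q, p < q → q < xs.length → bs.getD p false → xs.getD p 0 < xs.getD q 0 := by
  induction bs generalizing c xs with
  | nil =>
    cases xs with
    | nil => simp
    | cons x xs => simp at hl
  | cons b bs ih =>
    cases xs with
    | nil => simp at hl
    | cons x xs =>
      simp only [List.length_cons, Nat.add_right_cancel_iff] at hl
      cases b
      · obtain ⟨i₁, i₂⟩ := ih hl h.2
        refine ⟨fun q hq => ?_, fun p q hpq hq hp => ?_⟩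
        · cases q with
          | zero => exact h.1
          | succ q => exact i₁ q (by simpa using hq)
        · obtain ⟨q, rfl⟩ : ∃ m, q = m + 1 := ⟨q - 1, by omega⟩
          cases p with
          | zero => simp at hp
          | succ p => exact i₂ p q (by omega) (by simpa using hq) hp
      · obtain ⟨i₁, i₂⟩ := ih hl h.2
        refine ⟨fun q hq => ?_, fun p q hpq hq hp => ?_⟩
        · cases q with
          | zero => exact h.1
          | succ q => exact h.1.trans (i₁ q (by simpa using hq))
        · obtain ⟨q, rfl⟩ : ∃ m, q = m + 1 := ⟨q - 1, by omega⟩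
          cases p with
          | zero => exact i₁ q (by simpa using hq)
          | succ p => exact i₂ p q (by omega) (by simpa using hq) hp

lemma exists_bubbleOut_eq (hl : bs.length = xs.length) {q : ℕ} (hq : bs.getD q false) :
    ∃ p, p < xs.length ∧ (bubbleOut c bs xs).getD p 0 = c := by
  induction bs generalizing c xs q with
  | nil => simp at hq
  | cons b bs ih =>
    cases xs with
    | nil => simp at hl
    | cons x xs =>
      simp only [List.length_cons, Nat.add_right_cancel_iff] at hl
      cases b
      · cases q with
        | zero => simp at hq
        | succ q =>
          obtain ⟨p, hp, e⟩ := ih hl (q := q) (by simpa using hq) (c := c)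
          exact ⟨p + 1, by simpa, e⟩
      · exact ⟨0, by simp, by simp [bubbleOut]⟩

/-- The first dot after the gap `p` would receive the letter that was carried past `p`, which is
smaller than the entry at `p`, against minimality. -/
lemma BubbleAscending.eq_false (hl : bs.length = xs.length) (h : BubbleAscending c bs xs) {p : ℕ}
    (hp : bs.getD p false = false) (hpl : p < xs.length)
    (hmin : ∀ q, p < q → q < xs.length →
      (bubbleOut c bs xs).getD p 0 < (bubbleOut c bs xs).getD q 0)
    {q : ℕ} (hpq : p < q) : bs.getD q false = false := by
  induction bs generalizing c xs p q with
  | nil => simp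
  | cons b bs ih =>
    cases xs with
    | nil => simp at hl
    | cons x xs =>
      simp only [List.length_cons, Nat.add_right_cancel_iff] at hl
      obtain ⟨q, rfl⟩ : ∃ m, q = m + 1 := ⟨q - 1, by omega⟩
      cases p with
      | zero =>
        obtain rfl : b = false := by simpa using hp
        by_contra hc
        obtain ⟨p, hp, e⟩ := exists_bubbleOut_eq (c := c) hl (q := q) (by simpa using hc)
        have := hmin (p + 1) (by omega) (by simpa)
        simp only [bubbleOut, List.getD_cons_zero, List.getD_cons_succ, e] at this
        exact absurd h.1 (by omega)
      | succ p =>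
        simp only [List.length_cons, Nat.add_lt_add_iff_right] at hpl
        cases b
        · exact ih hl h.2 hp hpl (fun q hq hq' => hmin (q + 1) (by omega) (by simpa)) (by omega)
        · exact ih hl h.2 hp hpl (fun q hq hq' => hmin (q + 1) (by omega) (by simpa)) (by omega)

lemma getD_map_succ {l : List ℕ} {p : ℕ} (h : p < l.length) :
    (l.map (· + 1)).getD p 0 = l.getD p 0 + 1 := by
  simp [List.getD_eq_getElem?_getD, h]

end Bubble

/-- The path of a Le diagram is valid. -/
theorem valid_dotPath {k n : ℕ} {r : ℕ → ℕ} (d : ℕ → ℕ → Bool) (h : IsShape k n r)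
    (hL : IsLe r d) :
    (dotPath n k r d).Valid ∧
      ∀ p q, p < q → q < k →
        (∀ j, d (k - 1 - q) j → j < r (k - 1 - p) → d (k - 1 - p) j) →
        (dotPath n k r d).high.getD p 0 < (dotPath n k r d).high.getD q 0 := by
  -- The second clause is what keeps the induction going: an entry is smaller than a later one if
  -- the row of the former contains the dots of the row of the latter, as far as it has boxes. The
  -- Le condition provides this for every row with a dot in the first column.
  induction d, h using IsShape.induction with
  | nil r d h => simp [dotPath, DotPath.Valid]
  | row k n r d h h' h0 ih =>
    obtain ⟨i₁, i₂⟩ := ih hL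
    have hlen := (DotPath.high_perm i₁).1
    rw [rows_dotPath d h'] at hlen
    rw [dotPath_row d h0]
    refine ⟨i₁, fun p q hpq hq hd => ?_⟩
    obtain ⟨q, rfl⟩ : ∃ m, q = m + 1 := ⟨q - 1, by omega⟩
    rw [DotPath.high, List.getD_cons_succ, getD_map_succ (by omega)]
    cases p with
    | zero => simp
    | succ p =>
      rw [List.getD_cons_succ, getD_map_succ (by omega)]
      have := i₂ p q (by omega) (by omega) (fun j => by
        have := hd j
        rwa [show k + 1 - 1 - (q + 1) = k - 1 - q by omega,
          show k + 1 - 1 - (p + 1) = k - 1 - p by omega] at this)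
      omega
  | col k n r d h h' h1 ih =>
    obtain ⟨i₁, i₂⟩ := ih fun r₁ r₂ c₁ c₂ a b c d e =>
      hL r₁ r₂ (c₁ + 1) (c₂ + 1) a b c (by beta_reduce at *; omega) (by beta_reduce at *; omega)
    have hlen := (DotPath.high_perm i₁).1
    rw [rows_dotPath _ h'] at hlen
    rw [dotPath_col d h1]
    set H := (dotPath n k (fun i => r i - 1) fun i j => d i (j + 1)).high with hH
    have hb : (colDots k fun i => d i 0).length = (H.map (· + 1)).length := by
      simp [length_colDots, hlen]
    have key := bubbleAscending_of_lt (c := 0) hb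
      (fun q hq => by
        rw [List.length_map] at hq
        rw [getD_map_succ hq]; omega)
      (fun p q hpq hq hp => by
        rw [List.length_map] at hq
        rw [getD_colDots _ (by omega)] at hp
        rw [getD_map_succ (by omega), getD_map_succ hq]
        have := i₂ p q hpq (by omega) (fun j hj hjr => hL _ _ (j + 1) 0 hj hp (by omega) (by omega)
          (by beta_reduce at *; omega))
        omega)
    refine ⟨⟨?_, key.1, i₁⟩, fun p q hpq hq hd => ?_⟩
    · rw [length_colDots, rows_dotPath _ h']
    · refine key.2 p q hpq (by simpa [hlen] using hq) ?_ ?_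
      · rw [getD_colDots _ hq, getD_colDots _ (by omega)]
        exact fun hdq => hd 0 hdq (h1 _ (by omega))
      · intro _ _
        rw [getD_map_succ (by omega), getD_map_succ (by omega)]
        have := i₂ p q hpq hq (fun j hj hjr => hd (j + 1) hj (by beta_reduce at *; omega))
        omega

/-- A diagram with a valid path is a Le diagram. -/
theorem isLe_of_valid {k n : ℕ} {r : ℕ → ℕ} (d : ℕ → ℕ → Bool) (h : IsShape k n r)
    (hd : ∀ i j, d i j → j < r i) (hV : (dotPath n k r d).Valid) :
    IsLe r d ∧
      ∀ p, (∀ q, p < q → q < k →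
        (dotPath n k r d).high.getD p 0 < (dotPath n k r d).high.getD q 0) →
        ∀ q, p < q → q < k → ∀ j, d (k - 1 - q) j → j < r (k - 1 - p) → d (k - 1 - p) j := by
  -- The converse comparison: an entry smaller than all later ones forces its row to contain the
  -- dots of the rows below. In a valid path every dot of the first column produces such an entry.
  induction d, h using IsShape.induction with
  | nil r d h =>
    refine ⟨fun r₁ r₂ c₁ c₂ _ _ _ _ h' => ?_, fun p _ q _ hq => by omega⟩
    rw [h.zero r₂ (by omega)] at h'
    omega
  | row k n r d h h' h0 ih =>
    rw [dotPath_row d h0] at hV ⊢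
    have hlen := (DotPath.high_perm (S := dotPath n k r d) hV).1
    rw [rows_dotPath d h'] at hlen
    obtain ⟨i₁, i₂⟩ := ih hd hV
    refine ⟨i₁, fun p hp q hpq hq j hj hjr => ?_⟩
    cases p with
    | zero => simp [h0] at hjr
    | succ p =>
      obtain ⟨q, rfl⟩ : ∃ m, q = m + 1 := ⟨q - 1, by omega⟩
      rw [show k + 1 - 1 - (q + 1) = k - 1 - q by omega] at hj
      rw [show k + 1 - 1 - (p + 1) = k - 1 - p by omega] at hjr ⊢
      refine i₂ p (fun q hpq hq => ?_) q (by omega) (by omega) j hj hjr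
      have := hp (q + 1) (by omega) (by omega)
      rw [DotPath.high, List.getD_cons_succ, List.getD_cons_succ, getD_map_succ (by omega),
        getD_map_succ (by omega)] at this
      omega
  | col k n r d h h' h1 ih =>
    rw [dotPath_col d h1] at hV ⊢
    obtain ⟨hl, ha, hS⟩ := hV
    obtain ⟨i₁, i₂⟩ := ih (fun i j hij => by have := hd _ _ hij; beta_reduce at *; omega) hS
    have hlen := (DotPath.high_perm hS).1
    rw [rows_dotPath _ h'] at hlen
    set H := (dotPath n k (fun i => r i - 1) fun i j => d i (j + 1)).high with hH
    have hb : (colDots k fun i => d i 0).length = (H.map (· + 1)).length := by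
      simp [length_colDots, hlen]
    have key := (ha.carry_lt hb).2
    have hdk : ∀ {i j}, d i j → i < k := fun {i j} hij => by
      by_contra hc
      have := hd _ _ hij
      have := h.zero i (by omega)
      omega
    have dot : ∀ p, p < k → d (k - 1 - p) 0 → ∀ q, p < q → q < k → H.getD p 0 < H.getD q 0 := by
      intro p hp hdp q hpq hq
      have := key p q hpq (by simpa [hlen]) (by rwa [getD_colDots _ hp])
      rw [getD_map_succ (by omega), getD_map_succ (by omega)] at this
      omega
    constructor
    · intro r₁ r₂ c₁ c₂ d₁ d₂ hr hc hcr
      rcases hr.eq_or_lt with rfl | hr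
      · exact d₁
      have hr₁ := hdk d₁
      have hr₂ := hdk d₂
      cases c₁ with
      | zero =>
        obtain rfl : c₂ = 0 := by omega
        exact d₂
      | succ c₁ =>
        cases c₂ with
        | zero =>
          have e₁ : k - 1 - (k - 1 - r₁) = r₁ := by omega
          have e₂ : k - 1 - (k - 1 - r₂) = r₂ := by omega
          have := i₂ (k - 1 - r₂) (dot _ (by omega) (by rwa [e₂])) (k - 1 - r₁) (by omega)
            (by omega) c₁
          rw [e₁, e₂] at this
          exact this d₁ (by beta_reduce at *; omega)
        | succ c₂ => exact i₁ r₁ r₂ c₁ c₂ d₁ d₂ hr.le (by beta_reduce at *; omega) (by beta_reduce at *; omega)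
    · intro p hp q hpq hq j hj hjr
      have hmin : ∀ q, p < q → q < (H.map (· + 1)).length →
          (bubbleOut 0 (colDots k fun i => d i 0) (H.map (· + 1))).getD p 0 <
            (bubbleOut 0 (colDots k fun i => d i 0) (H.map (· + 1))).getD q 0 :=
        fun q hpq hq => hp q hpq (by simpa [hlen] using hq)
      cases hdp : d (k - 1 - p) 0
      -- Row `p` has no dot in the first column, so neither do the rows below it. The pass leaves
      -- the entries from `p` on unchanged, and minimality passes to `H`.
      · have hf := fun q hpq => ha.eq_false hb (by rw [getD_colDots _ (by omega), hdp])
          (by simp; omega) hmin (q := q) hpq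
        have hH' : ∀ q, p < q → q < k → H.getD p 0 < H.getD q 0 := fun q hpq hq => by
          have := hmin q hpq (by simp; omega)
          rw [getD_bubbleOut_of_false hb (by simp; omega) (by
              rw [getD_colDots _ (by omega), hdp]),
            getD_bubbleOut_of_false hb (by simp; omega) (hf q hpq),
            getD_map_succ (by omega), getD_map_succ (by omega)] at this
          omega
        cases j with
        | zero =>
          have := hf q hpq
          rw [getD_colDots _ hq, hj] at this
          simp at this
        | succ j => exact i₂ p hH' q hpq hq j hj (by beta_reduce at *; omega)
      · cases j with
        | zero => exact hdp
        | succ j =>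
          exact i₂ p (dot p (by beta_reduce at *; omega) hdp) q hpq hq j hj (by beta_reduce at *; omega)

/-! ### Existence of the diagram -/

lemma bubble_colDots_false {k c : ℕ} {xs : List ℕ} (h : xs.length = k) :
    bubbleOut c (colDots k fun _ => false) xs = xs ∧
      bubbleCarry c (colDots k fun _ => false) xs = c := by
  induction k generalizing xs with
  | zero =>
    rw [List.length_eq_zero_iff] at h
    subst h
    simp [colDots, bubbleOut, bubbleCarry]
  | succ k ih =>
    cases xs with
    | nil => simp at h
    | cons x xs =>
      obtain ⟨e, f⟩ := ih (xs := xs) (by simpa using h)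
      simp [colDots, bubbleOut, bubbleCarry, e, f]

/-- The path of the diagram without dots. -/
def emptyPath (n k : ℕ) (r : ℕ → ℕ) : DotPath := dotPath n k r fun _ _ => false

lemma valid_emptyPath {k n : ℕ} {r : ℕ → ℕ} (h : IsShape k n r) : (emptyPath n k r).Valid :=
  (valid_dotPath _ h fun _ _ _ _ h => by simp at h).1

lemma length_high_emptyPath {k n : ℕ} {r : ℕ → ℕ} (h : IsShape k n r) :
    (emptyPath n k r).high.length = k := by
  rw [(DotPath.high_perm (valid_emptyPath h)).1]
  exact rows_dotPath _ h

lemma high_low_emptyPath_row {k n : ℕ} {r : ℕ → ℕ} (h0 : r k = 0) :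
    (emptyPath (n + 1) (k + 1) r).high = 0 :: (emptyPath n k r).high.map (· + 1) ∧
      (emptyPath (n + 1) (k + 1) r).low = (emptyPath n k r).low.map (· + 1) := by
  rw [emptyPath, dotPath_row _ h0]
  exact ⟨rfl, rfl⟩

lemma high_low_emptyPath_col {k n : ℕ} {r : ℕ → ℕ} (h : IsShape k n fun i => r i - 1)
    (h1 : ∀ i < k, 1 ≤ r i) :
    (emptyPath (n + 1) k r).high = (emptyPath n k fun i => r i - 1).high.map (· + 1) ∧
      (emptyPath (n + 1) k r).low = 0 :: (emptyPath n k fun i => r i - 1).low.map (· + 1) := by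
  have := bubble_colDots_false (c := 0) (k := k)
    (xs := (emptyPath n k fun i => r i - 1).high.map (· + 1)) (by
      rw [List.length_map, length_high_emptyPath h])
  rw [emptyPath, dotPath_col _ h1]
  refine ⟨this.1, ?_⟩
  rw [DotPath.low]
  exact congrArg₂ _ this.2 rfl

lemma getD_high_emptyPath {k n : ℕ} {r : ℕ → ℕ} (h : IsShape k n r) {p : ℕ} (hp : p < k) :
    (emptyPath n k r).high.getD p 0 = p + r (k - 1 - p) := by
  obtain ⟨d⟩ : Nonempty (ℕ → ℕ → Bool) := ⟨fun _ _ => false⟩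
  induction d, h using IsShape.induction generalizing p with
  | nil r d h => omega
  | row k n r d h h' h0 ih =>
    rw [(high_low_emptyPath_row h0).1]
    cases p with
    | zero => simp [h0]
    | succ p =>
      rw [List.getD_cons_succ, getD_map_succ (by rw [length_high_emptyPath h']; omega),
        ih (by omega), show k + 1 - 1 - (p + 1) = k - 1 - p by omega]
      omega
  | col k n r d h h' h1 ih =>
    rw [(high_low_emptyPath_col h' h1).1, getD_map_succ (by rw [length_high_emptyPath h']; omega),
      ih hp]
    have := h1 (k - 1 - p) (by omega)
    beta_reduce
    omega

lemma sorted_low_emptyPath {k n : ℕ} {r : ℕ → ℕ} (h : IsShape k n r) :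
    (emptyPath n k r).low.Pairwise (· < ·) := by
  obtain ⟨d⟩ : Nonempty (ℕ → ℕ → Bool) := ⟨fun _ _ => false⟩
  induction d, h using IsShape.induction with
  | nil r d h => simp [emptyPath, dotPath, DotPath.low]
  | row k n r d h h' h0 ih =>
    rw [(high_low_emptyPath_row h0).2]
    exact List.Pairwise.map _ (fun a b h => by omega) ih
  | col k n r d h h' h1 ih =>
    rw [(high_low_emptyPath_col h' h1).2, List.pairwise_cons]
    exact ⟨by simp, List.Pairwise.map _ (fun a b h => by omega) ih⟩

lemma exists_map_succ_eq {l : List ℕ} (h : 0 ∉ l) : ∃ l' : List ℕ, l = l'.map (· + 1) := by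
  induction l with
  | nil => exact ⟨[], rfl⟩
  | cons x l ih =>
    simp only [List.mem_cons, not_or] at h
    obtain ⟨l', rfl⟩ := ih h.2
    exact ⟨(x - 1) :: l', by simp; omega⟩

/-- The pass is run backwards, from the right: `c` is the minimum of the entries seen so far, and a
dot is set whenever a new minimum appears. By the last clause, the number of small entries in an
initial segment drops by at most one, and it can drop only if that segment already contains all
small entries; this preserves the rank conditions. -/
lemma exists_bubble_eq (V : List ℕ) (y : ℕ) (hnd : (V ++ [y]).Nodup) :
    ∃ (c : ℕ) (bs : List Bool) (xs : List ℕ), bs.length = V.length ∧ xs.length = V.length ∧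
      bubbleOut c bs xs = V ∧ bubbleCarry c bs xs = y ∧ BubbleAscending c bs xs ∧
      (∀ z ∈ V ++ [y], c ≤ z) ∧ c ∈ V ++ [y] ∧
      ∀ t M, c < M →
        (V.take t).countP (· < M) ≤ (xs.take t).countP (· < M) ∨
        (V.take t).countP (· < M) ≤ (xs.take t).countP (· < M) + 1 ∧
          (V ++ [y]).countP (· < M) = (V.take t).countP (· < M) := by
  induction V with
  | nil => exact ⟨y, [], [], by simp [bubbleOut, bubbleCarry, BubbleAscending]⟩
  | cons v V ih =>
    rw [List.cons_append, List.nodup_cons] at hnd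
    obtain ⟨c, bs, xs, hb, hx, ho, hc, ha, hmin, hmem, hr⟩ := ih hnd.2
    rcases lt_or_gt_of_ne (show v ≠ c by rintro rfl; exact hnd.1 hmem) with hvc | hvc
    · refine ⟨v, true :: bs, c :: xs, by simp [hb], by simp [hx], by simp [bubbleOut, ho],
        hc, ⟨hvc, ha⟩, ?_, by simp, fun t M hM => ?_⟩
      · intro z hz
        rw [List.cons_append, List.mem_cons] at hz
        rcases hz with rfl | hz
        · exact le_rfl
        · exact hvc.le.trans (hmin z hz)
      · cases t with
        | zero => simp
        | succ t =>
          by_cases hcM : c < M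
          · have := hr t M hcM
            simp only [List.take_succ_cons, List.cons_append, List.countP_cons, hM, hcM,
              decide_true, if_true]
            omega
          · have e : (V ++ [y]).countP (· < M) = 0 := List.countP_eq_zero.2 fun z hz => by
              have := hmin z hz
              simp only [decide_eq_true_eq]
              omega
            have e' : (V.take t).countP (· < M) = 0 := List.countP_eq_zero.2 fun z hz =>
              List.countP_eq_zero.1 e z (by simp [List.mem_of_mem_take hz])
            right
            simp only [List.take_succ_cons, List.cons_append, List.countP_cons, hM, e, e',
              decide_true, if_true]
            exact ⟨by omega, trivial⟩
    · refine ⟨c, false :: bs, v :: xs, by simp [hb], by simp [hx], by simp [bubbleOut, ho],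
        hc, ⟨hvc, ha⟩, ?_, by simp [hmem], fun t M hM => ?_⟩
      · intro z hz
        rw [List.cons_append, List.mem_cons] at hz
        rcases hz with rfl | hz
        · exact hvc.le
        · exact hmin z hz
      · cases t with
        | zero => simp
        | succ t =>
          have := hr t M hM
          simp only [List.take_succ_cons, List.cons_append, List.countP_cons]
          omega

lemma colDots_congr {k : ℕ} {d d' : ℕ → Bool} (h : ∀ i < k, d i = d' i) :
    colDots k d = colDots k d' := by
  induction k with
  | zero => rfl
  | succ k ih => rw [colDots, colDots, h k (by omega), ih fun i hi => h i (by omega)]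

lemma colDots_getD {k : ℕ} {bs : List Bool} (h : bs.length = k) :
    colDots k (fun i => bs.getD (k - 1 - i) false) = bs := by
  refine List.ext_getElem (by rw [length_colDots, h]) fun p h₁ h₂ => ?_
  have hp : p < k := by omega
  have := getD_colDots (fun i => bs.getD (k - 1 - i) false) hp
  rw [List.getD_eq_getElem _ _ h₁, show k - 1 - (k - 1 - p) = p by omega,
    List.getD_eq_getElem _ _ h₂] at this
  exact this

lemma countP_map_succ (l : List ℕ) (M : ℕ) :
    (l.map (· + 1)).countP (· < M + 1) = l.countP (· < M) := by
  rw [List.countP_map]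
  congr 1
  funext x
  simp

/-- Every permutation below the Grassmannian permutation of shape `r` comes from a diagram. -/
theorem exists_dots {k n : ℕ} {r : ℕ → ℕ} (h : IsShape k n r) {V Z : List ℕ}
    (hV : V.length = k) (hp : (V ++ Z).Perm (List.range n))
    (hr : ∀ t M, (((emptyPath n k r).high ++ (emptyPath n k r).low).take t).countP (· < M) ≤
      ((V ++ Z).take t).countP (· < M)) :
    ∃ d : ℕ → ℕ → Bool, (∀ i j, d i j → j < r i) ∧ (dotPath n k r d).Valid ∧
      (dotPath n k r d).high = V ∧ (dotPath n k r d).low = Z := by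
  obtain ⟨d⟩ : Nonempty (ℕ → ℕ → Bool) := ⟨fun _ _ => false⟩
  induction d, h using IsShape.induction generalizing V Z with
  | nil r d h =>
    simp only [List.range_zero, List.perm_nil, List.append_eq_nil_iff] at hp
    exact ⟨fun _ _ => false, by simp, by simp [dotPath, DotPath.Valid],
      by simp [dotPath, DotPath.high, hp.1], by simp [dotPath, DotPath.low, hp.2]⟩
  | row k n r d h h' h0 ih =>
    obtain ⟨e₁, e₂⟩ := high_low_emptyPath_row (n := n) h0
    rw [e₁, e₂] at hr
    have hnd := hp.nodup_iff.2 List.nodup_range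
    obtain _ | ⟨v, V⟩ := V
    · simp at hV
    have hv := hr 1 1
    simp only [List.cons_append, List.take_succ_cons, List.take_zero, List.countP_cons,
      List.countP_nil, decide_true, zero_lt_one, if_true, decide_eq_true_eq] at hv
    -- The rank condition for `t = M = 1` says that the first entry is below 1.
    obtain rfl : v = 0 := by split_ifs at hv <;> omega
    rw [List.cons_append, List.nodup_cons, List.mem_append, not_or] at hnd
    obtain ⟨V, rfl⟩ := exists_map_succ_eq hnd.1.1
    obtain ⟨Z, rfl⟩ := exists_map_succ_eq hnd.1.2
    rw [List.cons_append, List.range_succ_eq_map, List.perm_cons, ← List.map_append] at hp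
    have hp' : (V ++ Z).Perm (List.range n) :=
      (List.map_perm_map_iff (add_left_injective 1)).1 hp
    obtain ⟨d, hd, hval, hh, hl⟩ := ih (by simpa using hV) hp' fun t M => by
      have := hr (t + 1) (M + 1)
      simp only [List.cons_append, List.take_succ_cons, List.countP_cons, ← List.map_append,
        ← List.map_take, countP_map_succ] at this
      omega
    refine ⟨d, hd, ?_⟩
    rw [dotPath_row d h0]
    exact ⟨hval, by simp [DotPath.high, hh], by simp [DotPath.low, hl]⟩
  | col k n r d h h' h1 ih =>
    obtain ⟨e₁, e₂⟩ := high_low_emptyPath_col h' h1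
    rw [e₁, e₂] at hr
    have hnd := hp.nodup_iff.2 List.nodup_range
    have hW := length_high_emptyPath h'
    set W := (emptyPath n k fun i => r i - 1).high
    set X := (emptyPath n k fun i => r i - 1).low
    obtain _ | ⟨y, Z⟩ := Z
    · have hlen := hp.length_eq
      have := h'.le
      simp at hlen
      omega
    have hsplit : V ++ y :: Z = (V ++ [y]) ++ Z := by simp
    have hnd' : (V ++ [y]).Nodup := by rw [hsplit] at hnd; exact hnd.of_append_left
    obtain ⟨c, bs, xs, hb, hx, ho, hc, ha, hmin, hmem, hcount⟩ := exists_bubble_eq V y hnd'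
    have htk : ∀ M, (((W.map (· + 1) ++ 0 :: X.map (· + 1))).take (k + 1)).countP (· < M + 1) =
        W.countP (· < M) + 1 := fun M => by
      rw [List.take_append, List.take_of_length_le (by simp [hW]), List.length_map, hW,
        show k + 1 - k = 1 by omega, List.countP_append, countP_map_succ]
      simp
    have htk' : (V ++ y :: Z).take (k + 1) = V ++ [y] := by
      rw [hsplit, ← hV, List.take_append_of_le_length (by simp), List.take_of_length_le (by simp)]
    -- The rank condition at `t = k + 1`, `M = 1` puts 0 among the first `k + 1` entries, and `c` is
    -- their minimum.
    obtain rfl : c = 0 := by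
      have := hr (k + 1) 1
      rw [htk 0, htk'] at this
      have hpos : 0 < (V ++ [y]).countP (· < 1) := by omega
      obtain ⟨z, hz, hz'⟩ := List.countP_pos_iff.1 hpos
      have := hmin z hz
      simp only [decide_eq_true_eq] at hz'
      omega
    have hbp := bubble_perm_append (c := 0) (hb.trans hx.symm) [] Z
    rw [ho, hc, List.nil_append, List.nil_append] at hbp
    have hp' := hbp.symm.trans hp
    have hnd₂ := hp'.nodup_iff.2 List.nodup_range
    rw [List.nodup_cons, List.mem_append, not_or] at hnd₂
    obtain ⟨xs, rfl⟩ := exists_map_succ_eq hnd₂.1.1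
    obtain ⟨Z, rfl⟩ := exists_map_succ_eq hnd₂.1.2
    rw [List.range_succ_eq_map, List.perm_cons, ← List.map_append] at hp'
    replace hp' : (xs ++ Z).Perm (List.range n) :=
      (List.map_perm_map_iff (add_left_injective 1)).1 hp'
    have hxl : xs.length = k := by rw [← hV, ← hx]; simp
    have hVy : ∀ M, (V ++ [y]).countP (· < M + 1) = xs.countP (· < M) + 1 := fun M => by
      have := (bubble_perm (c := 0) (hb.trans hx.symm)).countP_eq (· < M + 1)
      rw [ho, hc, List.countP_cons, List.countP_cons, countP_map_succ] at this
      rw [List.countP_append, List.countP_cons, List.countP_nil]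
      simp at this ⊢
      omega
    obtain ⟨d, hd, hval, hh, hl⟩ := ih (V := xs) (Z := Z) hxl hp' fun t M => by
      -- For `t ≤ k`, if the count drops by one, the segment of `xs` still contains all small
      -- entries of `xs`, and the condition at `k + 1` suffices. For `t > k`, the condition at `t +
      -- 1` is used, and the letter 0 is removed from both sides.
      rcases le_or_gt t k with ht | ht
      · have h₁ := hr t (M + 1)
        rw [List.take_append_of_le_length (by simpa [hW]),
          List.take_append_of_le_length (by omega), ← List.map_take, countP_map_succ] at h₁
        have h₂ := hcount t (M + 1) (by omega)
        rw [← List.map_take, countP_map_succ, hVy] at h₂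
        have h₃ := hr (k + 1) (M + 1)
        rw [htk, htk', hVy] at h₃
        have h₄ : (W.take t).countP (· < M) ≤ W.countP (· < M) :=
          (List.take_sublist t W).countP_le
        rw [List.take_append_of_le_length (by omega), List.take_append_of_le_length (by omega)]
        omega
      · obtain ⟨e, rfl⟩ := Nat.exists_eq_add_of_lt ht
        have h₁ := hr (k + (e + 1) + 1) (M + 1)
        rw [hsplit, List.take_append, List.take_append,
          List.take_of_length_le (l := W.map (· + 1)) (by simp [hW]; omega),
          List.take_of_length_le (l := V ++ [y]) (by simp [hV]),
          List.countP_append, List.countP_append, countP_map_succ, hVy] at h₁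
        simp only [List.length_map, List.length_append, List.length_cons, List.length_nil, hW, hV,
          show k + (e + 1) + 1 - k = (e + 1) + 1 by omega,
          show k + (e + 1) + 1 - (k + (0 + 1)) = e + 1 by omega, List.take_succ_cons,
          List.countP_cons, ← List.map_take, countP_map_succ, Nat.zero_lt_succ, decide_true,
          if_true] at h₁
        rw [List.take_append, List.take_append, List.take_of_length_le (l := W) (by omega),
          List.take_of_length_le (l := xs) (by omega), List.countP_append, List.countP_append, hW, hxl,
          show k + e + 1 - k = e + 1 by omega]
        omega
    -- The test `i < k` is needed because `k - 1 - i` truncates to 0 beyond the last row.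
    refine ⟨fun i j => match j with
      | 0 => decide (i < k) && bs.getD (k - 1 - i) false
      | j + 1 => d i j, fun i j hij => ?_, ?_⟩
    · cases j with
      | zero =>
        simp only [Bool.and_eq_true, decide_eq_true_eq] at hij
        exact h1 i hij.1
      | succ j =>
        have := hd i j hij
        beta_reduce at this
        omega
    · have hcol : (colDots k fun i => decide (i < k) && bs.getD (k - 1 - i) false) = bs := by
        rw [← colDots_congr (d := fun i => bs.getD (k - 1 - i) false) fun i hi => by simp [hi]]
        exact colDots_getD (hb.trans hV)
      rw [dotPath_col _ h1]
      simp only [hcol]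
      refine ⟨⟨?_, ?_, hval⟩, ?_, ?_⟩
      · rw [rows_dotPath _ h', hb, hV]
      · rw [hh]; exact ha
      · rw [DotPath.high, hh, ho]
      · rw [DotPath.low, hh, hc, hl]

/-! ### Permutations as lists -/

/-- The window of the inverse of `v`. -/
def invWindow {n : ℕ} (v : Perm (Fin n)) : List ℕ := (List.finRange n).map fun c => (v⁻¹ c : ℕ)

/-- Exchange of the entries in positions `p` and `p + 1`. -/
def swapAt : ℕ → List ℕ → List ℕ
  | 0, x :: y :: l => y :: x :: l
  | p + 1, x :: l => x :: swapAt p l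
  | _, l => l

/-- The action of a word in the simple transpositions on lists. -/
def wordAct (w l : List ℕ) : List ℕ := w.foldr (fun p A => swapAt (p - 1) A) l

lemma swapAt_append (A B : List ℕ) (x y : ℕ) :
    swapAt A.length (A ++ x :: y :: B) = A ++ y :: x :: B := by
  induction A with
  | nil => rfl
  | cons a A ih => simp [swapAt, ih]

lemma length_swapAt (p : ℕ) (l : List ℕ) : (swapAt p l).length = l.length := by
  induction p generalizing l with
  | zero => rcases l with _ | ⟨x, _ | ⟨y, l⟩⟩ <;> rfl
  | succ p ih => cases l <;> simp [swapAt, ih]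

lemma swapAt_map (f : ℕ → ℕ) (p : ℕ) (l : List ℕ) : swapAt p (l.map f) = (swapAt p l).map f := by
  induction p generalizing l with
  | zero => rcases l with _ | ⟨x, _ | ⟨y, l⟩⟩ <;> rfl
  | succ p ih => cases l <;> simp [swapAt, ih]

lemma getElem?_swapAt {p : ℕ} {l : List ℕ} (h : p + 1 < l.length) (i : ℕ) :
    (swapAt p l)[i]? = if i = p then l[p + 1]? else if i = p + 1 then l[p]? else l[i]? := by
  induction p generalizing l i with
  | zero =>
    rcases l with _ | ⟨x, _ | ⟨y, l⟩⟩
    · simp at h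
    · simp at h
    · rcases i with _ | _ | i <;> simp [swapAt]
  | succ p ih =>
    cases l with
    | nil => simp at h
    | cons x l =>
      cases i with
      | zero => simp [swapAt]
      | succ i => simp [swapAt, ih (l := l) (by simpa using h)]

lemma length_invWindow {n : ℕ} (v : Perm (Fin n)) : (invWindow v).length = n := by
  simp [invWindow]

lemma getElem?_invWindow {n : ℕ} (v : Perm (Fin n)) (c : Fin n) :
    (invWindow v)[(c : ℕ)]? = some (v⁻¹ c : ℕ) := by
  simp [invWindow]

lemma invWindow_injective {n : ℕ} {v v' : Perm (Fin n)} (h : invWindow v = invWindow v') :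
    v = v' := by
  rw [← inv_inj]
  ext c
  have := getElem?_invWindow v c
  rw [h, getElem?_invWindow] at this
  exact (Option.some_inj.1 this).symm

lemma invWindow_one (n : ℕ) : invWindow (1 : Perm (Fin n)) = List.range n := by
  refine List.ext_getElem (by simp [invWindow]) fun i h₁ h₂ => by simp [invWindow]

lemma nodup_invWindow {n : ℕ} (v : Perm (Fin n)) : (invWindow v).Nodup :=
  (List.nodup_map_iff (Fin.val_injective.comp v⁻¹.injective)).2 (List.nodup_finRange n)

lemma mem_invWindow {n : ℕ} (v : Perm (Fin n)) {x : ℕ} : x ∈ invWindow v ↔ x < n := by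
  simp only [invWindow, List.mem_map, List.mem_finRange, true_and]
  constructor
  · rintro ⟨c, rfl⟩
    exact (v⁻¹ c).2
  · intro hx
    exact ⟨v ⟨x, hx⟩, by simp⟩

lemma invWindow_perm {n : ℕ} (v : Perm (Fin n)) : (invWindow v).Perm (List.range n) := by
  rw [List.perm_ext_iff_of_nodup (nodup_invWindow v) List.nodup_range]
  simp [mem_invWindow]

lemma invWindow_simpleTransposition_mul {n p : ℕ} (h1 : 1 ≤ p) (hp : p < n) (v : Perm (Fin n)) :
    invWindow (simpleTransposition n p * v) = swapAt (p - 1) (invWindow v) := by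
  refine List.ext_getElem? fun i => ?_
  rcases lt_or_ge i n with hi | hi
  · have := getElem?_invWindow (simpleTransposition n p * v) ⟨i, hi⟩
    rw [this, getElem?_swapAt (by rw [length_invWindow]; omega)]
    have e : (simpleTransposition n p * v)⁻¹ ⟨i, hi⟩ =
        v⁻¹ (swap ⟨p - 1, by omega⟩ ⟨p, hp⟩ ⟨i, hi⟩) := by
      simp [simpleTransposition, h1, hp, mul_inv_rev]
    rw [e, swap_apply_def]
    simp only [Fin.mk.injEq, Nat.sub_add_cancel h1]
    split_ifs
    · exact (getElem?_invWindow v ⟨p, hp⟩).symm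
    · exact (getElem?_invWindow v ⟨p - 1, _⟩).symm
    · exact (getElem?_invWindow v ⟨i, hi⟩).symm
  · rw [List.getElem?_eq_none (by rwa [length_invWindow]),
      List.getElem?_eq_none (by rwa [length_swapAt, length_invWindow])]

lemma invWindow_prod {n : ℕ} {w : List ℕ} (h : Letters n w) :
    invWindow (w.map (simpleTransposition n)).prod = wordAct w (List.range n) := by
  induction w with
  | nil => simp [wordAct, invWindow_one]
  | cons p w ih =>
    have hp := h p (by simp)
    rw [List.map_cons, List.prod_cons, invWindow_simpleTransposition_mul hp.1 hp.2,
      ih fun x hx => h x (by simp [hx])]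
    rfl

lemma wordAct_append (w w' l : List ℕ) : wordAct (w ++ w') l = wordAct w (wordAct w' l) := by
  simp [wordAct]

lemma wordAct_map_succ {w : List ℕ} (hw : ∀ p ∈ w, 1 ≤ p) (l : List ℕ) :
    wordAct (w.map (· + 1)) (0 :: l.map (· + 1)) = 0 :: (wordAct w l).map (· + 1) := by
  induction w with
  | nil => rfl
  | cons p w ih =>
    obtain ⟨p, rfl⟩ : ∃ m, p = m + 1 := ⟨p - 1, by have := hw p (by simp); omega⟩
    have := ih fun x hx => hw x (by simp [hx])
    simp only [wordAct, List.map_cons, List.foldr_cons, Nat.add_sub_cancel] at this ⊢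
    rw [this, swapAt, swapAt_map]

/-- The shadow of `BraidSeq.ascentWord_bubble` on permutations; no ascents are needed here. -/
lemma wordAct_gapWord {c : ℕ} {bs : List Bool} {A xs B : List ℕ} (hl : bs.length = xs.length) :
    wordAct (gapWord (A.length + 1) bs).reverse (A ++ c :: (xs ++ B)) =
      A ++ (bubbleOut c bs xs ++ bubbleCarry c bs xs :: B) := by
  induction bs generalizing c xs A with
  | nil =>
    cases xs with
    | nil => simp [bubbleCarry, bubbleOut, gapWord, wordAct]
    | cons x xs => simp at hl
  | cons b bs ih =>
    cases xs with
    | nil => simp at hl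
    | cons x xs =>
      simp only [List.length_cons, Nat.add_right_cancel_iff] at hl
      cases b
      · have := ih (c := c) (A := A ++ [x]) hl
        simp only [List.append_assoc, List.cons_append, List.nil_append, List.length_append,
          List.length_cons, List.length_nil, Nat.zero_add] at this
        rw [gapWord, List.reverse_cons, wordAct_append]
        have e : wordAct [A.length + 1] (A ++ c :: (x :: xs ++ B)) = A ++ x :: c :: (xs ++ B) :=
          swapAt_append A (xs ++ B) c x
        rw [e, this]
        rfl
      · have := ih (c := x) (A := A ++ [c]) hl
        simpa [bubbleOut, bubbleCarry, gapWord] using this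

lemma DotPath.wordAct_gaps {S : DotPath} (h : Valid S) :
    wordAct (gaps S) (List.range S.length) = high S ++ low S := by
  induction S with
  | nil => rfl
  | cons b S ih =>
    have step : ∀ hS : Valid S, wordAct ((gaps S).map (· + 1)) (List.range (S.length + 1)) =
        0 :: (high S ++ low S).map (· + 1) := fun hS => by
      rw [List.range_succ_eq_map, ← ih hS]
      exact wordAct_map_succ (fun p hp => (letters_gaps hS p hp).1) _
    cases b with
    | none =>
      rw [gaps, List.length_cons, step h, List.map_append]
      rfl
    | some bs =>
      obtain ⟨hl, -, hS⟩ := h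
      have := wordAct_gapWord (c := 0) (bs := bs) (A := []) (xs := (high S).map (· + 1))
        (B := (low S).map (· + 1)) (by simp [hl, (high_perm hS).1])
      rw [gaps, List.length_cons, wordAct_append, step hS, List.map_append]
      exact this

/-! ### Coxeter length, reduced words and Bruhat order. -/

section Length

variable {n : ℕ}

/-- Only the pair of places that hold the two exchanged letters can become an inversion. -/
lemma permLength_simpleTransposition_mul_le {p : ℕ} (h1 : 1 ≤ p) (hp : p < n)
    (v : Perm (Fin n)) : permLength (simpleTransposition n p * v) ≤ permLength v + 1 := by
  classical
  unfold permLength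
  refine (Finset.card_le_card (t := insert (v⁻¹ ⟨p - 1, by omega⟩, v⁻¹ ⟨p, hp⟩) _) ?_).trans
    (Finset.card_insert_le _ _)
  rintro ⟨i, j⟩ hij
  simp only [simpleTransposition, h1, hp, and_self, dif_pos, Finset.mem_filter, Finset.mem_univ,
    true_and, Perm.mul_apply, Finset.mem_insert, Prod.mk.injEq] at hij ⊢
  obtain ⟨hlt, hv⟩ := hij
  have hne : v i ≠ v j := fun h => hlt.ne (v.injective h)
  rw [Perm.eq_inv_iff_eq, Perm.eq_inv_iff_eq]
  rw [swap_apply_def, swap_apply_def] at hv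
  simp only [Fin.ext_iff, Fin.lt_def, ne_eq] at *
  split_ifs at hv <;> try dsimp only at hv
  all_goals omega

lemma permLength_simpleTransposition_mul_le_of_lt {p : ℕ} (h1 : 1 ≤ p) (hp : p < n)
    (v : Perm (Fin n)) (h : v⁻¹ ⟨p, hp⟩ < v⁻¹ ⟨p - 1, by omega⟩) :
    permLength (simpleTransposition n p * v) ≤ permLength v := by
  unfold permLength
  refine Finset.card_le_card ?_
  rintro ⟨i, j⟩ hij
  simp only [simpleTransposition, h1, hp, and_self, dif_pos, Finset.mem_filter, Finset.mem_univ,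
    true_and, Perm.mul_apply] at hij ⊢
  obtain ⟨hlt, hv⟩ := hij
  have hne : v i ≠ v j := fun h => hlt.ne (v.injective h)
  have hc : ¬ (v i = ⟨p - 1, by omega⟩ ∧ v j = ⟨p, hp⟩) := by
    rintro ⟨e₁, e₂⟩
    rw [← e₁, ← e₂] at h
    simp only [Perm.coe_inv, symm_apply_apply] at h
    exact absurd hlt h.not_gt
  rw [swap_apply_def, swap_apply_def] at hv
  simp only [Fin.ext_iff, Fin.lt_def, ne_eq] at *
  split_ifs at hv <;> try dsimp only at hv
  all_goals omega

lemma permLength_one : permLength (1 : Perm (Fin n)) = 0 := by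
  simp only [permLength, Finset.card_eq_zero, Finset.filter_eq_empty_iff]
  rintro ⟨i, j⟩ - ⟨h₁, h₂⟩
  exact absurd h₁ h₂.not_gt

lemma permLength_prod_le {a : List ℕ} (h : Letters n a) :
    permLength (a.map (simpleTransposition n)).prod ≤ a.length := by
  induction a with
  | nil => simp [permLength_one]
  | cons p a ih =>
    have hp := h p (by simp)
    rw [List.map_cons, List.prod_cons, List.length_cons]
    exact (permLength_simpleTransposition_mul_le hp.1 hp.2 _).trans
      (Nat.succ_le_succ (ih fun x hx => h x (by simp [hx])))

/-- The positive lift of a reduced word does not depend on the word. -/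
theorem IsReducedWord.ascentWord_mul {Γ : Type*} [Group Γ] {s : ℕ → Γ} (hs : BraidSeq n s)
    {v : Perm (Fin n)} {a : List ℕ} (h : IsReducedWord v a) :
    wordEval s (ascentWord n (invWindow v)) * wordEval s a = wordEval s (deltaWord n) := by
  induction a generalizing v with
  | nil =>
    obtain ⟨-, rfl, -⟩ := h
    simp [invWindow_one, ascentWord_range]
  | cons p a ih =>
    obtain ⟨hl, rfl, hlen⟩ := h
    obtain ⟨h1, hp⟩ := hl p (by simp)
    have hl' : Letters n a := fun x hx => hl x (by simp [hx])
    have hle := permLength_prod_le hl'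
    rw [List.map_cons, List.prod_cons] at hlen ⊢
    set v := (a.map (simpleTransposition n)).prod with hv
    rw [List.length_cons] at hlen
    -- Otherwise the multiplication by the generator would not raise the length, and the word would
    -- be longer than the length of its product.
    have hasc : v⁻¹ ⟨p - 1, by omega⟩ < v⁻¹ ⟨p, hp⟩ := by
      rcases lt_trichotomy (v⁻¹ ⟨p - 1, by omega⟩) (v⁻¹ ⟨p, hp⟩) with h | h | h
      · exact h
      · have := Fin.ext_iff.1 (v⁻¹.injective h)
        simp at this
        omega
      · have := permLength_simpleTransposition_mul_le_of_lt h1 hp v h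
        omega
    have hred : IsReducedWord v a := by
      refine ⟨hl', rfl, ?_⟩
      have := permLength_simpleTransposition_mul_le h1 hp v
      omega
    have e₁ := getElem?_invWindow v ⟨p - 1, by omega⟩
    have e₂ := getElem?_invWindow v ⟨p, hp⟩
    obtain ⟨q, rfl⟩ : ∃ q, p = q + 1 := ⟨p - 1, by omega⟩
    simp only [Nat.add_sub_cancel] at e₁ e₂ hasc
    obtain ⟨hq₁, e₁⟩ := List.getElem?_eq_some_iff.1 e₁
    obtain ⟨hq₂, e₂⟩ := List.getElem?_eq_some_iff.1 e₂
    have hdec : invWindow v = (invWindow v).take q ++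
        (v⁻¹ ⟨q, by omega⟩ : ℕ) :: (v⁻¹ ⟨q + 1, hp⟩ : ℕ) :: (invWindow v).drop (q + 2) := by
      rw [← e₁, ← e₂, ← List.drop_eq_getElem_cons, ← List.drop_eq_getElem_cons,
        List.take_append_drop]
    have hlq : ((invWindow v).take q).length = q := by
      rw [List.length_take, length_invWindow]
      omega
    have hnd := nodup_invWindow v
    have hlv := length_invWindow v
    rw [← ih hred, invWindow_simpleTransposition_mul h1 hp, Nat.add_sub_cancel, wordEval_cons,
      ← mul_assoc]
    congr 1
    generalize (invWindow v).take q = A at hdec hlq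
    generalize (invWindow v).drop (q + 2) = B at hdec
    rw [hdec] at hnd hlv ⊢
    subst hlq
    rw [swapAt_append, hs.ascentWord_swap hasc (Fin.is_lt _) hnd hlv.le]

/-- If `v i > v j`, the inversions of `v * swap i j` inject into those of `v`: the transposition is
applied to both places of a pair when this keeps their order, and the pair is left alone otherwise.
-/
lemma lt_of_permLength_lt {v : Perm (Fin n)} {i j : Fin n} (hij : i < j)
    (h : permLength v < permLength (v * swap i j)) : v i < v j := by
  by_contra hc
  have hji : v j < v i := lt_of_le_of_ne (not_lt.1 hc) fun e => hij.ne' (v.injective e)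
  refine absurd h (not_lt.2 ?_)
  unfold permLength
  refine Finset.card_le_card_of_injOn
    (fun p => if swap i j p.1 < swap i j p.2 then (swap i j p.1, swap i j p.2) else p) ?_ ?_
  · rintro ⟨a, b⟩ hmem
    obtain ⟨hab, hv⟩ := (Finset.mem_filter.1 (Finset.mem_coe.1 hmem)).2
    clear hmem
    refine Finset.mem_coe.2 (Finset.mem_filter.2 ⟨Finset.mem_univ _, ?_⟩)
    simp only [Perm.mul_apply] at hab hv ⊢
    split_ifs with hs
    · exact ⟨hs, hv⟩
    · refine ⟨hab, ?_⟩
      rcases eq_or_ne a i with rfl | hai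
      · rcases eq_or_ne b j with rfl | hbj
        · exact hji
        · rw [swap_apply_left, swap_apply_of_ne_of_ne hab.ne' hbj] at hv
          exact hv.trans hji
      · rcases eq_or_ne a j with rfl | haj
        · rw [swap_apply_right, swap_apply_of_ne_of_ne (hij.trans hab).ne' hab.ne'] at hs
          exact absurd (hij.trans hab) hs
        · rw [swap_apply_of_ne_of_ne hai haj] at hv hs
          rcases eq_or_ne b i with rfl | hbi
          · rw [swap_apply_left] at hs
            exact absurd (hab.trans hij) hs
          · rcases eq_or_ne b j with rfl | hbj
            · rw [swap_apply_right] at hv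
              exact hji.trans hv
            · rw [swap_apply_of_ne_of_ne hbi hbj] at hs
              exact absurd hab hs
  · rintro ⟨a, b⟩ hab ⟨c, d⟩ hcd e
    replace hab := (Finset.mem_filter.1 (Finset.mem_coe.1 hab)).2
    replace hcd := (Finset.mem_filter.1 (Finset.mem_coe.1 hcd)).2
    dsimp only at e
    split_ifs at e with h₁ h₂ h₂
    · simp only [Prod.mk.injEq, EmbeddingLike.apply_eq_iff_eq] at e
      exact Prod.ext e.1 e.2
    · simp only [Prod.mk.injEq] at e
      rw [← e.1, ← e.2, swap_apply_self, swap_apply_self] at h₂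
      exact absurd hab.1 h₂
    · simp only [Prod.mk.injEq] at e
      rw [e.1, e.2, swap_apply_self, swap_apply_self] at h₁
      exact absurd hcd.1 h₁
    · exact e

lemma mem_take_invWindow (v : Perm (Fin n)) (x : Fin n) (t : ℕ) :
    (x : ℕ) ∈ (invWindow v).take t ↔ (v x : ℕ) < t := by
  rw [List.mem_take_iff_getElem]
  constructor
  · rintro ⟨i, hi, e⟩
    rw [length_invWindow, lt_min_iff] at hi
    have := getElem?_invWindow v ⟨i, hi.2⟩
    rw [List.getElem?_eq_getElem (by rw [length_invWindow]; exact hi.2), e,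
      Option.some_inj] at this
    rw [Fin.ext this]
    simpa using hi.1
  · intro h
    have := getElem?_invWindow v (v x)
    rw [Perm.coe_inv, symm_apply_apply] at this
    obtain ⟨h₁, h₂⟩ := List.getElem?_eq_some_iff.1 this
    exact ⟨v x, by simp [h, length_invWindow], h₂⟩

/-- The values `i < j` trade places in the inverse window, where `i` stands before `j`. An initial
segment that contains `j` contains both and is merely permuted; in any other segment at most `i` is
replaced by the larger `j`. -/
lemma countP_take_invWindow_mul_swap_le {v : Perm (Fin n)} {i j : Fin n} (hij : i < j)
    (hv : v i < v j) (t M : ℕ) :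
    ((invWindow (v * swap i j)).take t).countP (· < M) ≤
      ((invWindow v).take t).countP (· < M) := by
  have e : invWindow (v * swap i j) = (invWindow v).map (swap (i : ℕ) j) := by
    simp only [invWindow, List.map_map, mul_inv_rev, swap_inv]
    refine List.map_congr_left fun c _ => ?_
    simp only [Perm.mul_apply, Function.comp_apply, swap_apply_def, Fin.ext_iff]
    split_ifs <;> rfl
  have hi := mem_take_invWindow v i t
  have hj := mem_take_invWindow v j t
  have hnd := (nodup_invWindow v).sublist (List.take_sublist t _)
  have hv' : (v i : ℕ) < v j := hv
  have hij' : (i : ℕ) < j := hij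
  rw [e, ← List.map_take]
  generalize (invWindow v).take t = l at *
  by_cases hjl : (j : ℕ) ∈ l
  · have hil : (i : ℕ) ∈ l := hi.2 (hv'.trans (hj.1 hjl))
    refine (List.Perm.countP_eq _ ?_).le
    rw [List.perm_ext_iff_of_nodup ((List.nodup_map_iff (swap _ _).injective).2 hnd) hnd]
    intro x
    rw [List.mem_map]
    constructor
    · rintro ⟨y, hy, rfl⟩
      rw [swap_apply_def]
      split_ifs <;> assumption
    · intro hx
      refine ⟨swap (i : ℕ) j x, ?_, swap_apply_self _ _ _⟩
      rw [swap_apply_def]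
      split_ifs <;> assumption
  · rw [List.countP_map]
    refine List.countP_mono_left fun x hx h => ?_
    simp only [Function.comp_apply, decide_eq_true_eq] at h ⊢
    rw [swap_apply_def] at h
    split_ifs at h with h₁ h₂
    · omega
    · exact absurd (h₂ ▸ hx) hjl
    · exact h

/-- The necessity half of the tableau criterion, and the only consequence of Bruhat order that is
used. -/
lemma BruhatLE.countP_take_le {u w : Perm (Fin n)} (h : BruhatLE u w) (t M : ℕ) :
    ((invWindow w).take t).countP (· < M) ≤ ((invWindow u).take t).countP (· < M) := by
  induction h with
  | refl => exact le_rfl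
  | tail _ h ih =>
    obtain ⟨i, j, rfl, hlt⟩ := h
    refine le_trans ?_ ih
    rcases lt_trichotomy i j with hij | rfl | hij
    · exact countP_take_invWindow_mul_swap_le hij (lt_of_permLength_lt hij hlt) t M
    · exact absurd hlt (by rw [swap_self]; exact lt_irrefl _)
    · rw [swap_comm] at hlt ⊢
      exact countP_take_invWindow_mul_swap_le hij (lt_of_permLength_lt hij hlt) t M

end Length

/-! ### The Grassmannian permutation and its shape. -/

section Grassmannian

variable {n k : ℕ} {w : Perm (Fin n)}

lemma IsGrassmannian.add_le (h : IsGrassmannian k w) {i j : ℕ} (hij : i ≤ j) (hj : j < k)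
    (hjn : j < n) : (w⁻¹ ⟨i, by omega⟩ : ℕ) + (j - i) ≤ w⁻¹ ⟨j, hjn⟩ := by
  induction j, hij using Nat.le_induction with
  | base => simp
  | succ j hij ih =>
    have := ih (by omega) (by omega)
    have h' : w⁻¹ ⟨j, by omega⟩ < w⁻¹ ⟨j + 1, hjn⟩ :=
      h _ _ (by simp [Fin.lt_def]) (Or.inl hj)
    rw [Fin.lt_def] at h'
    omega

lemma IsGrassmannian.isShape (hkn : k ≤ n) (h : IsGrassmannian k w) :
    IsShape k n (rowLength k w) := by
  refine ⟨hkn, fun i => ?_, fun i => ?_, fun i hi => ?_⟩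
  · unfold rowLength
    by_cases hi : i + 1 < k
    · rw [dif_pos ⟨hi, hkn⟩, dif_pos ⟨by omega, hkn⟩]
      have := h.add_le (i := k - 1 - (i + 1)) (j := k - 1 - i) (by omega) (by omega) (by omega)
      omega
    · rw [dif_neg (fun h => hi h.1)]
      omega
  · unfold rowLength
    split_ifs with hi
    · have := h.add_le (i := k - 1 - i) (j := k - 1) (by omega) (by omega) (by omega)
      have := (w⁻¹ ⟨k - 1, by omega⟩).2
      omega
    · omega
  · unfold rowLength
    rw [dif_neg (by omega)]

/-- The first `k` entries are read off from the row lengths. The others are the complementary values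
in increasing order, so they are determined as well. -/
lemma IsGrassmannian.invWindow_eq (hkn : k ≤ n) (h : IsGrassmannian k w) :
    (invWindow w).take k = (emptyPath n k (rowLength k w)).high ∧
      (invWindow w).drop k = (emptyPath n k (rowLength k w)).low := by
  have hS := h.isShape hkn
  have hlen := length_high_emptyPath hS
  have h₁ : (invWindow w).take k = (emptyPath n k (rowLength k w)).high := by
    refine List.ext_getElem (by simp [length_invWindow, hkn, hlen]) fun p hp₁ hp₂ => ?_
    have hpk : p < k := by omega
    rw [← List.getD_eq_getElem _ 0 hp₂, getD_high_emptyPath hS hpk]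
    have := getElem?_invWindow w ⟨p, by omega⟩
    rw [List.getElem?_eq_getElem (by rw [length_invWindow]; exact (by omega : p < n)),
      Option.some_inj] at this
    rw [List.getElem_take, this, rowLength, dif_pos ⟨by omega, hkn⟩]
    have h0 := h.add_le (i := 0) (j := p) (by omega) hpk (by omega)
    simp only [show k - 1 - (k - 1 - p) = p by omega]
    omega
  refine ⟨h₁, ?_⟩
  have hp : ((invWindow w).take k ++ (invWindow w).drop k).Perm
      ((emptyPath n k (rowLength k w)).high ++ (emptyPath n k (rowLength k w)).low) := by
    rw [List.take_append_drop]
    have := (DotPath.high_perm (valid_emptyPath hS)).2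
    rw [emptyPath, length_dotPath] at this
    exact (invWindow_perm w).trans this.symm
  rw [h₁, List.perm_append_left_iff] at hp
  refine List.Perm.eq_of_pairwise (le := (· < ·)) (fun a b _ _ h₁ h₂ => by omega) ?_
    (sorted_low_emptyPath hS) hp
  rw [List.pairwise_iff_getElem]
  intro i j hi hj hij
  simp only [List.length_drop, length_invWindow] at hi hj
  have e₁ := getElem?_invWindow w ⟨k + i, by omega⟩
  have e₂ := getElem?_invWindow w ⟨k + j, by omega⟩
  rw [List.getElem?_eq_getElem (by rw [length_invWindow]; exact (by omega : k + i < n)),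
    Option.some_inj] at e₁
  rw [List.getElem?_eq_getElem (by rw [length_invWindow]; exact (by omega : k + j < n)),
    Option.some_inj] at e₂
  rw [List.getElem_drop, List.getElem_drop, e₁, e₂]
  exact h _ _ (by simpa [Fin.lt_def] using hij) (Or.inr (by simp))

end Grassmannian

/-! ### The juggling braid of a path -/

/-! ### Counting in initial segments. -/

section Counting

lemma count_and_lt {p : ℕ → Prop} [DecidablePred p] {i n : ℕ} (h : i ≤ n) :
    Nat.count (fun x => x < i ∧ p x) n = Nat.count p i := by
  obtain ⟨e, rfl⟩ := Nat.exists_eq_add_of_le h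
  rw [Nat.count_add]
  have h₁ : Nat.count (fun x => i + x < i ∧ p (i + x)) e = 0 := by
    rw [Nat.count_eq_card_filter_range, Finset.card_eq_zero, Finset.filter_eq_empty_iff]
    intro x _
    omega
  rw [h₁, Nat.add_zero, Nat.count_eq_card_filter_range, Nat.count_eq_card_filter_range]
  congr 1
  refine Finset.filter_congr fun x hx => ?_
  simp [Finset.mem_range.1 hx]

lemma count_congr {p q : ℕ → Prop} [DecidablePred p] [DecidablePred q] {n : ℕ}
    (h : ∀ x < n, p x ↔ q x) : Nat.count p n = Nat.count q n := by
  rw [Nat.count_eq_card_filter_range, Nat.count_eq_card_filter_range]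
  congr 1
  exact Finset.filter_congr fun x hx => h x (Finset.mem_range.1 hx)

lemma card_filter_fin {n : ℕ} (p : ℕ → Prop) [DecidablePred p] :
    (Finset.univ.filter fun x : Fin n => p x).card = Nat.count p n := by
  rw [Nat.count_eq_card_filter_range, ← Finset.card_map Fin.valEmbedding]
  congr 1
  ext x
  simp only [Finset.mem_map, Finset.mem_filter, Finset.mem_univ, true_and, Fin.valEmbedding_apply,
    Finset.mem_range]
  constructor
  · rintro ⟨a, ha, rfl⟩
    exact ⟨a.2, ha⟩
  · rintro ⟨hx, hp⟩
    exact ⟨⟨x, hx⟩, hp, rfl⟩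

end Counting

/-- The interval word of the arc from `f i` to `i`, for a function on `{0, …, n - 1}`. -/
def intervalWord (n : ℕ) (f : ℕ → ℕ) (i : ℕ) : List ℕ :=
  descWord (1 + Nat.count (fun x => x < i ∧ f i < f x) n)
    (Nat.count (fun x => i < x ∧ x < f i ∧ f i < f x) n)

/-- The interval word of the arcs that end at `m`. -/
def endWord (n : ℕ) (f : ℕ → ℕ) (m : ℕ) : List ℕ :=
  ((List.range n).filter fun i => f i = m).flatMap (intervalWord n f)

/-- A new leftmost arc is never crossed at the right end of another arc; it only raises by one the
positions of the arcs that it encloses. -/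
lemma intervalWord_succ {n : ℕ} {f : ℕ → ℕ} {i : ℕ} (h : 1 ≤ f (i + 1)) :
    intervalWord (n + 1) f (i + 1) =
      if f (i + 1) < f 0 then (intervalWord n (fun x => f (x + 1) - 1) i).map (· + 1)
      else intervalWord n (fun x => f (x + 1) - 1) i := by
  have e₁ : Nat.count (fun x => x + 1 < i + 1 ∧ f (i + 1) < f (x + 1)) n =
      Nat.count (fun x => x < i ∧ f (i + 1) - 1 < f (x + 1) - 1) n :=
    count_congr fun x _ => by omega
  have e₂ : Nat.count (fun x => i + 1 < x + 1 ∧ x + 1 < f (i + 1) ∧ f (i + 1) < f (x + 1)) n =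
      Nat.count (fun x => i < x ∧ x < f (i + 1) - 1 ∧ f (i + 1) - 1 < f (x + 1) - 1) n :=
    count_congr fun x _ => by omega
  rw [intervalWord, Nat.count_succ', Nat.count_succ', e₁, e₂, intervalWord, descWord_map_succ]
  simp only [Nat.zero_lt_succ, true_and, Nat.not_lt_zero, false_and, if_false, Nat.add_zero]
  split_ifs <;> rfl

/-- The function `f` gives the arcs of the path. -/
def DotPath.Matches : DotPath → (ℕ → ℕ) → Prop
  | [], _ => True
  -- Positivity of the later values keeps the subtraction in the recursion from truncating.
  | none :: S, f => S.length + 1 ≤ f 0 ∧ (∀ i < S.length, 1 ≤ f (i + 1)) ∧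
      Matches S fun i => f (i + 1) - 1
  | some bs :: S, f => f 0 = bubbleCarry 0 bs ((high S).map (· + 1)) ∧
      (∀ i < S.length, 1 ≤ f (i + 1)) ∧ Matches S fun i => f (i + 1) - 1

lemma endWord_succ {n : ℕ} {f : ℕ → ℕ} (h : ∀ i < n, 1 ≤ f (i + 1)) {m : ℕ} (hm : f 0 ≠ m + 1) :
    endWord (n + 1) f (m + 1) =
      if m + 1 < f 0 then (endWord n (fun x => f (x + 1) - 1) m).map (· + 1)
      else endWord n (fun x => f (x + 1) - 1) m := by
  have e : ((List.range n).filter fun i => f (i + 1) = m + 1) =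
      (List.range n).filter fun i => f (i + 1) - 1 = m :=
    List.filter_congr fun i hi => by
      have := h i (List.mem_range.1 hi)
      congr 1
      simp only [eq_iff_iff]
      omega
  rw [endWord, List.range_succ_eq_map, List.filter_cons_of_neg (by simpa using hm),
    List.filter_map, List.flatMap_map]
  simp only [Function.comp_def, Nat.succ_eq_add_one]
  rw [e, endWord, List.map_flatMap]
  have key : ∀ i ∈ (List.range n).filter fun i => f (i + 1) - 1 = m,
      intervalWord (n + 1) f (i + 1) =
      if m + 1 < f 0 then (intervalWord n (fun x => f (x + 1) - 1) i).map (· + 1)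
      else intervalWord n (fun x => f (x + 1) - 1) i := fun i hi => by
    simp only [List.mem_filter, List.mem_range, decide_eq_true_eq] at hi
    have := h i hi.1
    rw [intervalWord_succ this, show f (i + 1) = m + 1 by omega]
  rw [List.flatMap_congr key]
  split_ifs <;> rfl

lemma endWord_zero {n : ℕ} {f : ℕ → ℕ} (h : ∀ i < n, 1 ≤ f (i + 1)) :
    endWord (n + 1) f 0 = [] := by
  have e : ((List.range n).map Nat.succ).filter (fun i => f i = 0) = [] := by
    simp only [List.filter_eq_nil_iff, List.mem_map, List.mem_range]
    rintro _ ⟨i, hi, rfl⟩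
    have := h i hi
    simp only [Nat.succ_eq_add_one, decide_eq_true_eq]
    omega
  by_cases h0 : f 0 = 0
  · rw [endWord, List.range_succ_eq_map, List.filter_cons_of_pos (by simpa using h0), e]
    simp [intervalWord, h0]
  · rw [endWord, List.range_succ_eq_map, List.filter_cons_of_neg (by simpa using h0), e]
    rfl

namespace DotPath

/-- In juggling terms: of the `M` throws made before time `M`, those still in the air are as many as
the times below `M` at which none of the throws lands, and these times are the entries of `high`.
Both counts satisfy the same recursion along the path. -/
lemma count_arcs {S : DotPath} (hS : Valid S) {f : ℕ → ℕ} (h : Matches S f) {M : ℕ}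
    (hM : M ≤ S.length) :
    Nat.count (fun x => x < M ∧ M ≤ f x) S.length = (high S).countP (· < M) := by
  induction S generalizing f M with
  | nil => simp [high]
  | cons b S ih =>
    cases M with
    | zero => simp [Nat.count_eq_card_filter_range]
    | succ M =>
      have step : ∀ hS : Valid S, Matches S (fun i => f (i + 1) - 1) →
          (∀ i < S.length, 1 ≤ f (i + 1)) →
          Nat.count (fun x => x < M + 1 ∧ M + 1 ≤ f x) (S.length + 1) =
            (high S).countP (· < M) + if M + 1 ≤ f 0 then 1 else 0 := fun hS hm h1 => by
        rw [← ih hS hm (by simpa using hM), Nat.count_succ']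
        simp only [Nat.zero_lt_succ, true_and]
        congr 1
        refine count_congr fun x hx => ?_
        have := h1 x hx
        omega
      cases b with
      | none =>
        obtain ⟨h0, h1, hm⟩ := h
        rw [List.length_cons, step hS hm h1, high, List.countP_cons, countP_map_succ,
          if_pos (by simp at hM; omega)]
        simp
      | some bs =>
        obtain ⟨h0, h1, hm⟩ := h
        obtain ⟨hl, -, hS⟩ := hS
        have := (bubble_perm (c := 0) (bs := bs) (xs := (high S).map (· + 1))
          (by simp [hl, (high_perm hS).1])).countP_eq (· < M + 1)
        rw [List.countP_cons, List.countP_cons, countP_map_succ, ← h0] at this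
        rw [List.length_cons, step hS hm h1, high]
        simp only [decide_eq_true_eq, Nat.zero_lt_succ, if_true] at this
        split_ifs at this ⊢ <;> omega

/-- The number of columns without dots. -/
def emptyCols : DotPath → ℕ
  | [] => 0
  | none :: S => emptyCols S
  | some bs :: S => emptyCols S + if true ∈ bs then 0 else 1

end DotPath

lemma bubbleCarry_eq_zero_iff {bs : List Bool} {xs : List ℕ} (hl : bs.length = xs.length)
    (h0 : ∀ x ∈ xs, 1 ≤ x) : bubbleCarry 0 bs xs = 0 ↔ true ∉ bs := by
  have pos : ∀ (bs : List Bool) (xs : List ℕ) (c : ℕ), bs.length = xs.length →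
      (∀ x ∈ xs, 1 ≤ x) → 1 ≤ c → 1 ≤ bubbleCarry c bs xs := fun bs xs c hl h0 hc => by
    have : bubbleCarry c bs xs ∈ c :: xs := (bubble_perm hl).mem_iff.1 (by simp)
    rcases List.mem_cons.1 this with h | h
    · omega
    · exact h0 _ h
  induction bs generalizing xs with
  | nil => cases xs <;> simp [bubbleCarry]
  | cons b bs ih =>
    cases xs with
    | nil => simp at hl
    | cons x xs =>
      simp only [List.length_cons, Nat.add_right_cancel_iff] at hl
      have h0' : ∀ y ∈ xs, 1 ≤ y := fun y hy => h0 y (by simp [hy])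
      cases b
      · simpa [bubbleCarry] using ih hl h0'
      · have := pos bs xs x hl h0' (h0 x (by simp))
        simp only [bubbleCarry, List.mem_cons, true_or, not_true_eq_false, iff_false]
        omega

namespace DotPath

/-- The point of a column is fixed exactly if its pass brings back the letter 0. At the first dot a
positive entry is taken up, and the carried letter stays positive from then on, so this happens only
without dots. -/
lemma count_fixed {S : DotPath} (hS : Valid S) {f : ℕ → ℕ} (h : Matches S f) :
    Nat.count (fun i => f i = i) S.length = emptyCols S := by
  induction S generalizing f with
  | nil => rfl
  | cons b S ih =>
    have step : ∀ hS : Valid S, Matches S (fun i => f (i + 1) - 1) →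
        (∀ i < S.length, 1 ≤ f (i + 1)) →
        Nat.count (fun i => f i = i) (S.length + 1) = emptyCols S + if f 0 = 0 then 1 else 0 :=
      fun hS hm h1 => by
        rw [← ih hS hm, Nat.count_succ']
        congr 1
        refine count_congr fun x hx => ?_
        have := h1 x hx
        omega
    cases b with
    | none =>
      obtain ⟨h0, h1, hm⟩ := h
      rw [List.length_cons, step hS hm h1, if_neg (by omega)]
      rfl
    | some bs =>
      obtain ⟨h0, h1, hm⟩ := h
      obtain ⟨hl, -, hS⟩ := hS
      have := bubbleCarry_eq_zero_iff (bs := bs) (xs := (high S).map (· + 1))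
        (by simp [hl, (high_perm hS).1]) (by simp)
      rw [List.length_cons, step hS hm h1, emptyCols, h0]
      simp only [this]
      split_ifs <;> simp_all

/-- The arcs that enclose `A_i`, those that it crosses, and `A_i` itself are disjoint families of
arcs that start before `f i` and end there or later. -/
lemma interval_count_le {n : ℕ} (f : ℕ → ℕ) {i : ℕ} (hi : i < n) (hif : i < f i) :
    1 + Nat.count (fun x => x < i ∧ f i < f x) n +
      Nat.count (fun x => i < x ∧ x < f i ∧ f i < f x) n ≤
      Nat.count (fun x => x < f i ∧ f i ≤ f x) n := by
  simp only [Nat.count_eq_card_filter_range]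
  rw [Nat.add_comm 1, Nat.add_assoc, Nat.add_comm 1, ← Finset.card_insert_of_notMem (a := i)
    (s := (Finset.range n).filter fun x => i < x ∧ x < f i ∧ f i < f x) (by simp),
    ← Finset.card_union_of_disjoint]
  · refine Finset.card_le_card fun x hx => ?_
    simp only [Finset.mem_union, Finset.mem_insert, Finset.mem_filter, Finset.mem_range] at hx ⊢
    rcases hx with hx | rfl | hx
    · exact ⟨hx.1, by omega, by omega⟩
    · exact ⟨hi, hif, le_rfl⟩
    · exact ⟨hx.1, by omega, by omega⟩
  · rw [Finset.disjoint_left]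
    intro x hx hx'
    simp only [Finset.mem_insert, Finset.mem_filter] at hx hx'
    omega

/-- This bound places the letters of the arcs inside a later arc within the range in which its
descending word can slide past them. -/
lemma lt_of_mem_endWord {S : DotPath} (hS : Valid S) {f : ℕ → ℕ} (h : Matches S f) {m x : ℕ}
    (hm : m < S.length) (hx : x ∈ endWord S.length f m) :
    1 ≤ x ∧ x < (high S).countP (· < m) := by
  simp only [endWord, List.mem_flatMap, List.mem_filter, List.mem_range, decide_eq_true_eq] at hx
  obtain ⟨i, ⟨hi, rfl⟩, hx⟩ := hx
  rw [intervalWord, mem_descWord] at hx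
  have hif : i < f i := by
    have : 0 < Nat.count (fun x => i < x ∧ x < f i ∧ f i < f x) S.length := by omega
    rw [Nat.count_eq_card_filter_range, Finset.card_pos] at this
    obtain ⟨y, hy⟩ := this
    rw [Finset.mem_filter] at hy
    omega
  have := interval_count_le f hi hif
  rw [count_arcs hS h hm.le] at this
  omega

section

variable {Γ : Type*} [Group Γ]

/-- The first part of the juggling braid of a path. -/
theorem wordEval_arcs_low {S : DotPath} (hS : Valid S) {f : ℕ → ℕ} (h : Matches S f)
    (hf : Set.InjOn f {i | i < S.length}) {s : ℕ → Γ} (hs : BraidSeq (rows S) s) :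
    wordEval s ((List.range S.length).reverse.flatMap (endWord S.length f)) =
      wordEval s (arcWord S) := by
  induction S generalizing f s with
  | nil => rfl
  | cons b S ih =>
    have hf' : (∀ i < S.length, 1 ≤ f (i + 1)) →
        Set.InjOn (fun i => f (i + 1) - 1) {i | i < S.length} := fun h1 i hi j hj e => by
      have h₁ := h1 i hi
      have h₂ := h1 j hj
      have := hf (show i + 1 < (b :: S).length by simpa using hi)
        (show j + 1 < (b :: S).length by simpa using hj) (by beta_reduce at e; omega)
      omega
    have split : (∀ i < S.length, 1 ≤ f (i + 1)) →
        (List.range (S.length + 1)).reverse.flatMap (endWord (S.length + 1) f) =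
          (List.range S.length).reverse.flatMap fun m => endWord (S.length + 1) f (m + 1) :=
      fun h1 => by
        rw [List.range_succ_eq_map, List.reverse_cons, List.flatMap_append, ← List.map_reverse,
          List.flatMap_map, List.flatMap_singleton, endWord_zero h1, List.append_nil]
    cases b with
    | none =>
      obtain ⟨h0, h1, hm⟩ := h
      rw [List.length_cons, split h1, arcWord, wordEval_map_succ, ← ih hS hm (hf' h1) hs.shift,
        ← wordEval_map_succ, List.map_flatMap]
      congr 1
      refine List.flatMap_congr fun m hm => ?_
      simp only [List.mem_reverse, List.mem_range] at hm
      rw [endWord_succ h1 (by omega), if_pos (by omega)]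
    | some bs =>
      obtain ⟨h0, h1, hm⟩ := h
      obtain ⟨hl, -, hV⟩ := hS
      have hb : bs.length = ((high S).map (· + 1)).length := by simp [hl, (high_perm hV).1]
      have hmem : f 0 ∈ 0 :: (high S).map (· + 1) := by
        rw [h0]
        exact (bubble_perm hb).mem_iff.1 (by simp)
      have hrec := ih hV hm (hf' h1) hs
      rw [List.length_cons, split h1, arcWord, wordEval_append, ← h0, ← hrec]
      -- Either `A_0` is a point, or it ends at `c + 1` with `c` an entry of `high S`; no other arc
      -- of the window ends there.
      rcases List.mem_cons.1 hmem with hy | hy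
      · have e0 : (high S).countP (fun z => z + 1 < f 0) = 0 := by
          simp [hy]
        rw [e0, descWord_zero, wordEval_nil, mul_one]
        congr 1
        refine List.flatMap_congr fun m hm => ?_
        rw [endWord_succ h1 (by omega), if_neg (by omega)]
      · obtain ⟨c, hc, hyc⟩ := List.mem_map.1 hy
        have hcn := lt_of_mem_high hV hc
        have hne : ∀ x < S.length, f (x + 1) ≠ c + 1 := fun x hx e => by
          have := hf (show x + 1 < (some bs :: S).length by simpa using hx)
            (show 0 < (some bs :: S).length by simp) (e.trans hyc)
          omega
        have e₁ : endWord S.length (fun x => f (x + 1) - 1) c = [] := by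
          rw [endWord, List.filter_eq_nil_iff.2, List.flatMap_nil]
          intro x hx
          have := hne x (List.mem_range.1 hx)
          have := h1 x (List.mem_range.1 hx)
          simp only [decide_eq_true_eq]
          omega
        have e₂ : endWord (S.length + 1) f (c + 1) =
            descWord 1 ((high S).countP fun z => z + 1 < f 0) := by
          have e : ((List.range S.length).map Nat.succ).filter (fun i => f i = c + 1) = [] := by
            simp only [List.filter_eq_nil_iff, List.mem_map, List.mem_range]
            rintro _ ⟨i, hi, rfl⟩
            simpa using hne i hi
          rw [endWord, List.range_succ_eq_map, List.filter_cons_of_pos (by simp [hyc]), e,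
            List.flatMap_singleton, intervalWord]
          have e₃ : Nat.count (fun x => x < 0 ∧ f 0 < f x) (S.length + 1) = 0 := by
            simp [Nat.count_eq_card_filter_range]
          have e₄ : Nat.count (fun x => 0 < x ∧ x < f 0 ∧ f 0 < f x) (S.length + 1) =
              (high S).countP fun z => z + 1 < f 0 := by
            have := count_arcs hV hm (M := c) hcn.le
            simp only [← hyc, Nat.add_lt_add_iff_right]
            rw [← this, Nat.count_succ', if_neg (by omega), Nat.add_zero]
            refine count_congr fun x hx => ?_
            have := hne x hx
            omega
          rw [e₃, e₄]
        have hrange : (List.range S.length).reverse =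
            (List.range' (c + 1) (S.length - c - 1)).reverse ++ c :: (List.range c).reverse := by
          have : List.range S.length = List.range c ++ c :: List.range' (c + 1) (S.length - c - 1) := by
            rw [List.range_eq_range', List.range_eq_range', ← List.range'_succ,
              show S.length = c + (S.length - c - 1 + 1) by omega, ← List.range'_append]
            simp
          rw [this]
          simp
        have e₅ : (List.range' (c + 1) (S.length - c - 1)).reverse.flatMap
              (fun m => endWord (S.length + 1) f (m + 1)) =
            (List.range' (c + 1) (S.length - c - 1)).reverse.flatMap
              (endWord S.length fun i => f (i + 1) - 1) :=
          List.flatMap_congr fun m hm => by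
            simp only [List.mem_reverse, List.mem_range'_1] at hm
            rw [endWord_succ h1 (by omega), if_neg (by omega)]
        have e₆ : (List.range c).reverse.flatMap
              (fun m => endWord (S.length + 1) f (m + 1)) =
            ((List.range c).reverse.flatMap
              (endWord S.length fun i => f (i + 1) - 1)).map (· + 1) := by
          rw [List.map_flatMap]
          refine List.flatMap_congr fun m hm => ?_
          simp only [List.mem_reverse, List.mem_range] at hm
          rw [endWord_succ h1 (by omega), if_pos (by omega)]
        have hcount : (high S).countP (fun z => z + 1 < f 0) = (high S).countP (· < c) := by
          rw [← hyc]
          simp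
        have hlt : (high S).countP (fun z => z + 1 < f 0) + 1 ≤ rows S := by
          rw [hcount, ← (high_perm hV).1]
          refine Nat.lt_of_le_of_ne List.countP_le_length fun he => ?_
          simpa using List.countP_eq_length.1 he c hc
        -- Arcs that end after `A_0` keep their words; those that end before it are enclosed by it
        -- and have their letters raised by one. The descending word of `A_0` slides to the right
        -- past the latter and lowers them again.
        rw [hrange]
        simp only [List.flatMap_append, List.flatMap_cons, e₁, e₂, e₅, e₆, List.nil_append,
          wordEval_append]
        rw [mul_assoc]
        congr 1
        symm
        refine hs.slide_word le_rfl (by simp only [rows]; omega) fun x hx => ?_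
        simp only [List.mem_flatMap, List.mem_reverse, List.mem_range] at hx
        obtain ⟨m, hmc, hx⟩ := hx
        have hx' := lt_of_mem_endWord hV hm (hmc.trans hcn) hx
        have hmono : (high S).countP (· < m) ≤ (high S).countP (· < c) :=
          List.countP_mono_left fun z _ hz => by
            simp only [decide_eq_true_eq] at hz ⊢
            omega
        omega

end

end DotPath

/-! The arcs that end in the second window. -/

lemma filter_succ_le (l : List ℕ) (m : ℕ) :
    l.filter (m + 1 ≤ ·) = ((dropZero l).filter (m ≤ ·)).map (· + 1) := by
  induction l with
  | nil => rfl
  | cons x l ih =>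
    cases x with
    | zero => simpa using ih
    | succ x =>
      have e : dropZero ((x + 1) :: l) = x :: dropZero l := rfl
      by_cases h : m ≤ x
      · rw [e, List.filter_cons_of_pos (by simpa using h), ih,
          List.filter_cons_of_pos (by simpa using h), List.map_cons]
      · rw [e, List.filter_cons_of_neg (by simpa using h), ih,
          List.filter_cons_of_neg (by simpa using h)]

/-- The interval word of the entry `m` of a list, among the entries which are at least `m`. -/
def entryWord (l : List ℕ) (m : ℕ) : List ℕ :=
  descWord ((l.filter (m ≤ ·)).idxOf m + 1)
    ((l.filter (m ≤ ·)).length - 1 - (l.filter (m ≤ ·)).idxOf m)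

lemma idxOf_map_add (l : List ℕ) (m p : ℕ) : (l.map (· + p)).idxOf (m + p) = l.idxOf m := by
  induction l with
  | nil => rfl
  | cons x l ih =>
    by_cases h : x = m
    · simp [h]
    · rw [List.map_cons, List.idxOf_cons_ne _ h, List.idxOf_cons_ne _ (by simpa using h), ih]

lemma entryWord_succ (l : List ℕ) (m : ℕ) : entryWord l (m + 1) = entryWord (dropZero l) m := by
  simp only [entryWord, filter_succ_le, idxOf_map_add, List.length_map]

/-- When the turn of the letter `m` comes, all smaller letters have been removed, so its factor
depends only on the entries that are at least `m`. -/
lemma ascentWord_eq_flatMap (M : ℕ) (l : List ℕ) :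
    ascentWord M l = (List.range M).reverse.flatMap (entryWord l) := by
  induction M generalizing l with
  | zero => rfl
  | succ M ih =>
    rw [List.range_succ_eq_map, List.reverse_cons, List.flatMap_append, ← List.map_reverse,
      List.flatMap_map, List.flatMap_singleton, ascentWord, ih]
    congr 1
    · exact List.flatMap_congr fun m _ => (entryWord_succ l m).symm
    · simp [entryWord]

lemma entryWord_map_add (l : List ℕ) (m p : ℕ) :
    entryWord (l.map (· + p)) (m + p) = entryWord l m := by
  have : (l.map (· + p)).filter (m + p ≤ ·) = (l.filter (m ≤ ·)).map (· + p) := by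
    rw [List.filter_map]
    congr 1
    refine List.filter_congr fun x _ => ?_
    simp
  simp only [entryWord, this, idxOf_map_add, List.length_map]

lemma count_eq_length_filter (p : ℕ → Prop) [DecidablePred p] (f : ℕ → ℕ) (n : ℕ) :
    (((List.range n).map f).filter fun x => p x).length = Nat.count (fun x => p (f x)) n := by
  rw [← List.countP_eq_length_filter, List.countP_map]
  rfl

/-- For an arc that ends beyond the window the condition `x < f i` is automatic: it crosses exactly
the arcs that start later and end later, that is, the ascents at its entry. -/
lemma endWord_of_le {n : ℕ} {f : ℕ → ℕ} (hf : Set.InjOn f {i | i < n}) {m : ℕ} (hm : n ≤ m) :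
    endWord n f m = entryWord ((List.range n).map f) m := by
  by_cases h : ∃ i < n, f i = m
  · obtain ⟨i, hi, rfl⟩ := h
    have hrange : List.range n =
        List.range i ++ i :: (List.range (n - i - 1)).map (i + 1 + ·) := by
      rw [← List.range'_eq_map_range, List.range_eq_range', List.range_eq_range',
        ← List.range'_succ, show n = i + (n - i - 1 + 1) by omega, ← List.range'_append]
      simp
    have hne : ∀ x < n, f x = f i → x = i := fun x hx e => hf hx hi e
    have e₁ : (List.range n).filter (fun x => f x = f i) = [i] := by
      have h₁ : (List.range i).filter (fun x => f x = f i) = [] := by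
        simp only [List.filter_eq_nil_iff, List.mem_range, decide_eq_true_eq]
        intro x hx e
        have := hne x (by omega) e
        omega
      have h₂ : ((List.range (n - i - 1)).map (i + 1 + ·)).filter (fun x => f x = f i) = [] := by
        simp only [List.filter_eq_nil_iff, List.mem_map, List.mem_range, decide_eq_true_eq]
        rintro _ ⟨x, hx, rfl⟩ e
        have := hne (i + 1 + x) (by omega) e
        omega
      rw [hrange, List.filter_append, h₁, List.filter_cons_of_pos (by simp), h₂]
      rfl
    have e₂ : (((List.range n).map f).filter (f i ≤ ·)) =
        ((List.range i).map f).filter (f i ≤ ·) ++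
          f i :: ((List.range (n - i - 1)).map fun x => f (i + 1 + x)).filter (f i ≤ ·) := by
      rw [hrange, List.map_append, List.filter_append, List.map_cons,
        List.filter_cons_of_pos (by simp), List.map_map]
      rfl
    have h₁ : f i ∉ ((List.range i).map f).filter (f i ≤ ·) := by
      simp only [List.mem_filter, List.mem_map, List.mem_range, not_and]
      rintro ⟨x, hx, e⟩
      have := hne x (by omega) e
      omega
    have c₁ : Nat.count (fun x => x < i ∧ f i < f x) n =
        (((List.range i).map f).filter (f i ≤ ·)).length := by
      rw [count_and_lt hi.le, count_eq_length_filter (f i ≤ ·)]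
      refine count_congr fun x hx => ?_
      have : f x ≠ f i := fun e => by have := hne x (by omega) e; omega
      omega
    have c₂ : Nat.count (fun x => i < x ∧ x < f i ∧ f i < f x) n =
        (((List.range (n - i - 1)).map fun x => f (i + 1 + x)).filter (f i ≤ ·)).length := by
      rw [count_eq_length_filter (f i ≤ ·)]
      obtain ⟨e, he⟩ : ∃ e, n = i + 1 + e := ⟨n - i - 1, by omega⟩
      have h0 : Nat.count (fun x => i < x ∧ x < f i ∧ f i < f x) (i + 1) = 0 := by
        rw [Nat.count_eq_card_filter_range, Finset.card_eq_zero, Finset.filter_eq_empty_iff]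
        intro x hx
        rw [Finset.mem_range] at hx
        omega
      conv_lhs => rw [he]
      rw [Nat.count_add, h0, Nat.zero_add, show n - i - 1 = e by omega]
      refine count_congr fun x hx => ?_
      have : f (i + 1 + x) ≠ f i := fun e => by have := hne (i + 1 + x) (by omega) e; omega
      omega
    rw [endWord, e₁, List.flatMap_singleton, intervalWord, entryWord, e₂,
      List.idxOf_append_of_notMem h₁, c₁, c₂, List.length_append, List.length_cons,
      List.idxOf_cons_self]
    congr 1 <;> omega
  · push Not at h
    have e : (List.range n).filter (fun x => f x = m) = [] := by
      simpa [List.filter_eq_nil_iff] using h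
    have hm' : m ∉ ((List.range n).map f).filter (m ≤ ·) := by
      simp only [List.mem_filter, List.mem_map, List.mem_range, not_and]
      rintro ⟨x, hx, e⟩
      exact absurd e (h x hx)
    rw [endWord, e, List.flatMap_nil, entryWord, List.idxOf_eq_length hm',
      show ∀ a : ℕ, a - 1 - a = 0 by omega, descWord_zero]

/-- The second part of the juggling braid. -/
theorem arcs_high {n : ℕ} {f : ℕ → ℕ} (hf : Set.InjOn f {i | i < n}) {V : List ℕ}
    (hV : ((List.range n).map f).filter (n ≤ ·) = V.map (· + n)) :
    (List.range' n n).reverse.flatMap (endWord n f) = ascentWord n V := by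
  rw [ascentWord_eq_flatMap, List.range'_eq_map_range, ← List.map_reverse, List.flatMap_map]
  refine List.flatMap_congr fun m _ => ?_
  rw [endWord_of_le hf (by omega), ← entryWord_map_add V m n, ← hV, Nat.add_comm n m, entryWord,
    entryWord, List.filter_filter]
  have : ∀ l : List ℕ, l.filter (m + n ≤ ·) =
      l.filter fun a => decide (m + n ≤ a) && decide (n ≤ a) := fun l => by
    refine List.filter_congr fun x _ => ?_
    by_cases h : m + n ≤ x
    · simp [h, show n ≤ x by omega]
    · simp [h]
  rw [this]

/-! Comparison with the juggling braid of a function on `Fin n`. -/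

lemma jugglingPart_eq {n : ℕ} (k : ℕ) {f : Fin n → ℕ} {g : ℕ → ℕ} (h : ∀ i : Fin n, g i = f i)
    (ms : List ℕ) : jugglingPart k f ms = wordEval (sigma k) (ms.flatMap (endWord n g)) := by
  have harc : ∀ i : Fin n, arcBraid k f i = wordEval (sigma k) (intervalWord n g i) := fun i => by
    have e₁ : arcPosition f i = 1 + Nat.count (fun x => x < (i : ℕ) ∧ g i < g x) n := by
      rw [arcPosition, ← card_filter_fin]
      congr 2
      ext x
      simp only [Finset.mem_filter, Finset.mem_univ, true_and, h, Fin.lt_def]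
    have e₂ : arcCrossings f i =
        Nat.count (fun x => (i : ℕ) < x ∧ x < g i ∧ g i < g x) n := by
      rw [arcCrossings, ← card_filter_fin]
      congr 1
      ext x
      simp only [Finset.mem_filter, Finset.mem_univ, true_and, h, Fin.lt_def]
    rw [arcBraid, e₁, e₂, intervalWord, intervalBraid]
    have : ∀ c : ℕ, 1 + Nat.count (fun x => x < (i : ℕ) ∧ g i < g x) n + c - 1 + 1 -
      (1 + Nat.count (fun x => x < (i : ℕ) ∧ g i < g x) n) = c := by omega
    rw [this]
    rfl
  have hend : ∀ m, wordEval (sigma k) (endWord n g m) =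
      (((List.finRange n).filter fun i => f i = m).map (arcBraid k f)).prod := fun m => by
    have hr : List.range n = (List.finRange n).map fun i : Fin n => (i : ℕ) :=
      List.map_coe_finRange_eq_range.symm
    rw [endWord, hr, List.filter_map, List.flatMap_map]
    simp only [Function.comp_def, h]
    induction (List.finRange n).filter fun i => decide (f i = m) with
    | nil => rfl
    | cons i l ih => rw [List.flatMap_cons, wordEval_append, ih, List.map_cons, List.prod_cons, harc]
  rw [jugglingPart]
  induction ms with
  | nil => rfl
  | cons m ms ih => rw [List.map_cons, List.prod_cons, ih, List.flatMap_cons, wordEval_append, hend]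

lemma jugglingBraid_eq_mul {n : ℕ} (k : ℕ) (f : Fin n → ℕ) :
    jugglingBraid k f = jugglingBraid₂ k f * jugglingBraid₁ k f := by
  have : (List.range (2 * n)).reverse = (List.range' n n).reverse ++ (List.range n).reverse := by
    rw [List.range_eq_range', List.range_eq_range', Nat.two_mul, ← List.range'_append]
    simp
  rw [jugglingBraid, this, jugglingBraid₁, jugglingBraid₂, jugglingPart, List.map_append,
    List.prod_append]
  rfl

/-! ### Braid groups: shifts, inclusions and Markov moves -/

lemma sigma_of_lt {n i : ℕ} (h : 1 ≤ i ∧ i < n) :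
    sigma n i = PresentedGroup.of (⟨i - 1, by omega⟩ : Fin (n - 1)) := by
  rw [sigma, dif_pos h]

lemma of_eq_sigma {n : ℕ} (i : Fin (n - 1)) :
    (PresentedGroup.of i : BraidGroup n) = sigma n (i + 1) := by
  rw [sigma_of_lt ⟨by omega, by omega⟩]
  rfl

theorem braidSeq_sigma (n : ℕ) : BraidSeq n (sigma n) where
  comm i j hi hij hj := by
    rw [sigma_of_lt ⟨hi, by omega⟩, sigma_of_lt ⟨by omega, hj⟩]
    have h : PresentedGroup.mk (braidRelations n) _ = 1 :=
      PresentedGroup.one_of_mem (rels := braidRelations n)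
        (Or.inl ⟨⟨i - 1, by omega⟩, ⟨j - 1, by omega⟩, by simp only; omega, rfl⟩)
    rw [map_mul, map_inv, mul_inv_eq_one] at h
    simp only [map_mul] at h
    exact h
  braid i hi hij := by
    rw [sigma_of_lt ⟨hi, by omega⟩, sigma_of_lt ⟨by omega, hij⟩]
    have h : PresentedGroup.mk (braidRelations n) _ = 1 :=
      PresentedGroup.one_of_mem (rels := braidRelations n)
        (Or.inr ⟨⟨i - 1, by omega⟩, ⟨i + 1 - 1, by omega⟩, by simp only; omega, rfl⟩)
    rw [map_mul, map_inv, mul_inv_eq_one] at h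
    simp only [map_mul] at h
    exact h

lemma BraidGroup.hom_ext {n : ℕ} {G : Type*} [Group G] {φ ψ : BraidGroup n →* G}
    (h : ∀ i, 1 ≤ i → i < n → φ (sigma n i) = ψ (sigma n i)) : φ = ψ :=
  PresentedGroup.ext fun i => by
    rw [of_eq_sigma]
    exact h _ (by omega) (by omega)

/-- The homomorphism from the braid group that is given by a sequence with the braid relations. -/
def BraidSeq.hom {n : ℕ} {G : Type*} [Group G] {s : ℕ → G} (h : BraidSeq n s) :
    BraidGroup n →* G :=
  PresentedGroup.toGroup (f := fun i : Fin (n - 1) => s (i + 1)) <| by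
    rintro r (⟨i, j, hij, rfl⟩ | ⟨i, j, hij, rfl⟩)
    · simp only [map_mul, map_inv, FreeGroup.lift_apply_of]
      rw [mul_inv_eq_one]
      exact h.comm _ _ (by omega) (by omega) (by omega)
    · simp only [map_mul, map_inv, FreeGroup.lift_apply_of]
      rw [mul_inv_eq_one, ← hij]
      exact h.braid _ (by omega) (by omega)

lemma BraidSeq.hom_sigma {n : ℕ} {G : Type*} [Group G] {s : ℕ → G} (h : BraidSeq n s) {i : ℕ}
    (hi : 1 ≤ i) (hin : i < n) : h.hom (sigma n i) = s i := by
  rw [sigma_of_lt ⟨hi, hin⟩, BraidSeq.hom, PresentedGroup.toGroup.of]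
  simp only
  congr 1
  omega

lemma map_wordEval {n : ℕ} {G : Type*} [Group G] {φ : BraidGroup n →* G} {t : ℕ → G}
    (h : ∀ i, 1 ≤ i → i < n → φ (sigma n i) = t i) {l : List ℕ} (hl : Letters n l) :
    φ (wordEval (sigma n) l) = wordEval t l := by
  induction l with
  | nil => simp
  | cons x l ih =>
    have hx := hl x (by simp)
    rw [wordEval_cons, map_mul, h x hx.1 hx.2, wordEval_cons, ih fun y hy => hl y (by simp [hy])]

lemma addStrand_sigma {n i : ℕ} (hi : 1 ≤ i) (hin : i < n) :
    addStrand n (sigma n i) = sigma (n + 1) i := by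
  rw [sigma_of_lt ⟨hi, hin⟩, addStrand, PresentedGroup.toGroup.of, sigma_of_lt ⟨hi, by omega⟩]

/-- The inclusion `σ_i ↦ σ_{i+1}`, which adds a disjoint trivial strand at the top. -/
def shiftStrand (n : ℕ) : BraidGroup n →* BraidGroup (n + 1) := (braidSeq_sigma (n + 1)).shift.hom

lemma shiftStrand_sigma {n i : ℕ} (hi : 1 ≤ i) (hin : i < n) :
    shiftStrand n (sigma n i) = sigma (n + 1) (i + 1) :=
  BraidSeq.hom_sigma _ hi hin

lemma shiftStrand_wordEval {n : ℕ} {l : List ℕ} (hl : Letters n l) :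
    shiftStrand n (wordEval (sigma n) l) = wordEval (sigma (n + 1)) (l.map (· + 1)) := by
  rw [wordEval_map_succ]
  exact map_wordEval (fun i => shiftStrand_sigma) hl

/-- The inclusion of `Br_k` into `Br_{k+m}` that adds `m` disjoint trivial strands at the bottom. -/
def addStrands (k : ℕ) : (m : ℕ) → BraidGroup k →* BraidGroup (k + m)
  | 0 => MonoidHom.id _
  | m + 1 => (addStrand (k + m)).comp (addStrands k m)

lemma addStrands_sigma {k i : ℕ} (m : ℕ) (hi : 1 ≤ i) (hik : i < k) :
    addStrands k m (sigma k i) = sigma (k + m) i := by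
  induction m with
  | zero => rfl
  | succ m ih =>
    rw [addStrands, MonoidHom.comp_apply, ih, addStrand_sigma hi (by omega)]
    rfl

/-- Conjugation by `σ_k ⋯ σ_1` raises the indices of `σ_1, …, σ_{k-1}` by one; both sides are
homomorphisms in `z`, so generators suffice. -/
lemma addStrands_mul_descWord {k m : ℕ} (z : BraidGroup k) :
    addStrands k (m + 1) z * wordEval (sigma (k + m + 1)) (descWord 1 k) =
      wordEval (sigma (k + m + 1)) (descWord 1 k) * shiftStrand (k + m) (addStrands k m z) := by
  set δ := wordEval (sigma (k + m + 1)) (descWord 1 k) with hδ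
  have : (MulAut.conj δ⁻¹).toMonoidHom.comp (addStrands k (m + 1)) =
      (shiftStrand (k + m)).comp (addStrands k m) := by
    refine BraidGroup.hom_ext fun i hi hik => ?_
    simp only [MonoidHom.comp_apply, MulEquiv.coe_toMonoidHom, MulAut.conj_apply, inv_inv]
    rw [addStrands_sigma _ hi hik, addStrands_sigma _ hi hik, shiftStrand_sigma hi (by omega),
      mul_assoc, inv_mul_eq_iff_eq_mul, hδ]
    exact (braidSeq_sigma (k + m + 1)).slide le_rfl hi (by omega) (by omega)
  have hz := DFunLike.congr_fun this z
  simp only [MonoidHom.comp_apply, MulEquiv.coe_toMonoidHom, MulAut.conj_apply, inv_inv] at hz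
  rw [← hz]
  group

/-- Markov moves act on the bottom strand while columns release the top one. Conjugation by the half
twist exchanges the two, and `γ` is the flip of `β`. -/
lemma isConj_shiftStrand {n : ℕ} (β : BraidGroup n) :
    ∃ γ : BraidGroup n, IsConj γ β ∧ IsConj (shiftStrand n β) (addStrand n γ) ∧
      IsConj (shiftStrand n β * sigma (n + 1) 1) (addStrand n γ * sigma (n + 1) n) := by
  set Δ := wordEval (sigma n) (deltaWord n) with hΔ
  set Δ' := wordEval (sigma (n + 1)) (deltaWord (n + 1)) with hΔ'
  have : (MulAut.conj Δ').toMonoidHom.comp (shiftStrand n) =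
      (addStrand n).comp (MulAut.conj Δ).toMonoidHom := by
    refine BraidGroup.hom_ext fun i hi hin => ?_
    simp only [MonoidHom.comp_apply, MulEquiv.coe_toMonoidHom, MulAut.conj_apply]
    rw [shiftStrand_sigma hi hin, (braidSeq_sigma (n + 1)).delta_flip (by omega) (by omega),
      (braidSeq_sigma n).delta_flip hi hin, mul_inv_cancel_right, mul_inv_cancel_right,
      addStrand_sigma (by omega) (by omega)]
    congr 1
    omega
  have hβ := DFunLike.congr_fun this β
  simp only [MonoidHom.comp_apply, MulEquiv.coe_toMonoidHom, MulAut.conj_apply] at hβ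
  refine ⟨Δ * β * Δ⁻¹, (isConj_iff.2 ⟨Δ, rfl⟩ : IsConj β _).symm, isConj_iff.2 ⟨Δ', hβ⟩,
    isConj_iff.2 ⟨Δ', ?_⟩⟩
  rcases Nat.eq_zero_or_pos n with rfl | hn
  · have h1 : sigma (0 + 1) 1 = 1 := by simp [sigma]
    have h0 : sigma (0 + 1) 0 = 1 := by simp [sigma]
    rw [h1, h0, mul_one, mul_one, hβ]
  · have h1 : Δ' * sigma (n + 1) 1 = sigma (n + 1) n * Δ' :=
      (braidSeq_sigma (n + 1)).delta_flip le_rfl (by omega)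
    rw [← hβ, eq_mul_inv_of_mul_eq h1.symm]
    group

section Markov

variable {N : ℕ} {α : BraidGroup N} {s n : ℕ}

lemma MarkovReduces.destabilize_shift {β : BraidGroup n} (hn : 1 ≤ n)
    (h : MarkovReduces α s (shiftStrand n β * sigma (n + 1) 1)) : MarkovReduces α s β := by
  obtain ⟨γ, h₁, _, h₃⟩ := isConj_shiftStrand β
  exact ((h.conj h₃).destabilize hn).conj h₁

lemma MarkovReduces.deleteStrand_shift {β : BraidGroup n}
    (h : MarkovReduces α s (shiftStrand n β)) : MarkovReduces α (s + 1) β := by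
  obtain ⟨γ, h₁, h₂, _⟩ := isConj_shiftStrand β
  exact ((h.conj h₂).deleteStrand).conj h₁

end Markov

/-- Conjugation of `σ_a` into `σ_1`. -/
lemma BraidSeq.conj_descWord {Γ : Type*} [Group Γ] {s : ℕ → Γ} {N a : ℕ} (h : BraidSeq N s)
    (haN : a + 1 < N) :
    (wordEval s (descWord 1 a))⁻¹ * s (a + 1) * wordEval s (descWord 1 a) =
      wordEval s (descWord 2 a) * s 1 * (wordEval s (descWord 2 a))⁻¹ := by
  have h₁ := h.slide_word (a := 1) (l := a + 1) le_rfl (by omega) (w := descWord 1 a)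
    fun x hx => by
      rw [mem_descWord] at hx
      omega
  have e : wordEval s (descWord 1 (a + 1)) = wordEval s (descWord 2 a) * s 1 := by
    rw [descWord_succ']
    simp
  rw [mul_assoc, inv_mul_eq_iff_eq_mul, ← mul_assoc, eq_mul_inv_iff_mul_eq, ← e, h₁,
    descWord_map_succ, descWord_succ, wordEval_cons, Nat.add_comm 1 a]

/-! ### Reduction of the Richardson braid, column by column -/

lemma gapWord_append (q : ℕ) (A B : List Bool) :
    gapWord q (A ++ B) = gapWord q A ++ gapWord (q + A.length) B := by
  induction A generalizing q with
  | nil => rfl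
  | cons b A ih =>
    have e : q + 1 + A.length = q + (A.length + 1) := by omega
    cases b <;> simp [gapWord, ih, e]

lemma gapWord_replicate (q p : ℕ) :
    gapWord q (List.replicate p false) = List.range' q p := by
  induction p generalizing q with
  | zero => rfl
  | succ p ih => rw [List.replicate_succ, gapWord, ih, List.range'_succ]

lemma tangle_replicate_append {Γ : Type*} [Group Γ] (s : ℕ → Γ) (p : ℕ) (bs : List Bool) :
    tangle s (List.replicate p false ++ bs) = tangle (fun i => s (i + p)) bs := by
  induction p generalizing s with
  | zero => rfl
  | succ p ih =>
    rw [List.replicate_succ, List.cons_append, tangle, ih]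
    simp only [Nat.add_assoc]

lemma tangle_replicate {Γ : Type*} [Group Γ] (s : ℕ → Γ) (p : ℕ) :
    tangle s (List.replicate p false) = 1 := by
  rw [← List.append_nil (List.replicate p false), tangle_replicate_append]
  rfl

lemma tangle_replicate_append_true {Γ : Type*} [Group Γ] (s : ℕ → Γ) (c : ℕ) (bs : List Bool) :
    tangle s (List.replicate c false ++ true :: bs) =
      (wordEval s (gapWord (c + 1) bs).reverse)⁻¹ * wordEval s (descWord (c + 1) bs.length) := by
  rw [tangle_replicate_append, tangle, wordEval_shift, wordEval_shift, List.map_reverse,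
    ← gapWord_add, descWord_map_add, Nat.add_comm 1 c]

lemma exists_replicate (bs : List Bool) :
    bs = List.replicate bs.length false ∨
      ∃ p bs', bs = List.replicate p false ++ true :: bs' := by
  induction bs with
  | nil => simp
  | cons b bs ih =>
    cases b with
    | true => exact Or.inr ⟨0, bs, rfl⟩
    | false =>
      rcases ih with h | ⟨p, bs', h⟩
      · left
        rw [List.length_cons, List.replicate_succ, ← h]
      · right
        exact ⟨p + 1, bs', by rw [List.replicate_succ, List.cons_append, ← h]⟩

lemma isConj_mul_comm {G : Type*} [Group G] (a b : G) : IsConj (a * b) (b * a) :=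
  isConj_iff.2 ⟨a⁻¹, by group⟩

section Markov

variable {N s k m q : ℕ} {α : BraidGroup N} {bs : List Bool} {z : BraidGroup k}
  {X : BraidGroup (k + m)}

/-- Here `q` counts the rows without a box in the first column, and `σ_q ⋯ σ_1` completes the word
of all its boxes to `σ_k ⋯ σ_1`. Pulling `z` through this word and rotating cyclically leaves the
top strand only in the factor in front of the shifted braid. -/
lemma markovReduces_conj_column (hk : q + bs.length = k)
    (hX : Commute (wordEval (sigma (k + m + 1)) (descWord 1 q)) (shiftStrand (k + m) X))
    (h : MarkovReduces α s (addStrands k (m + 1) z *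
      (wordEval (sigma (k + m + 1)) (descWord (q + 1) bs.length) * shiftStrand (k + m) X *
        (wordEval (sigma (k + m + 1)) (gapWord (q + 1) bs).reverse)⁻¹))) :
    MarkovReduces α s ((wordEval (sigma (k + m + 1)) (descWord 1 q))⁻¹ *
      (wordEval (sigma (k + m + 1)) (gapWord (q + 1) bs).reverse)⁻¹ *
      wordEval (sigma (k + m + 1)) (descWord 1 k) *
      shiftStrand (k + m) (addStrands k m z * X)) := by
  have hz := addStrands_mul_descWord (m := m) z
  have hδ : wordEval (sigma (k + m + 1)) (descWord 1 k) =
      wordEval (sigma (k + m + 1)) (descWord (q + 1) bs.length) *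
        wordEval (sigma (k + m + 1)) (descWord 1 q) := by
    rw [← wordEval_append, ← hk, descWord_add, Nat.add_comm 1 q]
  generalize addStrands k (m + 1) z = z' at *
  generalize wordEval (sigma (k + m + 1)) (gapWord (q + 1) bs).reverse = U at *
  generalize wordEval (sigma (k + m + 1)) (descWord 1 k) = δ at *
  generalize wordEval (sigma (k + m + 1)) (descWord 1 q) = W at *
  generalize wordEval (sigma (k + m + 1)) (descWord (q + 1) bs.length) = C at *
  have hC : C = δ * W⁻¹ := eq_mul_inv_of_mul_eq hδ.symm
  rw [map_mul]
  generalize shiftStrand (k + m) X = X' at *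
  generalize shiftStrand (k + m) (addStrands k m z) = y at *
  have e : z' * (C * X' * U⁻¹) = δ * (y * X' * W⁻¹ * U⁻¹) := by
    rw [hC, mul_assoc (y * X') , mul_assoc δ, hX.inv_left.eq]
    simp only [← mul_assoc]
    rw [hz]
  rw [e] at h
  have h₂ := h.conj (isConj_mul_comm δ _)
  have e₂ : y * X' * W⁻¹ * U⁻¹ * δ = (y * X') * (W⁻¹ * U⁻¹ * δ) := by group
  rw [e₂] at h₂
  exact h₂.conj (isConj_mul_comm _ _)

/-- Without dots the gap word is the word of the whole column, so the front factor cancels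
completely and the top strand is disjoint from the others. -/
lemma markovReduces_empty_column (hk : q + bs.length = k)
    (hbs : bs = List.replicate bs.length false)
    (hX : Commute (wordEval (sigma (k + m + 1)) (descWord 1 q)) (shiftStrand (k + m) X))
    (h : MarkovReduces α s (addStrands k (m + 1) z *
      (wordEval (sigma (k + m + 1)) (descWord (q + 1) bs.length) * shiftStrand (k + m) X *
        (wordEval (sigma (k + m + 1)) (gapWord (q + 1) bs).reverse)⁻¹))) :
    MarkovReduces α (s + 1) (addStrands k m z * X) := by
  have h' := markovReduces_conj_column hk hX h
  have hδ : wordEval (sigma (k + m + 1)) (descWord 1 k) =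
      wordEval (sigma (k + m + 1)) (gapWord (q + 1) bs).reverse *
        wordEval (sigma (k + m + 1)) (descWord 1 q) := by
    rw [← wordEval_append, ← hk, descWord_add, Nat.add_comm 1 q, hbs, gapWord_replicate]
    simp [descWord]
  rw [hδ] at h'
  refine MarkovReduces.deleteStrand_shift ?_
  convert h' using 1
  group

lemma markovReduces_dotted_column (hk : q + bs.length = k) {p : ℕ} {bs' : List Bool}
    (hbs : bs = List.replicate p false ++ true :: bs')
    (hX : Commute (wordEval (sigma (k + m + 1)) (descWord 1 q)) (shiftStrand (k + m) X))
    (h : MarkovReduces α s (addStrands k (m + 1) z *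
      (wordEval (sigma (k + m + 1)) (descWord (q + 1) bs.length) * shiftStrand (k + m) X *
        (wordEval (sigma (k + m + 1)) (gapWord (q + 1) bs).reverse)⁻¹))) :
    MarkovReduces α s (addStrands k m
      (tangle (sigma k) (List.replicate q false ++ bs) * z) * X) := by
  have h' := markovReduces_conj_column hk hX h
  have hl : bs.length = p + (bs'.length + 1) := by
    rw [hbs]
    simp
  set t := sigma (k + m + 1) with ht
  have hs : BraidSeq (k + m + 1) t := braidSeq_sigma _
  have hT : List.replicate q false ++ bs = List.replicate (q + p) false ++ true :: bs' := by
    rw [hbs, ← List.append_assoc, List.replicate_append_replicate]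
  have hU : wordEval t (gapWord (q + 1) bs).reverse =
      wordEval t (gapWord (q + p + 2) bs').reverse * wordEval t (descWord (q + 1) p) := by
    rw [hbs, gapWord_append, gapWord_replicate, List.length_replicate, gapWord,
      List.reverse_append, wordEval_append, show q + 1 + p + 1 = q + p + 2 by omega]
    rfl
  have hS : wordEval t (descWord 1 (q + p)) =
      wordEval t (descWord (q + 1) p) * wordEval t (descWord 1 q) := by
    rw [← wordEval_append, descWord_add, Nat.add_comm 1 q]
  have hδ : wordEval t (descWord 1 k) = wordEval t (descWord (q + p + 2) bs'.length) *
      (t (q + p + 1) * wordEval t (descWord 1 (q + p))) := by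
    have : descWord 1 k = descWord (q + p + 2) bs'.length ++
        (q + p + 1) :: descWord 1 (q + p) := by
      rw [← hk, hl, show q + (p + (bs'.length + 1)) = (q + p + 1) + bs'.length by omega,
        descWord_add, descWord_succ, show 1 + (q + p + 1) = q + p + 2 by omega,
        Nat.add_comm 1 (q + p)]
    rw [this, wordEval_append, wordEval_cons]
  have hconj := hs.conj_descWord (a := q + p) (by omega)
  have hcomm : ∀ w : List ℕ, (∀ x ∈ w, q + p + 2 ≤ x ∧ x < q + p + 2 + bs'.length) →
      Commute (wordEval t w) (wordEval t (descWord 1 (q + p))) := fun w hw =>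
    hs.comm_words (fun x hx => by have := hw x hx; constructor <;> omega)
      (letters_descWord le_rfl (by omega)) fun x hx y hy => by
        have := hw x hx
        rw [mem_descWord] at hy
        omega
  have c₁ := hcomm (gapWord (q + p + 2) bs').reverse fun x hx =>
    mem_gapWord (List.mem_reverse.1 hx)
  have c₂ := hcomm (descWord (q + p + 2) bs'.length) fun x hx => mem_descWord.1 hx
  set T := tangle (sigma k) (List.replicate q false ++ bs) with hTdef
  have hshT : shiftStrand (k + m) (addStrands k m T) =
      (wordEval t (gapWord (q + p + 2) bs').reverse)⁻¹ *
        wordEval t (descWord (q + p + 2) bs'.length) := by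
    rw [hTdef, hT, tangle_replicate_append_true, map_mul, map_mul, map_inv, map_inv]
    have key : ∀ w : List ℕ, (∀ x ∈ w, q + p + 1 ≤ x ∧ x < q + p + 1 + bs'.length) →
        shiftStrand (k + m) (addStrands k m (wordEval (sigma k) w)) =
          wordEval t (w.map (· + 1)) := fun w hw => by
      have hw' : Letters k w := fun x hx => by have := hw x hx; constructor <;> omega
      rw [map_wordEval (fun i h₁ h₂ => addStrands_sigma m h₁ h₂) hw',
        shiftStrand_wordEval (hw'.mono (by omega))]
    rw [key _ fun x hx => mem_gapWord (List.mem_reverse.1 hx),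
      key _ fun x hx => mem_descWord.1 hx, List.map_reverse, ← gapWord_succ, descWord_map_succ]
  have hE : shiftStrand (k + m) (wordEval (sigma (k + m)) (descWord 1 (q + p))) =
      wordEval t (descWord 2 (q + p)) := by
    rw [shiftStrand_wordEval (letters_descWord le_rfl (by omega)), descWord_map_succ]
  set e := wordEval (sigma (k + m)) (descWord 1 (q + p)) with he
  -- After the cancellation of common runs, the top strand remains only in a conjugate of
  -- `σ_{q+p+1}`, the generator at the first dot. By `BraidSeq.conj_descWord` this equals `σ_1`
  -- conjugated by a braid of the lower strands, so `σ_1` occurs once; the other factor is the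
  -- tangle.
  have hmain : (wordEval t (descWord 1 q))⁻¹ * (wordEval t (gapWord (q + 1) bs).reverse)⁻¹ *
      wordEval t (descWord 1 k) = shiftStrand (k + m) (addStrands k m T * e) *
        (t 1 * (shiftStrand (k + m) e)⁻¹) := by
    rw [map_mul, hshT, hE, mul_assoc _ (wordEval t (descWord 2 (q + p))),
      ← mul_assoc (wordEval t (descWord 2 (q + p))), ← hconj, hU, hδ, mul_inv_rev,
      ← mul_assoc (wordEval t (descWord 1 q))⁻¹, ← mul_inv_rev, ← hS]
    have c := (c₁.inv_left.mul_left c₂).inv_right.eq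
    simp only [← mul_assoc] at c ⊢
    rw [c]
  rw [hmain] at h'
  have e₁ : shiftStrand (k + m) (addStrands k m T * e) * (t 1 * (shiftStrand (k + m) e)⁻¹) *
      shiftStrand (k + m) (addStrands k m z * X) =
      (shiftStrand (k + m) (addStrands k m T * e) * t 1) *
        shiftStrand (k + m) (e⁻¹ * (addStrands k m z * X)) := by
    rw [map_mul _ e⁻¹, map_inv]
    group
  rw [e₁] at h'
  have h₂ := h'.conj (isConj_mul_comm _ _)
  rw [← mul_assoc, ← map_mul] at h₂
  have h₃ := (h₂.destabilize_shift (by omega)).conj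
    (show IsConj _ (addStrands k m (T * z) * X) from ?_)
  · exact h₃
  · have e₂ : e⁻¹ * (addStrands k m z * X) * (addStrands k m T * e) =
        e⁻¹ * ((addStrands k m z * X) * (addStrands k m T * e)) := by group
    rw [e₂]
    refine (isConj_mul_comm _ _).trans ?_
    rw [map_mul]
    have e₃ : addStrands k m z * X * (addStrands k m T * e) * e⁻¹ =
        (addStrands k m z * X) * addStrands k m T := by group
    rw [e₃, mul_assoc (addStrands k m T)]
    exact isConj_mul_comm _ _

end Markov

lemma colDots_append (q h : ℕ) (d : ℕ → Bool) (hd : ∀ i, h ≤ i → i < q + h → d i = false) :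
    colDots (q + h) d = List.replicate q false ++ colDots h d := by
  induction q with
  | zero => simp
  | succ q ih =>
    rw [Nat.add_right_comm, colDots, ih fun i hi hi' => hd i hi (by omega),
      hd _ (by omega) (by omega), List.replicate_succ, List.cons_append]

lemma colDots_false (k : ℕ) : colDots k (fun _ => false) = List.replicate k false := by
  simpa [colDots] using colDots_append k 0 (fun _ => false) fun _ _ _ => rfl

lemma letters_emptyWord (k m : ℕ) (r : ℕ → ℕ) (d : ℕ → ℕ → Bool) :
    Letters (k + m) (emptyWord k m r d) := by
  intro x hx
  simp only [emptyWord, List.mem_flatMap, List.mem_range, List.mem_map, List.mem_filter] at hx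
  obtain ⟨j, hj, i, ⟨hi, -⟩, rfl⟩ := hx
  omega

lemma exists_support {r : ℕ → ℕ} (hr : Antitone r) (k : ℕ) :
    ∃ q h, q + h = k ∧ ∀ i < k, 0 < r i ↔ i < h := by
  induction k with
  | zero => exact ⟨0, 0, rfl, by simp⟩
  | succ k ih =>
    obtain ⟨q, h, rfl, ih⟩ := ih
    by_cases hk : 0 < r (q + h)
    · refine ⟨0, q + h + 1, by omega, fun i hi => ⟨fun _ => hi, fun _ => ?_⟩⟩
      exact hk.trans_le (hr (by omega))
    · refine ⟨q + 1, h, by omega, fun i hi => ?_⟩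
      obtain hi | rfl : i < q + h ∨ i = q + h := by omega
      · exact ih i hi
      · exact ⟨fun h => absurd h hk, fun h => by omega⟩

lemma filter_support {q h : ℕ} {r : ℕ → ℕ} (hr : ∀ i < q + h, 0 < r i ↔ i < h) (d : ℕ → Bool) :
    (((List.range (q + h)).filter fun i => 0 < r i ∧ d i = false).map fun i => q + h - i) =
      (gapWord (q + 1) (colDots h d)).reverse := by
  rw [Nat.add_comm q 1, gapWord_add, ← List.map_reverse, gapWord_colDots, List.map_map,
    Nat.add_comm q h, List.range_add, List.filter_append, List.map_append]
  have h₁ : (((List.range q).map (h + ·)).filter fun i => 0 < r i ∧ d i = false) = [] := by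
    simp only [List.filter_eq_nil_iff, List.mem_map, List.mem_range]
    rintro _ ⟨i, hi, rfl⟩
    have := hr (h + i) (by omega)
    simp only [decide_eq_true_eq, not_and]
    omega
  have h₂ : ((List.range h).filter fun i => 0 < r i ∧ d i = false) =
      (List.range h).filter fun i => d i = false :=
    List.filter_congr fun i hi => by
      rw [List.mem_range] at hi
      simp [(hr i (by omega)).2 hi]
  rw [h₁, h₂, List.map_nil, List.append_nil]
  refine List.map_congr_left fun i hi => ?_
  have := List.mem_range.1 (List.mem_filter.1 hi).1
  simp only [Function.comp_apply]
  omega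

section Columns

variable {N : ℕ} {α : BraidGroup N}

/-- The columns of a diagram are removed one by one, from left to right. -/
theorem markovReduces_columns {k m s : ℕ} {r : ℕ → ℕ} (hr : Antitone r) {d : ℕ → ℕ → Bool}
    (hd : ∀ i j, d i j → j < r i) (z : BraidGroup k)
    (h : MarkovReduces α s (addStrands k m z *
      (wordEval (sigma (k + m)) (emptyWord k m r fun _ _ => false) *
        (wordEval (sigma (k + m)) (emptyWord k m r d))⁻¹))) :
    MarkovReduces α (s + Nat.count (fun j => ∀ i < k, d i j = false) m)
      (((List.range m).reverse.map fun j => tangle (sigma k) (colDots k fun i => d i j)).prod *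
        z) := by
  -- The factor `z` collects the tangles of the removed columns, and `X` below is the Richardson
  -- braid of the remaining diagram.
  induction m generalizing r d z s with
  | zero =>
    have e : ∀ d, emptyWord k 0 r d = [] := fun d => rfl
    rw [e, e, wordEval_nil, inv_one, mul_one, mul_one] at h
    rw [addStrands, MonoidHom.id_apply] at h
    simpa using h
  | succ m ih =>
    have hr' : Antitone fun i => r i - 1 := fun i j hij => Nat.sub_le_sub_right (hr hij) 1
    obtain ⟨q, l, hk, hl⟩ := exists_support hr k
    have hd0 : ∀ i, l ≤ i → i < q + l → d i 0 = false := fun i hi hi' => by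
      by_contra hne
      have := (hl i (by omega)).1 (hd i 0 (by simpa using hne))
      omega
    set X := wordEval (sigma (k + m)) (emptyWord k m (fun i => r i - 1) fun _ _ => false) *
      (wordEval (sigma (k + m)) (emptyWord k m (fun i => r i - 1) fun i j => d i (j + 1)))⁻¹
      with hX
    have hXs : shiftStrand (k + m) X =
        wordEval (sigma (k + m + 1))
            ((emptyWord k m (fun i => r i - 1) fun _ _ => false).map (· + 1)) *
          (wordEval (sigma (k + m + 1))
            ((emptyWord k m (fun i => r i - 1) fun i j => d i (j + 1)).map (· + 1)))⁻¹ := by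
      rw [hX, map_mul, map_inv, shiftStrand_wordEval (letters_emptyWord _ _ _ _),
        shiftStrand_wordEval (letters_emptyWord _ _ _ _)]
    -- After the shift, boxes of later columns carry letters at least `q + 2`, because they lie in
    -- rows that also meet the first column; the run `σ_q ⋯ σ_1` is therefore far away.
    have hcomm : ∀ d', Commute (wordEval (sigma (k + m + 1)) (descWord 1 q))
        (wordEval (sigma (k + m + 1)) ((emptyWord k m (fun i => r i - 1) d').map (· + 1))) :=
      fun d' => (braidSeq_sigma _).comm_words (letters_descWord le_rfl (by omega))
        (letters_emptyWord _ _ _ _).map_succ fun x hx y hy => by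
          rw [mem_descWord] at hx
          simp only [emptyWord, List.mem_map, List.mem_flatMap, List.mem_range,
            List.mem_filter, decide_eq_true_eq] at hy
          obtain ⟨_, ⟨j, hj, i, ⟨hi, hjr, -⟩, rfl⟩, rfl⟩ := hy
          have := (hl i hi).1 (by omega)
          omega
    have hlen : (colDots l fun i => d i 0).length = l := length_colDots ..
    have hcol : colDots k (fun i => d i 0) =
        List.replicate q false ++ colDots l fun i => d i 0 := by
      rw [← hk, colDots_append q l _ hd0]
    have hX' : Commute (wordEval (sigma (k + m + 1)) (descWord 1 q)) (shiftStrand (k + m) X) := by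
      rw [hXs]
      exact (hcomm _).mul_right (hcomm _).inv_right
    have hw : ∀ d' : ℕ → Bool, (((List.range k).filter fun i => 0 < r i ∧ d' i = false).map
        fun i => k - i) = (gapWord (q + 1) (colDots l d')).reverse := fun d' => by
      subst hk
      exact filter_support hl d'
    have h' : MarkovReduces α s (addStrands k (m + 1) z *
        (wordEval (sigma (k + m + 1)) (descWord (q + 1) (colDots l fun i => d i 0).length) *
          shiftStrand (k + m) X *
        (wordEval (sigma (k + m + 1)) (gapWord (q + 1) (colDots l fun i => d i 0)).reverse)⁻¹)) := by
      change MarkovReduces α s (addStrands k (m + 1) z *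
        (wordEval (sigma (k + m + 1)) (emptyWord k (m + 1) r fun _ _ => false) *
          (wordEval (sigma (k + m + 1)) (emptyWord k (m + 1) r d))⁻¹)) at h
      rw [emptyWord_col, emptyWord_col, hw fun _ => false, hw fun i => d i 0, wordEval_append,
        wordEval_append, colDots_false, gapWord_replicate, mul_inv_rev, ← descWord] at h
      rw [hXs, hlen]
      simpa only [mul_assoc] using h
    rw [List.range_succ_eq_map, List.reverse_cons, List.map_append, List.prod_append,
      ← List.map_reverse, List.map_map, Nat.count_succ', List.map_singleton, List.prod_singleton,
      mul_assoc]
    rcases exists_replicate (colDots l fun i => d i 0) with he | ⟨p, bs, he⟩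
    · have h0 : ∀ i < k, d i 0 = false := fun i hi => by
        by_cases hil : i < l
        · have := getD_colDots (fun i => d i 0) (show l - 1 - i < l by omega)
          rw [he, hlen, show l - 1 - (l - 1 - i) = i by omega] at this
          rw [← this]
          exact List.getD_replicate _ (by omega)
        · exact hd0 i (by omega) (by omega)
      rw [if_pos h0, hcol, he, List.replicate_append_replicate, tangle_replicate, one_mul,
        ← Nat.add_assoc, Nat.add_right_comm]
      exact ih hr' (fun i j hij => by have := hd i (j + 1) hij; omega) z
        (markovReduces_empty_column (by omega) he hX' h')
    · have hp : p < l := by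
        rw [← hlen, he]
        simp
      have h0 : ¬∀ i < k, d i 0 = false := fun h0 => by
        have := getD_colDots (fun i => d i 0) hp
        rw [he, h0 _ (by omega)] at this
        simp [List.getD_eq_getElem?_getD] at this
      rw [if_neg h0, Nat.add_zero]
      refine ih hr' (fun i j hij => by have := hd i (j + 1) hij; omega) _ ?_
      rw [hcol]
      exact markovReduces_dotted_column (by omega) he hX' h'

end Columns

/-! ### The column tangles of a Le diagram -/

lemma wordEval_reverse_inv {Γ : Type*} [Group Γ] (s : ℕ → Γ) (l : List ℕ) :
    (wordEval s l.reverse)⁻¹ = (l.map fun q => (s q)⁻¹).prod := by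
  induction l with
  | nil => simp
  | cons x l ih => simp [← ih]

lemma gapWord_eq_filter {q : ℕ} {bs : List Bool} {P : Finset ℕ}
    (h : ∀ p < bs.length, bs.getD p false = decide (q + p + 1 ∈ P)) :
    gapWord q bs = (List.range' q bs.length).filter fun x => x + 1 ∉ P := by
  induction bs generalizing q with
  | nil => rfl
  | cons b bs ih =>
    have h0 : b = decide (q + 1 ∈ P) := h 0 (by simp)
    have h1 := ih (q := q + 1) fun p hp => by
      rw [show q + 1 + p + 1 = q + (p + 1) + 1 by omega, ← h (p + 1) (by simpa using hp)]
      rfl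
    rw [List.length_cons, List.range'_succ]
    by_cases hq : q + 1 ∈ P
    · rw [h0, decide_eq_true hq, List.filter_cons_of_neg (by simpa using hq), gapWord, h1]
    · rw [h0, decide_eq_false hq, List.filter_cons_of_pos (by simpa using hq), gapWord, h1]

/-- The description of the column tangle by the list of its dots. -/
lemma columnTangle_eq_tangle {k : ℕ} {P : Finset ℕ} {bs : List Bool} (hk : bs.length = k)
    (h : ∀ p < bs.length, bs.getD p false = decide (p + 1 ∈ P)) (hP : ∀ x ∈ P, 1 ≤ x ∧ x ≤ k) :
    columnTangle k P = tangle (sigma k) bs := by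
  rcases exists_replicate bs with he | ⟨c, bs', rfl⟩
  · have : ¬P.Nonempty := by
      rintro ⟨x, hx⟩
      have hx' := hP x hx
      have := h (x - 1) (by omega)
      rw [he, List.getD_replicate _ (by omega), Nat.sub_add_cancel hx'.1, decide_eq_true hx] at this
      simp at this
    rw [columnTangle, dif_neg this, he, tangle_replicate]
  · have hl : c + 1 + bs'.length = k := by
      rw [← hk]
      simp
      omega
    have hc : c + 1 ∈ P := by
      have := h c (by simp)
      simpa [List.getD_eq_getElem?_getD] using this
    have hmin : ∀ x ∈ P, c + 1 ≤ x := fun x hx => by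
      by_contra hlt
      have hx' := hP x hx
      have := h (x - 1) (by rw [hk]; omega)
      rw [Nat.sub_add_cancel hx'.1, decide_eq_true hx, List.getD_append _ _ _ _ (by simp; omega),
        List.getD_replicate _ (by omega)] at this
      simp at this
    have hne : P.Nonempty := ⟨_, hc⟩
    have hgap : gapWord (c + 1) bs' =
        (List.range' (c + 1) bs'.length).filter fun x => x + 1 ∉ P :=
      gapWord_eq_filter fun p hp => by
        have := h (c + 1 + p) (by simp; omega)
        rw [← this, List.getD_append_right _ _ _ _ (by simp; omega), List.length_replicate,
          show c + 1 + p - c = p + 1 by omega]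
        rfl
    have e₁ : P.min' hne = c + 1 :=
      le_antisymm (P.min'_le _ hc) (hmin _ (P.min'_mem hne))
    have hM := hP _ (P.max'_mem hne)
    have hM' := hmin _ (P.max'_mem hne)
    have hmax : ∀ x ∈ P, x ≤ P.max' hne := fun x hx => P.le_max' x hx
    have hMP := P.max'_mem hne
    rw [columnTangle, dif_pos hne, e₁, tangle_replicate_append_true, hgap, intervalBraid]
    generalize P.max' hne = M at *
    obtain ⟨t, rfl⟩ := Nat.exists_eq_add_of_le hM'
    obtain ⟨e, he⟩ : ∃ e, bs'.length = t + e := ⟨bs'.length - t, by omega⟩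
    -- All rows below the lowest dot are gaps; their inverse crossings will cancel against the
    -- beginning of the descending word.
    have hkeep : ((List.range' (c + 1 + t) e).filter fun x => x + 1 ∉ P) =
        List.range' (c + 1 + t) e :=
      List.filter_eq_self.2 fun x hx => by
        rw [List.mem_range'_1] at hx
        simp only [decide_eq_true_eq]
        intro hxP
        have := hmax _ hxP
        omega
    -- The last place belongs to the lowest dot itself, hence is no gap and may be dropped.
    have hlast : ((List.range' (c + 1) t).filter fun x => x + 1 ∉ P) =
        (List.range' (c + 1) (t - 1)).filter fun x => x + 1 ∉ P := by
      cases t with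
      | zero => rfl
      | succ t =>
        rw [List.range'_1_concat, List.filter_append, List.filter_cons_of_neg (by
          simpa [Nat.add_assoc] using hMP)]
        simp
    have hsplit : List.range' (c + 1) (t + e) =
        List.range' (c + 1) t ++ List.range' (c + 1 + t) e := by
      rw [← List.range'_append_1]
    rw [he, hsplit, List.filter_append, hkeep, hlast, List.reverse_append, wordEval_append,
      descWord_add, wordEval_append, show c + 1 + t - 1 - (c + 1) = t - 1 by omega,
      show c + 1 + t - 1 + 1 - (c + 1) = t by omega, ← wordEval_reverse_inv, mul_inv_rev,
      ← descWord, ← descWord]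
    simp only [mul_assoc, inv_mul_cancel_left]
    rfl

lemma columnTangle_dotPositions (k : ℕ) (L : Finset (ℕ × ℕ)) (j : ℕ) :
    columnTangle k (dotPositions k L j) = tangle (sigma k) (colDots k fun i => (i, j) ∈ L) := by
  refine columnTangle_eq_tangle (length_colDots _ _) (fun p hp => ?_) fun x hx => ?_
  · rw [length_colDots] at hp
    rw [getD_colDots _ hp]
    congr 1
    simp only [dotPositions, Finset.mem_filter, Finset.mem_Icc, eq_iff_iff]
    rw [show k - (p + 1) = k - 1 - p by omega]
    constructor
    · exact fun h => ⟨⟨by omega, by omega⟩, h⟩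
    · exact fun h => h.2
  · exact Finset.mem_Icc.1 (Finset.mem_filter.1 hx).1

lemma halfTwist_eq (k : ℕ) : halfTwist k = wordEval (sigma k) (deltaWord k) := by
  have : ∀ m, ((List.range' 1 m).map (intervalBraid k 1)).prod =
      wordEval (sigma k) (deltaWord (m + 1)) := fun m => by
    induction m with
    | zero => simp [deltaWord]
    | succ m ih =>
      rw [List.range'_1_concat, List.map_append, List.prod_append, ih, deltaWord.eq_2 (m + 1),
        wordEval_append, List.map_singleton, List.prod_singleton, intervalBraid,
        Nat.add_sub_cancel, Nat.add_comm 1 m]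
      rfl
  rw [halfTwist, this]
  cases k with
  | zero => simp [deltaWord]
  | succ k => rfl

/-! ### The path of a Le diagram -/

section Path

variable {k n : ℕ} {r : ℕ → ℕ}

lemma one_le_of_high_low (d : ℕ → ℕ → Bool) (h : IsShape k n r) {f : ℕ → ℕ}
    (hV : (dotPath n k r d).Valid) (hhigh : ∀ i ∈ (emptyPath n k r).high, 1 ≤ f i)
    (hlow : ∀ c i y : ℕ, (emptyPath n k r).low[c]? = some i →
      (dotPath n k r d).low[c]? = some y → 1 ≤ f i) : ∀ i < n, 1 ≤ f i := by
  intro i hi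
  have h₁ := DotPath.high_perm (valid_emptyPath h)
  have h₂ := DotPath.high_perm hV
  have l₁ : (emptyPath n k r).length = n := length_dotPath ..
  have l₂ : (dotPath n k r d).length = n := length_dotPath ..
  have r₁ : (emptyPath n k r).rows = k := rows_dotPath _ h
  have r₂ : (dotPath n k r d).rows = k := rows_dotPath _ h
  have e₁ := h₁.2.length_eq
  have e₂ := h₂.2.length_eq
  rw [List.length_append, List.length_range] at e₁ e₂
  have hmem := h₁.2.mem_iff.2 (List.mem_range.2 (l₁.symm ▸ hi))
  rcases List.mem_append.1 hmem with hm | hm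
  · exact hhigh i hm
  · obtain ⟨c, hc⟩ := List.mem_iff_getElem?.1 hm
    have hcl := (List.getElem?_eq_some_iff.1 hc).1
    exact hlow c i _ hc (List.getElem?_eq_getElem (by omega))

/-- Corresponding entries of the windows of `w⁻¹` and `u⁻¹` are start and end of an arc. For a
column the first low entries are 0 and the carried letter, which is the value at 0 that the path
prescribes. -/
lemma matches_dotPath (d : ℕ → ℕ → Bool) (h : IsShape k n r) {f : ℕ → ℕ}
    (hV : (dotPath n k r d).Valid)
    (hhigh : ∀ i ∈ (emptyPath n k r).high, n ≤ f i)
    (hlow : ∀ c i y : ℕ, (emptyPath n k r).low[c]? = some i → (dotPath n k r d).low[c]? = some y →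
      f i = y) : (dotPath n k r d).Matches f := by
  induction d, h using IsShape.induction generalizing f with
  | nil r d h => trivial
  | row k n r d h h' h0 ih =>
    rw [(high_low_emptyPath_row h0).1] at hhigh
    rw [(high_low_emptyPath_row h0).2] at hlow
    rw [dotPath_row d h0] at hV hlow ⊢
    rw [DotPath.low] at hlow
    have key : ∀ i < n, 1 ≤ f (i + 1) := one_le_of_high_low d h' (f := fun i => f (i + 1)) hV
      (fun i hi => le_add_self.trans (hhigh (i + 1) (by simpa using hi))) fun c i y hi hy => by
        have := hlow c (i + 1) (y + 1) (by simp [hi]) (by simp [hy])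
        simp [this]
    refine ⟨?_, ?_, ih hV (fun i hi => ?_) fun c i y hi hy => ?_⟩
    · rw [length_dotPath]
      exact hhigh 0 (by simp)
    · rw [length_dotPath]
      exact key
    · have := hhigh (i + 1) (by simpa using hi)
      omega
    · have := hlow c (i + 1) (y + 1) (by simp [hi]) (by simp [hy])
      simp [this]
  | col k n r d h h' h1 ih =>
    rw [(high_low_emptyPath_col h' h1).1] at hhigh
    rw [(high_low_emptyPath_col h' h1).2] at hlow
    rw [dotPath_col d h1] at hV hlow ⊢
    rw [DotPath.low] at hlow
    have key : ∀ i < n, 1 ≤ f (i + 1) :=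
      one_le_of_high_low _ h' (f := fun i => f (i + 1)) hV.2.2
      (fun i hi => le_add_self.trans (hhigh (i + 1) (by simpa using hi))) fun c i y hi hy => by
        have := hlow (c + 1) (i + 1) (y + 1) (by simp [hi]) (by simp [hy])
        simp [this]
    refine ⟨?_, ?_, ih hV.2.2 (fun i hi => ?_) fun c i y hi hy => ?_⟩
    · exact hlow 0 0 _ rfl rfl
    · rw [length_dotPath]
      exact key
    · have := hhigh (i + 1) (by simpa using hi)
      omega
    · have := hlow (c + 1) (i + 1) (y + 1) (by simp [hi]) (by simp [hy])
      simp [this]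

lemma filter_eq_high_emptyPath (h : IsShape k n r) {p : ℕ → Bool}
    (hhigh : ∀ i ∈ (emptyPath n k r).high, p i) (hlow : ∀ i ∈ (emptyPath n k r).low, ¬p i) :
    (List.range n).filter p = (emptyPath n k r).high := by
  obtain ⟨d⟩ : Nonempty (ℕ → ℕ → Bool) := ⟨fun _ _ => false⟩
  induction d, h using IsShape.induction generalizing p with
  | nil r d h => rfl
  | row k n r d h h' h0 ih =>
    rw [(high_low_emptyPath_row h0).1] at hhigh ⊢
    rw [(high_low_emptyPath_row h0).2] at hlow
    rw [List.range_succ_eq_map, List.filter_cons_of_pos (hhigh 0 (by simp)), List.filter_map,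
      ih (p := p ∘ Nat.succ) (fun i hi => hhigh (i + 1) (by simp [hi]))
        fun i hi => hlow (i + 1) (by simp [hi])]
  | col k n r d h h' h1 ih =>
    rw [(high_low_emptyPath_col h' h1).1] at hhigh ⊢
    rw [(high_low_emptyPath_col h' h1).2] at hlow
    rw [List.range_succ_eq_map, List.filter_cons_of_neg (hlow 0 (by simp)), List.filter_map,
      ih (p := p ∘ Nat.succ) (fun i hi => hhigh (i + 1) (by simp [hi]))
        fun i hi => hlow (i + 1) (by simp [hi])]

lemma mem_colDots {k : ℕ} {d : ℕ → Bool} {b : Bool} : b ∈ colDots k d ↔ ∃ i < k, d i = b := by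
  induction k with
  | zero => simp [colDots]
  | succ k ih =>
    rw [colDots, List.mem_cons, ih]
    constructor
    · rintro (rfl | ⟨i, hi, rfl⟩)
      · exact ⟨k, by omega, rfl⟩
      · exact ⟨i, by omega, rfl⟩
    · rintro ⟨i, hi, rfl⟩
      obtain rfl | hi := (Nat.le_of_lt_succ hi).eq_or_lt
      · exact Or.inl rfl
      · exact Or.inr ⟨i, hi, rfl⟩

lemma emptyCols_dotPath (d : ℕ → ℕ → Bool) (h : IsShape k n r) (hd : ∀ i j, d i j → j < r i) :
    (dotPath n k r d).emptyCols = Nat.count (fun j => ∀ i < k, d i j = false) (n - k) := by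
  induction d, h using IsShape.induction with
  | nil r d h => rfl
  | row k n r d h h' h0 ih =>
    rw [dotPath_row d h0, DotPath.emptyCols, ih hd, Nat.add_sub_add_right]
    refine count_congr fun j _ => ⟨fun hj i hi => ?_, fun hj i hi => hj i (by omega)⟩
    obtain rfl | hi := (Nat.le_of_lt_succ hi).eq_or_lt
    · by_contra hc
      have := hd i j (by simpa using hc)
      omega
    · exact hj i hi
  | col k n r d h h' h1 ih =>
    rw [dotPath_col d h1, DotPath.emptyCols, ih fun i j hij => by
      have := hd _ _ hij
      beta_reduce at *
      omega, Nat.succ_sub h'.le, Nat.count_succ']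
    congr 1
    by_cases hc : ∀ i < k, d i 0 = false
    · rw [if_pos hc, if_neg]
      rw [mem_colDots]
      rintro ⟨i, hi, hi'⟩
      simp [hc i hi] at hi'
    · rw [if_neg hc, if_pos]
      rw [mem_colDots]
      push Not at hc
      obtain ⟨i, hi, hi'⟩ := hc
      exact ⟨i, hi, by simpa using hi'⟩

end Path

/-! ### Positroid pairs -/

section Positroid

variable {k n : ℕ} {u w : Perm (Fin n)}

/-- The bounded affine permutation as a function on the natural numbers. -/
def windowExtend (f : Fin n → ℕ) (i : ℕ) : ℕ := if h : i < n then f ⟨i, h⟩ else 0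

lemma windowExtend_coe (f : Fin n → ℕ) (i : Fin n) : windowExtend f i = f i := by
  rw [windowExtend, dif_pos i.2]

lemma injOn_boundedAffine (k : ℕ) (u w : Perm (Fin n)) :
    Set.InjOn (windowExtend (boundedAffine k u w)) {i | i < n} := by
  intro i hi j hj e
  rw [Set.mem_ofPred_eq] at hi hj
  simp only [windowExtend, dif_pos hi, dif_pos hj, boundedAffine] at e
  have h₁ := (u⁻¹ (w ⟨i, hi⟩)).2
  have h₂ := (u⁻¹ (w ⟨j, hj⟩)).2
  have : (u⁻¹ (w ⟨i, hi⟩) : ℕ) = u⁻¹ (w ⟨j, hj⟩) := by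
    split_ifs at e <;> omega
  have := w.injective (u⁻¹.injective (Fin.ext this))
  simpa using this

lemma boundedAffine_of_getElem? {c i y : ℕ} (hi : (invWindow w)[c]? = some i)
    (hy : (invWindow u)[c]? = some y) :
    windowExtend (boundedAffine k u w) i = y + if c < k then n else 0 := by
  have hc : c < n := by
    have := (List.getElem?_eq_some_iff.1 hi).1
    rwa [length_invWindow] at this
  have h₁ := getElem?_invWindow w ⟨c, hc⟩
  have h₂ := getElem?_invWindow u ⟨c, hc⟩
  simp only at h₁ h₂
  rw [hi, Option.some_inj] at h₁
  rw [hy, Option.some_inj] at h₂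
  have e := windowExtend_coe (boundedAffine k u w) (w⁻¹ ⟨c, hc⟩)
  rw [← h₁] at e
  rw [e, boundedAffine, show w (w⁻¹ ⟨c, hc⟩) = ⟨c, hc⟩ by simp, h₂]

/-- Both words complete the ascent braid of the window of `u⁻¹` to the half twist, so they can be
cancelled against each other. -/
lemma IsReducedWord.wordEval_eq {Γ : Type*} [Group Γ] {s : ℕ → Γ} (hs : BraidSeq n s)
    {S : DotPath} (hS : S.Valid) (hn : S.length = n) (hu : invWindow u = S.high ++ S.low)
    {a : List ℕ} (h : IsReducedWord u a) : wordEval s a = wordEval s S.gaps := by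
  subst hn
  have h₁ := h.ascentWord_mul hs
  rw [hu, ← DotPath.ascentWord_mul_gaps hS hs] at h₁
  exact mul_left_cancel h₁

lemma emptyBoxWord_eq (k : ℕ) (w : Perm (Fin n)) (L : Finset (ℕ × ℕ)) :
    emptyBoxWord k w L = emptyWord k (n - k) (rowLength k w) fun i j => (i, j) ∈ L := by
  simp only [emptyBoxWord, emptyWord, decide_eq_false_iff_not]

lemma invWindow_emptyBoxWord (hkn : k ≤ n) (hw : IsGrassmannian k w) {L : Finset (ℕ × ℕ)}
    (hS : (dotPath n k (rowLength k w) fun i j => (i, j) ∈ L).Valid) :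
    invWindow ((emptyBoxWord k w L).map (simpleTransposition n)).prod =
      (dotPath n k (rowLength k w) fun i j => (i, j) ∈ L).high ++
        (dotPath n k (rowLength k w) fun i j => (i, j) ∈ L).low := by
  have hlet : Letters n (emptyBoxWord k w L) := by
    have := letters_emptyWord k (n - k) (rowLength k w) fun i j => (i, j) ∈ L
    rwa [Nat.add_sub_cancel' hkn, ← emptyBoxWord_eq] at this
  rw [invWindow_prod hlet, ← DotPath.wordAct_gaps hS, gaps_dotPath _ (hw.isShape hkn),
    length_dotPath, emptyBoxWord_eq]

/-- The tableau criterion supplies the rank conditions for the backward passes. The resulting dots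
lie in the boxes of the shape, so they form a finite set, and validity of the path is the Le
condition. -/
theorem IsPositroidPair.exists_isLeDiagramOf (hkn : k ≤ n) (h : IsPositroidPair k u w) :
    ∃ L, IsLeDiagramOf k u w L := by
  obtain ⟨hw, huw⟩ := h
  have hS := hw.isShape hkn
  obtain ⟨e₁, e₂⟩ := hw.invWindow_eq hkn
  obtain ⟨d, hd, hV, h₁, h₂⟩ := exists_dots hS (V := (invWindow u).take k)
    (Z := (invWindow u).drop k) (by simp [length_invWindow, hkn])
    (by rw [List.take_append_drop]; exact invWindow_perm u) fun t M => by
      rw [← e₁, ← e₂, List.take_append_drop, List.take_append_drop]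
      exact huw.countP_take_le t M
  have hL : ∃ L : Finset (ℕ × ℕ), (fun i j => decide ((i, j) ∈ L)) = d := by
    refine ⟨(Finset.range k ×ˢ Finset.range (n - k)).filter fun c => d c.1 c.2, ?_⟩
    funext i j
    simp only [Finset.mem_filter, Finset.mem_product, Finset.mem_range]
    rw [Bool.eq_iff_iff, decide_eq_true_eq]
    refine ⟨fun h => h.2, fun h => ⟨⟨?_, ?_⟩, h⟩⟩
    · by_contra hik
      have := hd i j h
      rw [hS.zero i (by omega)] at this
      omega
    · exact (hd i j h).trans_le (hS.bound i)
  obtain ⟨L, rfl⟩ := hL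
  refine ⟨L, ⟨fun c hc => hd c.1 c.2 (by simpa using hc), fun r₁ r₂ c₁ c₂ h₁ h₂ hr hc hlt => ?_⟩, ?_⟩
  · simpa using (isLe_of_valid _ hS hd hV).1 r₁ r₂ c₁ c₂ (by simpa using h₁) (by simpa using h₂)
      hr hc hlt
  · refine invWindow_injective ?_
    rw [invWindow_emptyBoxWord hkn hw hV, h₁, h₂, List.take_append_drop]

/-- The path of a Le diagram of a positroid pair. -/
structure IsPathOf (k : ℕ) (u w : Perm (Fin n)) (L : Finset (ℕ × ℕ)) : Prop where
  shape : IsShape k n (rowLength k w)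
  box : ∀ i j, (decide ((i, j) ∈ L) : Bool) → j < rowLength k w i
  valid : (dotPath n k (rowLength k w) fun i j => (i, j) ∈ L).Valid
  high : (dotPath n k (rowLength k w) fun i j => (i, j) ∈ L).high = (invWindow u).take k
  low : (dotPath n k (rowLength k w) fun i j => (i, j) ∈ L).low = (invWindow u).drop k
  matches_window : (dotPath n k (rowLength k w) fun i j => (i, j) ∈ L).Matches
    (windowExtend (boundedAffine k u w))
  filter_window : ((List.range n).map (windowExtend (boundedAffine k u w))).filter (n ≤ ·) =
    ((dotPath n k (rowLength k w) fun i j => (i, j) ∈ L).high).map (· + n)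

theorem IsLeDiagramOf.isPathOf (hkn : k ≤ n) (hw : IsGrassmannian k w) {L : Finset (ℕ × ℕ)}
    (h : IsLeDiagramOf k u w L) : IsPathOf k u w L := by
  have hS := hw.isShape hkn
  have hd : ∀ i j, (decide ((i, j) ∈ L) : Bool) → j < rowLength k w i := fun i j hij =>
    h.1.1 (i, j) (by simpa using hij)
  set S := dotPath n k (rowLength k w) fun i j => (i, j) ∈ L with hSdef
  have hV : S.Valid := (valid_dotPath _ hS fun r₁ r₂ c₁ c₂ h₁ h₂ hr hc hlt => by
    simpa using h.1.2 r₁ r₂ c₁ c₂ (by simpa using h₁) (by simpa using h₂) hr hc hlt).1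
  have hu : invWindow u = S.high ++ S.low := by
    rw [← h.2]
    exact invWindow_emptyBoxWord hkn hw hV
  have hlen : S.high.length = k := by
    rw [(DotPath.high_perm hV).1]
    exact rows_dotPath _ hS
  have hhigh : S.high = (invWindow u).take k := by
    rw [hu, ← hlen, List.take_left]
  have hlow : S.low = (invWindow u).drop k := by
    rw [hu, ← hlen, List.drop_left]
  obtain ⟨e₁, e₂⟩ := hw.invWindow_eq hkn
  have f_high : ∀ c i y : ℕ, (emptyPath n k (rowLength k w)).high[c]? = some i →
      S.high[c]? = some y → windowExtend (boundedAffine k u w) i = y + n := fun c i y hi hy => by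
    have hc : c < k := hlen ▸ (List.getElem?_eq_some_iff.1 hy).1
    rw [← e₁, List.getElem?_take_of_lt hc] at hi
    rw [hhigh, List.getElem?_take_of_lt hc] at hy
    rw [boundedAffine_of_getElem? hi hy, if_pos hc]
  have f_low : ∀ c i y : ℕ, (emptyPath n k (rowLength k w)).low[c]? = some i →
      S.low[c]? = some y → windowExtend (boundedAffine k u w) i = y := fun c i y hi hy => by
    rw [← e₂, List.getElem?_drop] at hi
    rw [hlow, List.getElem?_drop] at hy
    rw [boundedAffine_of_getElem? hi hy, if_neg (by omega), Nat.add_zero]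
  have hlen₀ := length_high_emptyPath hS
  have g_high : ∀ i ∈ (emptyPath n k (rowLength k w)).high,
      n ≤ windowExtend (boundedAffine k u w) i := fun i hi => by
    obtain ⟨c, hc⟩ := List.mem_iff_getElem?.1 hi
    have hcl := (List.getElem?_eq_some_iff.1 hc).1
    rw [f_high c i _ hc (List.getElem?_eq_getElem (by omega))]
    omega
  have g_low : ∀ i ∈ (emptyPath n k (rowLength k w)).low,
      windowExtend (boundedAffine k u w) i < n := fun i hi => by
    obtain ⟨c, hc⟩ := List.mem_iff_getElem?.1 hi
    have hcl := (List.getElem?_eq_some_iff.1 hc).1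
    have hcl' : c < S.low.length := by
      rw [hlow, List.length_drop, length_invWindow]
      rwa [← e₂, List.length_drop, length_invWindow] at hcl
    rw [f_low c i _ hc (List.getElem?_eq_getElem hcl')]
    have : S.low[c] ∈ invWindow u := by
      rw [hu]
      simp
    exact (mem_invWindow u).1 this
  refine ⟨hS, hd, hV, hhigh, hlow, matches_dotPath _ hS hV g_high f_low, ?_⟩
  rw [← hSdef, List.filter_map, Function.comp_def, filter_eq_high_emptyPath hS
    (fun i hi => by simpa using g_high i hi) fun i hi => by simpa using g_low i hi]
  refine List.ext_getElem? fun c => ?_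
  by_cases hc : c < k
  · rw [List.getElem?_map, List.getElem?_map, List.getElem?_eq_getElem (by omega),
      List.getElem?_eq_getElem (by omega), Option.map_some, Option.map_some,
      f_high c _ _ (List.getElem?_eq_getElem (by omega)) (List.getElem?_eq_getElem (by omega))]
  · rw [List.getElem?_eq_none (by simp; omega), List.getElem?_eq_none (by simp; omega)]

variable {L : Finset (ℕ × ℕ)}

lemma IsPathOf.leBraid_eq_braid (h : IsPathOf k u w L) : leBraid k n L =
    (dotPath n k (rowLength k w) fun i j => (i, j) ∈ L).braid (sigma k) := by
  rw [braid_dotPath _ _ h.shape h.box, leBraid]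
  simp only [columnTangle_dotPositions]

theorem IsPathOf.leBraid_eq (h : IsPathOf k u w L) : leBraid k n L =
    jugglingBraid₁ k (boundedAffine k u w) * (halfTwist k)⁻¹ *
      jugglingBraid₂ k (boundedAffine k u w) := by
  have hr : (dotPath n k (rowLength k w) fun i j => (i, j) ∈ L).rows = k := rows_dotPath _ h.shape
  have hb := braidSeq_sigma k
  have h₁ := DotPath.wordEval_arcs_low (s := sigma k) h.valid h.matches_window
    (by rw [length_dotPath]; exact injOn_boundedAffine k u w) (by rwa [hr])
  rw [length_dotPath] at h₁
  rw [h.leBraid_eq_braid, DotPath.braid_eq h.valid (by rwa [hr]), length_dotPath, hr, halfTwist_eq,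
    jugglingBraid₁, jugglingBraid₂, jugglingPart_eq k (windowExtend_coe _),
    jugglingPart_eq k (windowExtend_coe _), h₁,
    arcs_high (injOn_boundedAffine k u w) h.filter_window]

theorem IsPathOf.fixedCount_eq (h : IsPathOf k u w L) : fixedCount (boundedAffine k u w) =
    Nat.count (fun j => ∀ i < k, decide ((i, j) ∈ L) = false) (n - k) := by
  rw [← emptyCols_dotPath _ h.shape h.box, ← DotPath.count_fixed h.valid h.matches_window, length_dotPath,
    ← card_filter_fin, fixedCount]
  congr 1
  ext i
  simp only [windowExtend_coe]

theorem IsPathOf.markovReduces (hkn : k ≤ n) (hw : IsGrassmannian k w) (h : IsPathOf k u w L)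
    {a b : List ℕ} (ha : IsReducedWord w a) (hb : IsReducedWord u b) :
    MarkovReduces (richardsonBraid n a b) (fixedCount (boundedAffine k u w)) (leBraid k n L) := by
  have hu : invWindow u = (dotPath n k (rowLength k w) fun i j => (i, j) ∈ L).high ++
      (dotPath n k (rowLength k w) fun i j => (i, j) ∈ L).low := by
    rw [h.high, h.low, List.take_append_drop]
  have hw' : invWindow w = (emptyPath n k (rowLength k w)).high ++
      (emptyPath n k (rowLength k w)).low := by
    obtain ⟨e₁, e₂⟩ := hw.invWindow_eq hkn
    rw [← e₁, ← e₂, List.take_append_drop]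
  -- Both lifts are gap words: `w` belongs to the diagram of the same shape without any dots.
  have hR : richardsonBraid n a b =
      wordEval (sigma n) (emptyWord k (n - k) (rowLength k w) fun _ _ => false) *
        (wordEval (sigma n) (emptyWord k (n - k) (rowLength k w) fun i j => (i, j) ∈ L))⁻¹ := by
    rw [← gaps_dotPath _ h.shape, ← gaps_dotPath _ h.shape,
      ← hb.wordEval_eq (braidSeq_sigma n) h.valid (length_dotPath ..) hu, ← emptyPath,
      ← ha.wordEval_eq (braidSeq_sigma n) (valid_emptyPath h.shape) (length_dotPath ..) hw']
    rfl
  rw [h.fixedCount_eq, leBraid]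
  simp only [columnTangle_dotPositions]
  have hbox := h.box
  have hanti := h.shape.antitone
  generalize rowLength k w = r at *
  obtain ⟨m, rfl⟩ := Nat.exists_eq_add_of_le hkn
  rw [Nat.add_sub_cancel_left] at *
  have := markovReduces_columns (α := richardsonBraid (k + m) a b) (s := 0) (m := m) hanti hbox 1
    (by rw [map_one, one_mul, ← hR]; exact MarkovReduces.refl)
  rwa [mul_one, Nat.zero_add] at this

end Positroid

theorem theorem3p17 (k n : ℕ) (hkn : k ≤ n) (u w : Equiv.Perm (Fin n))
    (huw : IsPositroidPair k u w) :
    (∃ L : Finset (ℕ × ℕ), IsLeDiagramOf k u w L) ∧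
    ∀ L : Finset (ℕ × ℕ), IsLeDiagramOf k u w L →
      leBraid k n L =
        jugglingBraid₁ k (boundedAffine k u w) * (halfTwist k)⁻¹ *
          jugglingBraid₂ k (boundedAffine k u w) ∧
      IsConj (jugglingBraid k (boundedAffine k u w) * (halfTwist k)⁻¹) (leBraid k n L) ∧
      ∀ a b : List ℕ, IsReducedWord w a → IsReducedWord u b →
        MarkovReduces (richardsonBraid n a b) (fixedCount (boundedAffine k u w))
          (leBraid k n L) ∧
        MarkovReduces (richardsonBraid n a b) (fixedCount (boundedAffine k u w))
          (jugglingBraid k (boundedAffine k u w) * (halfTwist k)⁻¹) := by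
  refine ⟨huw.exists_isLeDiagramOf hkn, fun L hL => ?_⟩
  have hP := hL.isPathOf hkn huw.1
  have hconj : IsConj (jugglingBraid k (boundedAffine k u w) * (halfTwist k)⁻¹)
      (leBraid k n L) := by
    -- Moving the factor `J⁽²⁾` from the front to the end is a conjugation.
    rw [hP.leBraid_eq, jugglingBraid_eq_mul, mul_assoc]
    exact isConj_mul_comm _ _
  refine ⟨hP.leBraid_eq, hconj, fun a b ha hb => ?_⟩
  have h := hP.markovReduces hkn huw.1 ha hb
  exact ⟨h, h.conj hconj.symm⟩
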